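/- **Setting.** Let $Y_i=g(t_i)+\xi_i$, $t_i=i/n$, $i=1,\dots,n$, where $(\xi_i)$ is a zero-mean, second order stationary Gaussian process whose autocovariance $\gamma(k)=E(\xi_i\xi_{i+k})$ satisfies $\gamma(k)\sim C_\gamma|k|^{-\alpha}$ as $k\to\infty$, for constants $\alpha\in(0,1)$ and $C_\gamma>0$. Let $N\in\mathbb N$, and let $\phi,\psi:\mathbb R\to\mathbb R$ be father and mother wavelets supported in $[0,N]$ with $\int\phi=\int\phi^2=\int\psi^2=1$ and $\psi(0)=\psi(N)=0$, such that for every integer $J\ge 0$ the functions $$\phi_{Jk}(t)=N^{1/2}2^{J/2}\phi(N2^{J}t-k),\qquad \psi_{jk}(t)=N^{1/2}2^{(J+j)/2}\psi(N2^{J+j}t-k)\qquad (k\in\mathbb Z,\ j\ge 0)$$ form an orthonormal basis of $L^2(\mathbb R)$. Each of $\phi,\psi$ is either piecewise differentiable on $[0,N]$ (the derivative exists except at finitely many points and is bounded where it exists) or uniformly Hölder continuous with exponent $1/2$ on $[0,N]$. Let $r\ge1$ and suppose that $\psi$ has exactly $r$ vanishing moments: $\int_0^N t^k\psi(t)\,dt=0$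 for $0\le k<r$ and $\int_0^N t^r\psi(t)\,dt\ne0$. For a decomposition level $J\ge0$, a smoothing parameter $q\ge0$ and thresholds $\delta_j\in[0,\infty]$, the hard thresholding wavelet estimator is $$\hat g(t)=\sum_{k=-N+1}^{N2^J-1}\hat s_{Jk}\phi_{Jk}(t)+\sum_{j=0}^{q}\ \sum_{k=-N+1}^{N2^{J+j}-1}\hat d_{jk}\,I(|\hat d_{jk}|>\delta_j)\,\psi_{jk}(t),$$ with $\hat s_{Jk}=\frac1n\sum_{i=1}^nY_i\phi_{Jk}(t_i)$ and $\hat d_{jk}=\frac1n\sum_{i=1}^nY_i\psi_{jk}(t_i)$. Its mean integrated squared error is $\mathrm{MISE}_n(J,q,\{\delta_j\})=E\int_0^1(g(t)-\hat g(t))^2\,dt\in[0,\infty]$. Only decomposition levels $J=J_n$ with $2^{J_n}=o(n)$ are admitted. **Theorem 1.** Suppose that $g\in C^r[0,1]$ and that $\{t\in[0,1]: g^{(r)}(t)\ne0\}$ has positive Lebesgue measure. Then the optimal order of the MISE, when minimized over $J$, $q$ and $\{\delta_j\}$, is $n^{-2r\alpha/(2r+\alpha)}$. That is, there are constants $c,C>0$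 such that: 1. there are sequences $J_n$ with $2^{J_n}=o(n)$, $q_n$ and $\{\delta_{j,n}\}$ with $\mathrm{MISE}_n(J_n,q_n,\{\delta_{j,n}\})\le C\,n^{-2r\alpha/(2r+\alpha)}$ for all sufficiently large $n$; 2. for every sequence $J_n$ with $2^{J_n}=o(n)$, for all sufficiently large $n$ (depending on that sequence), and for all $q\ge0$ and all $\{\delta_j\}\subset[0,\infty]$, $$\mathrm{MISE}_n(J_n,q,\{\delta_j\})\ \ge\ c\,n^{-2r\alpha/(2r+\alpha)} .$$ The constants depend neither on $n$ nor on the choice of $J_n$, $q$, $\{\delta_j\}$. -/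

import Mathlib

open MeasureTheory ProbabilityTheory Filter Topology
open scoped ENNReal NNReal

noncomputable section

namespace LongMemoryWavelet

/-- The rescaled function `N^{1/2} 2^{m/2} f (N 2^m t - k)`. With `f = φ`, `m = J` this is `φ_{Jk}`;
with `f = ψ`, `m = J + j` it is `ψ_{jk}` (for the decomposition level `J`). -/
def scaled (N : ℕ) (f : ℝ → ℝ) (m : ℕ) (k : ℤ) (t : ℝ) : ℝ :=
  (N : ℝ) ^ (1 / 2 : ℝ) * (2 : ℝ) ^ ((m : ℝ) / 2) * f ((N : ℝ) * (2 : ℝ) ^ m * t - (k : ℝ))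

/-- The wavelet system `{φ_{Jk}, ψ_{jk} : k ∈ ℤ, j ≥ 0}` with decomposition level `J`. -/
def waveletSystem (N : ℕ) (φ ψ : ℝ → ℝ) (J : ℕ) : ℤ ⊕ ℕ × ℤ → ℝ → ℝ
  | Sum.inl k => scaled N φ J k
  | Sum.inr (j, k) => scaled N ψ (J + j) k

/-- `φ` and `ψ` are father and mother wavelets with support in `[0, N]`: they are normalised,
`ψ` vanishes at the end points, and for every level `J` the wavelet system is an orthonormal
(Hilbert) basis of `L²(ℝ)`. -/
structure IsWaveletPair (N : ℕ) (φ ψ : ℝ → ℝ) : Prop where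
  support_father : Function.support φ ⊆ Set.Icc 0 (N : ℝ)
  support_mother : Function.support ψ ⊆ Set.Icc 0 (N : ℝ)
  integral_father : ∫ t in (0 : ℝ)..N, φ t = 1
  integral_father_sq : ∫ t in (0 : ℝ)..N, φ t ^ 2 = 1
  integral_mother_sq : ∫ t in (0 : ℝ)..N, ψ t ^ 2 = 1
  mother_zero : ψ 0 = 0
  mother_end : ψ N = 0
  orthonormal_basis : ∀ J : ℕ,
    ∃ b : HilbertBasis (ℤ ⊕ ℕ × ℤ) ℝ (Lp ℝ 2 (volume : Measure ℝ)),
      ∀ i, (b i : ℝ → ℝ) =ᵐ[volume] waveletSystem N φ ψ J i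

/-- `ψ` (supported in `[0, N]`) has exactly `r` vanishing moments. -/
def HasVanishingMoments (N : ℕ) (ψ : ℝ → ℝ) (r : ℕ) : Prop :=
  (∀ k < r, ∫ t in (0 : ℝ)..N, t ^ k * ψ t = 0) ∧ ∫ t in (0 : ℝ)..N, t ^ r * ψ t ≠ 0

/-- Piecewise differentiability on `[0, N]`: the derivative exists except at finitely many points
and is bounded where it exists. -/
def PiecewiseDifferentiable (N : ℕ) (f : ℝ → ℝ) : Prop :=
  ∃ (S : Finset ℝ) (C : ℝ), ∀ x ∈ Set.Icc 0 (N : ℝ), x ∉ S →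
    DifferentiableAt ℝ f x ∧ |deriv f x| ≤ C

/-- The regularity required of the wavelets: piecewise differentiable, or uniformly Hölder
continuous with exponent `1/2` on `[0, N]`. -/
def WaveletRegular (N : ℕ) (f : ℝ → ℝ) : Prop :=
  PiecewiseDifferentiable N f ∨ ∃ C : ℝ≥0, HolderOnWith C (1 / 2) f (Set.Icc 0 (N : ℝ))

/-- `ξ` is a zero-mean second order stationary Gaussian process whose autocovariance function
`γ k = E (ξ_i ξ_{i+k})` satisfies `γ k ∼ C_γ k^{-α}` as `k → ∞`. -/
structure IsLongMemoryGaussian {Ω : Type*} [MeasurableSpace Ω] (P : Measure Ω)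
    (ξ : ℕ → Ω → ℝ) (γ : ℕ → ℝ) (Cγ α : ℝ) : Prop where
  gaussian : IsGaussianProcess ξ P
  mean_zero : ∀ i, ∫ ω, ξ i ω ∂P = 0
  covariance : ∀ i k, ∫ ω, ξ i ω * ξ (i + k) ω ∂P = γ k
  decay : Asymptotics.IsEquivalent atTop γ (fun k : ℕ => Cγ * (k : ℝ) ^ (-α))

/-- The observations `Y_i = g (i / n) + ξ_i`. -/
def observation {Ω : Type*} (n : ℕ) (g : ℝ → ℝ) (ξ : ℕ → Ω → ℝ) (ω : Ω) (i : ℕ) : ℝ :=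
  g ((i : ℝ) / n) + ξ i ω

/-- The empirical coefficient `n⁻¹ ∑_{i=1}^n Y_i f_{mk}(i / n)`: it is `ŝ_{Jk}` for `f = φ`,
`m = J`, and `d̂_{jk}` for `f = ψ`, `m = J + j`. -/
def empiricalCoeff (N n : ℕ) (Y : ℕ → ℝ) (f : ℝ → ℝ) (m : ℕ) (k : ℤ) : ℝ :=
  (n : ℝ)⁻¹ * ∑ i ∈ Finset.Icc 1 n, Y i * scaled N f m k ((i : ℝ) / n)

/-- Hard thresholding `d ↦ d I(|d| > δ)`; the threshold may be `∞`. -/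
def hardThreshold (δ : ℝ≥0∞) (d : ℝ) : ℝ :=
  if δ < ENNReal.ofReal |d| then d else 0

/-- The hard thresholding wavelet estimator with decomposition level `J`, smoothing parameter `q`
and thresholds `δ 0, …, δ q`. -/
def estimator (N : ℕ) (φ ψ : ℝ → ℝ) (n : ℕ) (Y : ℕ → ℝ) (J q : ℕ) (δ : ℕ → ℝ≥0∞) (t : ℝ) : ℝ :=
  ∑ k ∈ Finset.Icc (-(N : ℤ) + 1) ((N : ℤ) * 2 ^ J - 1),
      empiricalCoeff N n Y φ J k * scaled N φ J k t +
    ∑ j ∈ Finset.range (q + 1), ∑ k ∈ Finset.Icc (-(N : ℤ) + 1) ((N : ℤ) * 2 ^ (J + j) - 1),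
      hardThreshold (δ j) (empiricalCoeff N n Y ψ (J + j) k) * scaled N ψ (J + j) k t

/-- The mean integrated squared error `E ∫₀¹ (g - ĝ)²`, with values in `[0, ∞]`. -/
def MISE {Ω : Type*} [MeasurableSpace Ω] (P : Measure Ω) (ξ : ℕ → Ω → ℝ) (g : ℝ → ℝ)
    (N : ℕ) (φ ψ : ℝ → ℝ) (n J q : ℕ) (δ : ℕ → ℝ≥0∞) : ℝ≥0∞ :=
  ∫⁻ ω, ∫⁻ t in Set.Icc (0 : ℝ) 1,
    ENNReal.ofReal ((g t - estimator N φ ψ n (observation n g ξ ω) J q δ t) ^ 2) ∂volume ∂P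

/-- The admissible sequences of decomposition levels: `2^{J_n} = o(n)`. -/
def AdmissibleLevel (J : ℕ → ℕ) : Prop :=
  (fun n : ℕ => (2 : ℝ) ^ J n) =o[atTop] (fun n : ℕ => (n : ℝ))

end LongMemoryWavelet

end

/-! By Parseval, the MISE is controlled coefficient by coefficient: the risks of all coefficients
bound it from above, and those of the wavelets supported in [0, 1] bound it from below. Write M = N
2^m for the resolution of a level. The substitution x = M t - k turns the design into a grid of step
h = M/n. An empirical coefficient is then Gaussian, its squared bias is O(1/n) by a Riemann sum
estimate, and its variance is M⁻¹ times a quadratic form in the autocovariance. The form is of order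
h^α, so the variance is of order M⁻¹ (M/n)^α.

The upper half of that order only needs sums of k^(-α). The lower half is the delicate point. The
kernel |x|^(-α) is, up to a Gamma factor, a mixture of the Gaussian kernels exp(-s x²), and the
exponential series writes the form of each as a sum of squares of weighted moments. One nonvanishing
moment therefore bounds the form from below: the moment of order 0 for φ, of order r for ψ
(`exists_le_gridForm`). Taylor expansion and the vanishing moments show that a true interior
coefficient d at level m satisfies d² = O(M^(-1-2r)), with a matching lower bound where g^(r) stays
away from 0 (`PiecewiseHolder.abs_trueCoeff_sub_le`).

Lower bound. A Gaussian variable is at distance at least half its standard deviation from any given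
point with probability at least 1/2. An unthresholded coefficient thus costs a multiple of its
variance; a thresholded or omitted one costs a multiple of min(d², variance). About M coefficients
give a risk of order (2^J/n)^α from φ, and of order min(2^(-2rm), (2^m/n)^α) from every level m ≥ J.
With 2^m of order n^κ, κ = α/(2r+α), both terms have the order n^(-β), β = 2rα/(2r+α). If J ≤ m the
details at level m suffice, otherwise the φ part does.

Upper bound. Take 2^J of order n^κ. The φ part and the omitted interior details then cost n^(-β). At
the ends of [0, 1], where the moments do not cancel, d² is only O(1/M), so details must be kept up
to 2^q of order n^β. The threshold satisfies δ² = n^(-β') with β < β' < α. It dominates both noise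
and mean of every interior coefficient, and high Gaussian moments make false exceedances negligible.
The boundary has O(1) coefficients per level, each costing O(δ²), and the logarithmic number of
levels is absorbed by n^(β'-β). -/

namespace LongMemoryWavelet

/-! ### Regularity of the wavelets -/

/-- `f` vanishes off `[0, N]`, is bounded by `B`, and is Hölder continuous with exponent `1/2`
and constant `C` on every interval that avoids the finite set `S`. -/
structure PiecewiseHolder (N : ℕ) (f : ℝ → ℝ) (S : Finset ℝ) (C B : ℝ) : Prop where
  zero_mem : (0 : ℝ) ∈ S
  end_mem : (N : ℝ) ∈ S
  const_nonneg : 0 ≤ C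
  bound_nonneg : 0 ≤ B
  bound : ∀ x, |f x| ≤ B
  eq_zero : ∀ x, x ∉ Set.Icc 0 (N : ℝ) → f x = 0
  holder : ∀ x y, x ≤ y → (∀ s ∈ S, s ∉ Set.Icc x y) → |f y - f x| ≤ C * √(y - x)

theorem exists_pos_avoiding (S : Finset ℝ) (z : ℝ) :
    ∃ ε > 0, ∀ s ∈ S, s ≠ z → ε < |s - z| := by
  induction S using Finset.induction_on with
  | empty => exact ⟨1, one_pos, by simp⟩
  | insert a S _ ih =>
    obtain ⟨ε, hε, h⟩ := ih
    by_cases haz : a = z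
    · exact ⟨ε, hε, fun s hs hsz => by
        rcases Finset.mem_insert.1 hs with rfl | hs
        · exact absurd haz hsz
        · exact h s hs hsz⟩
    · have : 0 < |a - z| := abs_pos.2 (sub_ne_zero.2 haz)
      refine ⟨min ε (|a - z| / 2), lt_min hε (by linarith), fun s hs hsz => ?_⟩
      rcases Finset.mem_insert.1 hs with rfl | hs
      · exact (min_le_right _ _).trans_lt (by linarith)
      · exact (min_le_left _ _).trans_lt (h s hs hsz)

/-- Compactness reduces the claim to a neighbourhood of a point z, small enough to contain no other
exceptional point. Values to the left of z are compared with the left end point, values to the right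
with the right end point, and f z is counted separately since f may jump there. -/
theorem exists_bound_of_piecewise_holder {f : ℝ → ℝ} {S : Finset ℝ} {C : ℝ} (hC : 0 ≤ C) (N : ℕ)
    (hf : ∀ x y, x ≤ y → (∀ s ∈ S, s ∉ Set.Icc x y) → |f y - f x| ≤ C * √(y - x)) :
    ∃ B, ∀ x ∈ Set.Icc 0 (N : ℝ), |f x| ≤ B := by
  have hcompact : IsCompact (Set.Icc 0 (N : ℝ)) := isCompact_Icc
  refine hcompact.induction_on (p := fun A => ∃ B, ∀ x ∈ A, |f x| ≤ B) ⟨0, by simp⟩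
    (fun s t hst ⟨B, hB⟩ => ⟨B, fun x hx => hB x (hst hx)⟩)
    (fun s t ⟨B, hB⟩ ⟨B', hB'⟩ => ⟨max B B', fun x hx => ?_⟩) (fun z _ => ?_)
  · rcases hx with hx | hx
    · exact (hB x hx).trans (le_max_left _ _)
    · exact (hB' x hx).trans (le_max_right _ _)
  · obtain ⟨ε, hε, h⟩ := exists_pos_avoiding S z
    refine ⟨Set.Icc (z - ε) (z + ε), mem_nhdsWithin_of_mem_nhds
      (Icc_mem_nhds (by linarith) (by linarith)),
      |f z| + |f (z - ε)| + |f (z + ε)| + C * √ε, fun x hx => ?_⟩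
    have h1 := abs_nonneg (f z)
    have h2 := abs_nonneg (f (z - ε))
    have h3 := abs_nonneg (f (z + ε))
    have h4 : 0 ≤ C * √ε := by positivity
    rcases lt_trichotomy x z with hxz | rfl | hxz
    · have := hf (z - ε) x hx.1 (fun s hs hs' => by
        have := h s hs (by linarith [hs'.2])
        rw [lt_abs] at this
        rcases this with h | h <;> linarith [hs'.1, hs'.2])
      have h5 : C * √(x - (z - ε)) ≤ C * √ε :=
        mul_le_mul_of_nonneg_left (Real.sqrt_le_sqrt (by linarith)) hC
      have h6 := abs_sub_abs_le_abs_sub (f x) (f (z - ε))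
      linarith
    · linarith
    · have := hf x (z + ε) hx.2 (fun s hs hs' => by
        have := h s hs (by linarith [hs'.1])
        rw [lt_abs] at this
        rcases this with h | h <;> linarith [hs'.1, hs'.2])
      have h5 : C * √(z + ε - x) ≤ C * √ε :=
        mul_le_mul_of_nonneg_left (Real.sqrt_le_sqrt (by linarith)) hC
      have h6 := abs_sub_abs_le_abs_sub (f x) (f (z + ε))
      rw [abs_sub_comm] at h6
      linarith

theorem WaveletRegular.piecewiseHolder {N : ℕ} {f : ℝ → ℝ} (hf : WaveletRegular N f)
    (hsupp : Function.support f ⊆ Set.Icc 0 (N : ℝ)) :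
    ∃ S C B, PiecewiseHolder N f S C B := by
  have hzero : ∀ x, x ∉ Set.Icc 0 (N : ℝ) → f x = 0 := fun x hx => by
    by_contra h
    exact hx (hsupp h)
  obtain ⟨S, C, h0, hN, hC, hh⟩ : ∃ (S : Finset ℝ) (C : ℝ), (0 : ℝ) ∈ S ∧ (N : ℝ) ∈ S ∧ 0 ≤ C ∧
      ∀ x y, x ≤ y → (∀ s ∈ S, s ∉ Set.Icc x y) → |f y - f x| ≤ C * √(y - x) := by
    classical
    have key : ∀ (S : Finset ℝ) (C : ℝ), 0 ≤ C → (∀ x y : ℝ, 0 ≤ x → x ≤ y → y ≤ N →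
        (∀ s ∈ S, s ∉ Set.Icc x y) → |f y - f x| ≤ C * √(y - x)) →
        ∃ (S : Finset ℝ) (C : ℝ), (0 : ℝ) ∈ S ∧ (N : ℝ) ∈ S ∧ 0 ≤ C ∧
      ∀ x y, x ≤ y → (∀ s ∈ S, s ∉ Set.Icc x y) → |f y - f x| ≤ C * √(y - x) := by
      intro S C hC h
      -- With 0 and N among the exceptional points, an interval avoiding them lies entirely inside
      -- or entirely outside [0, N]; in the second case f vanishes at both of its ends.
      refine ⟨insert 0 (insert (N : ℝ) S), C, by simp, by simp, hC, fun x y hxy hs => ?_⟩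
      have e0 := hs 0 (by simp)
      have eN := hs N (by simp)
      have hpos : 0 ≤ C * √(y - x) := by positivity
      simp only [Set.mem_Icc, not_and_or, not_le] at e0 eN
      by_cases hin : 0 ≤ x ∧ y ≤ N
      · exact h x y hin.1 hxy hin.2 fun s hs' => hs s (by simp [hs'])
      · have hN0 : (0 : ℝ) ≤ N := N.cast_nonneg
        have : (x < 0 ∧ y < 0) ∨ (N < x ∧ N < y) := by
          rcases e0 with e0 | e0 <;> rcases eN with eN | eN
          · exact Or.inr ⟨eN, by linarith⟩
          · exact absurd ⟨e0.le, eN.le⟩ hin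
          · linarith
          · exact Or.inl ⟨by linarith, e0⟩
        have hx : f x = 0 := hzero x (by
          rcases this with h | h <;> simp only [Set.mem_Icc, not_and_or, not_le] <;> tauto)
        have hy : f y = 0 := hzero y (by
          rcases this with h | h <;> simp only [Set.mem_Icc, not_and_or, not_le] <;> tauto)
        simpa [hx, hy] using hpos
    rcases hf with ⟨S, C, h⟩ | ⟨C, h⟩
    -- On [0, N] a Lipschitz bound implies a Hölder bound, because y - x = √(y - x) √(y - x) ≤ √N
    -- √(y - x).
    · refine key S (|C| * √N) (by positivity) fun x y hx hxy hy hs => ?_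
      have := (convex_Icc x y).norm_image_sub_le_of_norm_deriv_le (f := f) (C := |C|)
        (fun z hz => (h z ⟨hx.trans hz.1, hz.2.trans hy⟩ (fun hzS => hs z hzS hz)).1)
        (fun z hz => ((h z ⟨hx.trans hz.1, hz.2.trans hy⟩ (fun hzS => hs z hzS hz)).2).trans
          (le_abs_self C)) (Set.left_mem_Icc.2 hxy) (Set.right_mem_Icc.2 hxy)
      rw [Real.norm_eq_abs, Real.norm_eq_abs, abs_of_nonneg (by linarith : 0 ≤ y - x)] at this
      refine this.trans ?_
      rw [mul_assoc]
      refine mul_le_mul_of_nonneg_left ?_ (abs_nonneg C)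
      calc y - x = √(y - x) * √(y - x) := (Real.mul_self_sqrt (by linarith)).symm
        _ ≤ √N * √(y - x) := mul_le_mul_of_nonneg_right (Real.sqrt_le_sqrt (by linarith))
          (Real.sqrt_nonneg _)
    · refine key ∅ C C.2 fun x y hx hxy hy _ => ?_
      have := h.dist_le (x := y) (y := x) ⟨hx.trans hxy, hy⟩ ⟨hx, hxy.trans hy⟩
      rw [Real.dist_eq, Real.dist_eq, abs_of_nonneg (by linarith : 0 ≤ y - x)] at this
      rw [Real.sqrt_eq_rpow]
      simpa using this
  obtain ⟨B, hB⟩ := exists_bound_of_piecewise_holder hC N hh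
  refine ⟨S, C, |B|, h0, hN, hC, abs_nonneg B, fun x => ?_, hzero, hh⟩
  by_cases hx : x ∈ Set.Icc 0 (N : ℝ)
  · exact (hB x hx).trans (le_abs_self B)
  · simp [hzero x hx]

namespace PiecewiseHolder

variable {N : ℕ} {f : ℝ → ℝ} {S : Finset ℝ} {C B : ℝ}

theorem continuousAt (hf : PiecewiseHolder N f S C B) {x : ℝ} (hx : x ∉ S) :
    ContinuousAt f x := by
  obtain ⟨ε, hε, h⟩ := exists_pos_avoiding S x
  have hav : ∀ s ∈ S, ε < |s - x| := fun s hs => h s hs (fun e => hx (e ▸ hs))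
  have hbd : ∀ᶠ y in 𝓝 x, |f y - f x| ≤ C * √|y - x| := by
    filter_upwards [Metric.ball_mem_nhds x hε] with y hy
    rw [Metric.mem_ball, Real.dist_eq, abs_lt] at hy
    rcases le_total x y with hxy | hxy
    · rw [abs_of_nonneg (by linarith : 0 ≤ y - x)]
      refine hf.holder x y hxy fun s hs hs' => ?_
      have := hav s hs
      rw [lt_abs] at this
      rcases this with h | h <;> linarith [hs'.1, hs'.2]
    · rw [abs_sub_comm, abs_sub_comm y, abs_of_nonneg (by linarith : 0 ≤ x - y)]
      refine hf.holder y x hxy fun s hs hs' => ?_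
      have := hav s hs
      rw [lt_abs] at this
      rcases this with h | h <;> linarith [hs'.1, hs'.2]
  have hlim : Tendsto (fun y => C * √|y - x|) (𝓝 x) (𝓝 0) := by
    have : Continuous fun y : ℝ => C * √|y - x| := by fun_prop
    simpa using this.tendsto x
  rw [ContinuousAt, tendsto_iff_norm_sub_tendsto_zero]
  exact squeeze_zero' (Eventually.of_forall fun _ => norm_nonneg _) hbd hlim

theorem aestronglyMeasurable (hf : PiecewiseHolder N f S C B) :
    AEStronglyMeasurable f volume := by
  have hS : MeasurableSet ((S : Set ℝ)ᶜ) := S.measurableSet.compl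
  have hc : ContinuousOn f ((S : Set ℝ)ᶜ) := fun x hx =>
    (hf.continuousAt (by simpa using hx)).continuousWithinAt
  have h := hc.aestronglyMeasurable (μ := volume) hS
  have hae : ((S : Set ℝ)ᶜ : Set ℝ) =ᵐ[volume] Set.univ := by
    rw [ae_eq_univ, compl_compl]
    exact S.finite_toSet.measure_zero _
  rwa [Measure.restrict_congr_set hae, Measure.restrict_univ] at h

theorem intervalIntegrable_mul (hf : PiecewiseHolder N f S C B) {G : ℝ → ℝ} {a b : ℝ}
    (hab : a ≤ b) (hG : ContinuousOn G (Set.Icc a b)) :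
    IntervalIntegrable (fun x => G x * f x) volume a b := by
  have h1 : IntervalIntegrable G volume a b := by
    apply ContinuousOn.intervalIntegrable
    rwa [Set.uIcc_of_le hab]
  rw [intervalIntegrable_iff] at h1 ⊢
  exact h1.mul_bdd (c := B) hf.aestronglyMeasurable.restrict
    (Eventually.of_forall fun x => hf.bound x)

end PiecewiseHolder

/-! ### Riemann sums of piecewise Hölder functions -/

/-- On each cell the error is the integral of F at the right end minus F x. A majorant `E` depending
on the left point x alone makes the cell errors add up to at most the integral of `E`, so
exceptional cells need no counting. -/
theorem abs_riemann_sum_sub_integral_le {F E : ℝ → ℝ} {a h : ℝ} (hh : 0 ≤ h) (n : ℕ)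
    (hF : IntervalIntegrable F volume a (a + h * n)) (hE : Integrable E) (hE0 : ∀ x, 0 ≤ E x)
    (hFE : ∀ x y, a ≤ x → x ≤ y → y ≤ x + h → y ≤ a + h * n → |F y - F x| ≤ E x) :
    |h * ∑ i ∈ Finset.Icc 1 n, F (a + h * i) - ∫ x in a..(a + h * n), F x| ≤ ∫ x, E x := by
  set t : ℕ → ℝ := fun i => a + h * i with ht
  have hmono : Monotone t := fun i j hij => by
    simp only [ht]; gcongr
  have hint : ∀ i < n, IntervalIntegrable F volume (t i) (t (i + 1)) := fun i hi => by
    refine hF.mono_set ?_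
    rw [Set.uIcc_of_le (hmono i.le_succ), Set.uIcc_of_le (by nlinarith [n.cast_nonneg (α := ℝ)])]
    exact Set.Icc_subset_Icc (by simp only [ht]; nlinarith [i.cast_nonneg (α := ℝ)])
      (hmono (Nat.succ_le_of_lt hi))
  have hsum : ∑ i ∈ Finset.Icc 1 n, F (a + h * i) = ∑ i ∈ Finset.range n, F (t (i + 1)) := by
    rw [Finset.range_eq_Ico, Finset.sum_Ico_add' (fun i => F (t i)) 0 n 1]
    rfl
  have h0 : t 0 = a := by simp [ht]
  have hEi : ∀ i < n, IntervalIntegrable E volume (t i) (t (i + 1)) := fun i _ =>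
    hE.intervalIntegrable
  have e1 := intervalIntegral.sum_integral_adjacent_intervals hint
  have e2 := intervalIntegral.sum_integral_adjacent_intervals hEi
  rw [h0] at e1 e2
  have hstep : ∀ i : ℕ, t (i + 1) - t i = h := fun i => by simp only [ht]; push_cast; ring
  have e3 : h * ∑ i ∈ Finset.Icc 1 n, F (a + h * i) - ∫ x in a..(a + h * n), F x =
      ∑ i ∈ Finset.range n, ∫ x in t i..t (i + 1), (F (t (i + 1)) - F x) := by
    rw [hsum, Finset.mul_sum, ← e1, ← Finset.sum_sub_distrib]
    refine Finset.sum_congr rfl fun i hi => ?_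
    rw [intervalIntegral.integral_sub (by simp) (hint i (Finset.mem_range.1 hi)),
      intervalIntegral.integral_const, hstep, smul_eq_mul]
  rw [e3]
  calc |∑ i ∈ Finset.range n, ∫ x in t i..t (i + 1), (F (t (i + 1)) - F x)|
      ≤ ∑ i ∈ Finset.range n, |∫ x in t i..t (i + 1), (F (t (i + 1)) - F x)| :=
        Finset.abs_sum_le_sum_abs _ _
    _ ≤ ∑ i ∈ Finset.range n, ∫ x in t i..t (i + 1), E x := by
        refine Finset.sum_le_sum fun i hi => ?_
        rw [Finset.mem_range] at hi
        have hle : t i ≤ t (i + 1) := hmono i.le_succ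
        have := intervalIntegral.norm_integral_le_of_norm_le (μ := volume) hle
          (f := fun x => F (t (i + 1)) - F x) (g := E)
          (Eventually.of_forall fun x hx => by
            refine hFE x _ ?_ hx.2 ?_ (hmono (Nat.succ_le_of_lt hi))
            · exact (h0 ▸ hmono (Nat.zero_le i)).trans hx.1.le
            · linarith [hx.1, hstep i]) (hEi i hi)
        exact this
    _ = ∫ x in a..t n, E x := e2
    _ ≤ ∫ x, E x := by
        rw [intervalIntegral.integral_of_le (h0 ▸ hmono (Nat.zero_le n))]
        exact setIntegral_le_integral hE (Eventually.of_forall hE0)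

theorem PiecewiseHolder.abs_riemann_sum_sub_integral_le {N : ℕ} {f : ℝ → ℝ} {S : Finset ℝ}
    {C B : ℝ} (hf : PiecewiseHolder N f S C B) {G : ℝ → ℝ} {a h L A : ℝ} (hh : 0 < h)
    (hh1 : h ≤ 1) (n : ℕ) (hL : 0 ≤ L) (hA : 0 ≤ A)
    (hGc : ContinuousOn G (Set.Icc a (a + h * n)))
    (hGA : ∀ x ∈ Set.Icc a (a + h * n), x ∈ Set.Icc 0 (N : ℝ) → |G x| ≤ A)
    (hGL : ∀ x ∈ Set.Icc a (a + h * n), ∀ y ∈ Set.Icc a (a + h * n), x ∈ Set.Icc 0 (N : ℝ) →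
      y ∈ Set.Icc 0 (N : ℝ) → |G y - G x| ≤ L * |y - x|) :
    |h * ∑ i ∈ Finset.Icc 1 n, G (a + h * i) * f (a + h * i) -
      ∫ x in a..(a + h * n), G x * f x| ≤
      ((C + B) * (N + 2) + 4 * B * S.card) * (L + A) * √h := by
  have hC := hf.const_nonneg
  have hB := hf.bound_nonneg
  set b := a + h * n with hb
  set K := (C + B) * (L + A) * √h with hK
  have hK0 : 0 ≤ K := by positivity
  -- The first term pays for pairs x, y with no exceptional point between them, where the Hölder
  -- bound applies. The second pays the trivial bound 2AB when an exceptional point lies within h of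
  -- x. The latter has total mass O(h), which is at most O(√h) since h ≤ 1.
  set E : ℝ → ℝ := fun x => (Set.Icc (-1 : ℝ) (N + 1)).indicator (fun _ => K) x +
    ∑ s ∈ S, (Set.Icc (s - h) (s + h)).indicator (fun _ => 2 * A * B) x with hE
  have hi1 : Integrable ((Set.Icc (-1 : ℝ) (N + 1)).indicator (fun _ => K)) :=
    (integrable_indicator_iff measurableSet_Icc).2 (integrableOn_const measure_Icc_lt_top.ne)
  have hi2 : ∀ s ∈ S, Integrable ((Set.Icc (s - h) (s + h)).indicator (fun _ => 2 * A * B)) :=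
    fun s _ => (integrable_indicator_iff measurableSet_Icc).2
      (integrableOn_const measure_Icc_lt_top.ne)
  have hEint : Integrable E := hi1.add (integrable_finsetSum S hi2)
  have hterm : ∀ x, ∀ s ∈ S, 0 ≤ (Set.Icc (s - h) (s + h)).indicator (fun _ => 2 * A * B) x :=
    fun x s _ => Set.indicator_nonneg (fun _ _ => by positivity) _
  have hfst : ∀ x, 0 ≤ (Set.Icc (-1 : ℝ) (N + 1)).indicator (fun _ => K) x :=
    fun x => Set.indicator_nonneg (fun _ _ => hK0) _
  have hE0 : ∀ x, 0 ≤ E x := fun x => add_nonneg (hfst x) (Finset.sum_nonneg (hterm x))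
  have hval : ∫ x, E x = K * (N + 2) + S.card * (2 * h * (2 * A * B)) := by
    rw [hE, integral_add hi1 (integrable_finsetSum S hi2), integral_finsetSum S hi2]
    congr 1
    · rw [integral_indicator measurableSet_Icc, setIntegral_const, Measure.real, Real.volume_Icc,
        ENNReal.toReal_ofReal (by linarith [N.cast_nonneg (α := ℝ)]), smul_eq_mul]
      ring
    · rw [Finset.sum_congr rfl (g := fun _ => 2 * h * (2 * A * B)), Finset.sum_const,
        nsmul_eq_mul]
      intro s _
      rw [integral_indicator measurableSet_Icc, setIntegral_const, Measure.real, Real.volume_Icc,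
        ENNReal.toReal_ofReal (by linarith), smul_eq_mul]
      ring
  have hN0 : (0 : ℝ) ≤ N := N.cast_nonneg
  have hbd : ∀ x ∈ Set.Icc a b, |G x * f x| ≤ A * B := fun x hx => by
    by_cases hxN : x ∈ Set.Icc 0 (N : ℝ)
    · rw [abs_mul]
      exact mul_le_mul (hGA x hx hxN) (hf.bound x) (abs_nonneg _) hA
    · rw [hf.eq_zero x hxN]
      simpa using mul_nonneg hA hB
  have hFE : ∀ x y, a ≤ x → x ≤ y → y ≤ x + h → y ≤ b → |G y * f y - G x * f x| ≤ E x := by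
    intro x y hax hxy hyx hyb
    have hx : x ∈ Set.Icc a b := ⟨hax, hxy.trans hyb⟩
    have hy : y ∈ Set.Icc a b := ⟨hax.trans hxy, hyb⟩
    by_cases hS : ∃ s ∈ S, s ∈ Set.Icc x y
    · obtain ⟨s, hs, hsx⟩ := hS
      have h1 : |G y * f y - G x * f x| ≤ 2 * A * B := by
        have := abs_sub (G y * f y) (G x * f x)
        linarith [hbd x hx, hbd y hy]
      have h2 : (Set.Icc (s - h) (s + h)).indicator (fun _ => 2 * A * B) x = 2 * A * B :=
        Set.indicator_of_mem (Set.mem_Icc.2 ⟨by linarith [hsx.2], by linarith [hsx.1]⟩) _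
      have h3 := Finset.single_le_sum (hterm x) hs
      rw [h2] at h3
      simp only [hE]
      linarith [hfst x]
    · push Not at hS
      have e0 := hS 0 hf.zero_mem
      have eN := hS N hf.end_mem
      by_cases hxN : x ∈ Set.Icc 0 (N : ℝ)
      · have hyN : y ∈ Set.Icc 0 (N : ℝ) := by
          refine ⟨hxN.1.trans hxy, ?_⟩
          by_contra hlt
          exact eN ⟨hxN.2, (not_le.1 hlt).le⟩
        have h1 : G y * f y - G x * f x = G y * (f y - f x) + f x * (G y - G x) := by ring
        have h2 := hf.holder x y hxy hS
        have h3 := hGL x hx y hy hxN hyN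
        have h4 : √(y - x) ≤ √h := Real.sqrt_le_sqrt (by linarith)
        have h5 : |y - x| ≤ √h := by
          rw [abs_of_nonneg (by linarith)]
          calc y - x ≤ h := by linarith
            _ = √h * √h := (Real.mul_self_sqrt hh.le).symm
            _ ≤ 1 * √h := mul_le_mul_of_nonneg_right (Real.sqrt_le_one.2 hh1) (Real.sqrt_nonneg _)
            _ = √h := one_mul _
        have h6 : |G y * f y - G x * f x| ≤ K := by
          rw [h1]
          calc |G y * (f y - f x) + f x * (G y - G x)|
              ≤ |G y| * |f y - f x| + |f x| * |G y - G x| := by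
                rw [← abs_mul, ← abs_mul]; exact abs_add_le _ _
            _ ≤ A * (C * √h) + B * (L * √h) := by
                refine add_le_add (mul_le_mul (hGA y hy hyN) (h2.trans ?_) (abs_nonneg _) hA)
                  (mul_le_mul (hf.bound x) (h3.trans ?_) (abs_nonneg _) hB)
                · exact mul_le_mul_of_nonneg_left h4 hC
                · exact mul_le_mul_of_nonneg_left h5 hL
            _ ≤ K := by
                rw [hK]
                have := Real.sqrt_nonneg h
                have q1 : 0 ≤ C * L * √h := by positivity
                have q2 : 0 ≤ B * A * √h := by positivity
                nlinarith
        have h7 : (Set.Icc (-1 : ℝ) (N + 1)).indicator (fun _ => K) x = K :=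
          Set.indicator_of_mem (Set.mem_Icc.2 ⟨by linarith [hxN.1], by linarith [hxN.2]⟩) _
        simp only [hE, h7]
        linarith [Finset.sum_nonneg (hterm x)]
      · have hyN : y ∉ Set.Icc 0 (N : ℝ) := by
          intro hyN
          apply hxN
          refine ⟨?_, hxy.trans hyN.2⟩
          by_contra hlt
          exact e0 ⟨(not_le.1 hlt).le, hyN.1⟩
        rw [hf.eq_zero x hxN, hf.eq_zero y hyN]
        simpa using hE0 x
  have hint := hf.intervalIntegrable_mul (a := a) (b := b)
    (by rw [hb]; nlinarith [n.cast_nonneg (α := ℝ)]) hGc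
  have hmain := LongMemoryWavelet.abs_riemann_sum_sub_integral_le hh.le n hint hEint hE0
    (fun x y h1 h2 h3 h4 => hFE x y h1 h2 h3 h4)
  refine hmain.trans ?_
  rw [hval, hK]
  have hsq : h ≤ √h := by
    calc h = √h * √h := (Real.mul_self_sqrt hh.le).symm
      _ ≤ 1 * √h := mul_le_mul_of_nonneg_right (Real.sqrt_le_one.2 hh1) (Real.sqrt_nonneg _)
      _ = √h := one_mul _
  have h8 : S.card * (2 * h * (2 * A * B)) ≤ 4 * B * S.card * (L + A) * √h := by
    calc (S.card : ℝ) * (2 * h * (2 * A * B)) = 4 * B * S.card * A * h := by ring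
      _ ≤ 4 * B * S.card * (L + A) * √h := by gcongr; linarith
  linarith

/-! ### Upper bound for the power-law quadratic form -/

/-- Induction on P: by Bernoulli's inequality for the exponent 1 - α in (0, 1), the right-hand side
grows by at least (P + 1)^(-α) at each step. -/
theorem sum_Icc_rpow_neg_le {α : ℝ} (h0 : 0 < α) (h1 : α < 1) (P : ℕ) :
    ∑ p ∈ Finset.Icc 1 P, (p : ℝ) ^ (-α) ≤ (P : ℝ) ^ (1 - α) / (1 - α) := by
  have hα : 0 < 1 - α := by linarith
  induction P with
  | zero => simp [Real.zero_rpow hα.ne']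
  | succ P ih =>
    rw [Finset.sum_Icc_succ_top (by omega)]
    refine (add_le_add_left ih _).trans ?_
    set q : ℝ := ((P + 1 : ℕ) : ℝ) with hq
    have hq1 : 1 ≤ q := by rw [hq]; exact_mod_cast Nat.succ_le_succ P.zero_le
    have hq0 : 0 < q := by linarith
    have hP : (P : ℝ) = q * (1 + -(1 / q)) := by
      rw [hq]; push_cast; field_simp; ring
    have hinv : 1 / q ≤ 1 := by rw [div_le_one hq0]; exact hq1
    have hB := rpow_one_add_le_one_add_mul_self (s := -(1 / q)) (by linarith) hα.le (by linarith)
    have hqq : q ^ (1 - α) = q * q ^ (-α) := by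
      rw [show 1 - α = 1 + -α by ring, Real.rpow_add hq0, Real.rpow_one]
    have hm : (P : ℝ) ^ (1 - α) ≤ q ^ (1 - α) - (1 - α) * q ^ (-α) := by
      rw [hP, Real.mul_rpow hq0.le (by linarith)]
      calc q ^ (1 - α) * (1 + -(1 / q)) ^ (1 - α)
          ≤ q ^ (1 - α) * (1 + (1 - α) * -(1 / q)) :=
            mul_le_mul_of_nonneg_left hB (by positivity)
        _ = q ^ (1 - α) - (1 - α) * q ^ (-α) := by
            rw [hqq]; field_simp; ring
    rw [← sub_nonneg]
    have : q ^ (1 - α) / (1 - α) - ((P : ℝ) ^ (1 - α) / (1 - α) + q ^ (-α)) =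
        (q ^ (1 - α) - (1 - α) * q ^ (-α) - (P : ℝ) ^ (1 - α)) / (1 - α) := by
      field_simp; ring
    rw [this]
    exact div_nonneg (by linarith) hα.le

/-- Every nonzero distance from i is attained at most twice, once on each side. Distance 0 is
harmless because F vanishes there, which holds for k^(-α) since real powers give 0^(-α) = 0. -/
theorem sum_le_two_mul_sum_natAbs {F : ℕ → ℝ} (hF : ∀ p, 0 ≤ F p) (hF0 : F 0 = 0)
    (s : Finset ℕ) (i P : ℕ) (hs : ∀ l ∈ s, ((i : ℤ) - l).natAbs ≤ P) :
    ∑ l ∈ s, F ((i : ℤ) - l).natAbs ≤ 2 * ∑ p ∈ Finset.Icc 1 P, F p := by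
  classical
  have key : ∀ t : Finset ℕ, (∀ l ∈ t, l ∈ s) →
      Set.InjOn (fun l : ℕ => ((i : ℤ) - l).natAbs) t → (∀ l ∈ t, l ≠ i) →
      ∑ l ∈ t, F ((i : ℤ) - l).natAbs ≤ ∑ p ∈ Finset.Icc 1 P, F p := by
    intro t hts hinj hne
    rw [← Finset.sum_image (f := F) hinj]
    refine Finset.sum_le_sum_of_subset_of_nonneg (fun p hp => ?_) fun p _ _ => hF p
    obtain ⟨l, hl, rfl⟩ := Finset.mem_image.1 hp
    have := hne l hl
    exact Finset.mem_Icc.2 ⟨by omega, hs l (hts l hl)⟩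
  rw [← Finset.sum_filter_add_sum_filter_not s (fun l => l < i), two_mul]
  refine add_le_add (key _ (fun l hl => (Finset.mem_filter.1 hl).1) ?_ ?_) ?_
  · intro x hx y hy hxy
    have h1 := (Finset.mem_filter.1 hx).2
    have h2 := (Finset.mem_filter.1 hy).2
    simp only at hxy
    omega
  · intro l hl
    have := (Finset.mem_filter.1 hl).2
    omega
  · rw [← Finset.sum_filter_add_sum_filter_not _ (fun l => l = i)]
    have hz : ∑ l ∈ (s.filter fun l => ¬ l < i).filter (fun l => l = i),
        F ((i : ℤ) - l).natAbs = 0 :=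
      Finset.sum_eq_zero fun l hl => by
        rw [(Finset.mem_filter.1 hl).2]; simp [hF0]
    rw [hz, zero_add]
    refine key _ (fun l hl => (Finset.mem_filter.1 (Finset.mem_filter.1 hl).1).1) ?_ ?_
    · intro x hx y hy hxy
      have h1 := (Finset.mem_filter.1 (Finset.mem_filter.1 hx).1).2
      have h2 := (Finset.mem_filter.1 (Finset.mem_filter.1 hy).1).2
      simp only at hxy
      omega
    · intro l hl
      exact (Finset.mem_filter.1 hl).2

theorem mul_card_grid_le {N : ℕ} {a h : ℝ} (hh : 0 < h) (n : ℕ) :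
    h * ((Finset.Icc 1 n).filter fun i : ℕ => a + h * i ∈ Set.Icc 0 (N : ℝ)).card ≤ N + h := by
  set I := (Finset.Icc 1 n).filter fun i : ℕ => a + h * i ∈ Set.Icc 0 (N : ℝ) with hI
  rcases I.eq_empty_or_nonempty with he | hne
  · rw [he]; simp; positivity
  · have h1 := (Finset.mem_filter.1 (I.min'_mem hne)).2
    have h2 := (Finset.mem_filter.1 (I.max'_mem hne)).2
    have hle := I.min'_le_max' hne
    set m := I.min' hne
    set M := I.max' hne
    have hsub : I ⊆ Finset.Icc m M := fun i hi =>
      Finset.mem_Icc.2 ⟨I.min'_le i hi, I.le_max' i hi⟩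
    have hc := Finset.card_le_card hsub
    rw [Nat.card_Icc] at hc
    have hc' : (I.card : ℝ) ≤ M - m + 1 := by
      have : I.card + m ≤ M + 1 := by omega
      have : (I.card : ℝ) + m ≤ M + 1 := by exact_mod_cast this
      linarith
    calc h * I.card ≤ h * (M - m + 1) := mul_le_mul_of_nonneg_left hc' hh.le
      _ = (a + h * M) - (a + h * m) + h := by ring
      _ ≤ N + h := by linarith [h1.1, h2.2]

/-- The quadratic form `h² ∑ κ(|i - l|) f(a + h i) f(a + h l)`. -/
noncomputable def gridForm (κ : ℕ → ℝ) (f : ℝ → ℝ) (a h : ℝ) (n : ℕ) : ℝ :=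
  h ^ 2 * ∑ i ∈ Finset.Icc 1 n, ∑ l ∈ Finset.Icc 1 n,
    κ ((i : ℤ) - l).natAbs * (f (a + h * i) * f (a + h * l))

theorem natAbs_sub_cast (i l : ℕ) : ((((i : ℤ) - l).natAbs : ℕ) : ℝ) = |(i : ℝ) - l| := by
  rw [Nat.cast_natAbs]
  push_cast
  rfl

namespace PiecewiseHolder

variable {N : ℕ} {f : ℝ → ℝ} {S : Finset ℝ} {C B : ℝ}

theorem sq_mul_sum_sq_le (hf : PiecewiseHolder N f S C B) {h : ℝ} (hh : 0 < h) (hh1 : h ≤ 1)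
    (a : ℝ) (n : ℕ) :
    h ^ 2 * ∑ i ∈ Finset.Icc 1 n, f (a + h * i) ^ 2 ≤ B ^ 2 * (N + 1) * h := by
  have h1 : ∑ i ∈ Finset.Icc 1 n, f (a + h * i) ^ 2 ≤
      ((Finset.Icc 1 n).filter fun i : ℕ => a + h * i ∈ Set.Icc 0 (N : ℝ)).card * B ^ 2 := by
    rw [← nsmul_eq_mul, ← Finset.sum_const, Finset.sum_filter]
    refine Finset.sum_le_sum fun i _ => ?_
    split_ifs with hi
    · exact sq_le_sq' (by linarith [(abs_le.1 (hf.bound (a + h * i))).1])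
        (abs_le.1 (hf.bound (a + h * i))).2
    · simp [hf.eq_zero _ hi]
  have h2 := mul_card_grid_le (N := N) (a := a) hh n
  calc h ^ 2 * ∑ i ∈ Finset.Icc 1 n, f (a + h * i) ^ 2
      ≤ h ^ 2 * (((Finset.Icc 1 n).filter fun i : ℕ => a + h * i ∈ Set.Icc 0 (N : ℝ)).card
        * B ^ 2) := by gcongr
    _ = (B ^ 2 * h) * (h * ((Finset.Icc 1 n).filter
        fun i : ℕ => a + h * i ∈ Set.Icc 0 (N : ℝ)).card) := by ring
    _ ≤ (B ^ 2 * h) * (N + h) := by gcongr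
    _ ≤ (B ^ 2 * h) * (N + 1) := by gcongr
    _ = _ := by ring

/-- At most (N + 1)/h grid points meet the support, and each row sums to O((N/h)^(1-α)). Thus h² h⁻¹
h^(α-1) = h^α. The diagonal contributes nothing, by the value 0^(-α) = 0. -/
theorem gridForm_rpow_abs_le (hf : PiecewiseHolder N f S C B) {α : ℝ} (h0 : 0 < α) (h1 : α < 1)
    {h : ℝ} (hh : 0 < h) (hh1 : h ≤ 1) (a : ℝ) (n : ℕ) :
    gridForm (fun k => (k : ℝ) ^ (-α)) (fun x => |f x|) a h n ≤
      (B ^ 2 * (N + 1) * (2 * ((N : ℝ) ^ (1 - α) / (1 - α)))) * h ^ α := by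
  have hα : 0 < 1 - α := by linarith
  have hB := hf.bound_nonneg
  set I := (Finset.Icc 1 n).filter fun i : ℕ => a + h * i ∈ Set.Icc 0 (N : ℝ) with hI
  set P := ⌊(N : ℝ) / h⌋₊ with hP
  set R := 2 * ((P : ℝ) ^ (1 - α) / (1 - α)) with hR
  have hR0 : 0 ≤ R := by positivity
  have hrow : ∀ i ∈ I, ∑ l ∈ I, (((i : ℤ) - l).natAbs : ℝ) ^ (-α) ≤ R := by
    intro i hi
    refine (sum_le_two_mul_sum_natAbs (F := fun p : ℕ => (p : ℝ) ^ (-α)) (fun p => by positivity)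
      (by simp [Real.zero_rpow (neg_ne_zero.2 h0.ne')]) I i P fun l hl => ?_).trans ?_
    · have hi' := (Finset.mem_filter.1 hi).2
      have hl' := (Finset.mem_filter.1 hl).2
      rw [hP, Nat.le_floor_iff (by positivity), natAbs_sub_cast, le_div_iff₀ hh]
      have : |(i : ℝ) - l| * h = |(a + h * i) - (a + h * l)| := by
        rw [show (a + h * i) - (a + h * l) = ((i : ℝ) - l) * h by ring, abs_mul, abs_of_pos hh]
      rw [this, abs_le]
      constructor <;> linarith [hi'.1, hi'.2, hl'.1, hl'.2]
    · have := sum_Icc_rpow_neg_le h0 h1 P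
      simp only [hR]
      linarith
  have hsum : ∑ i ∈ Finset.Icc 1 n, ∑ l ∈ Finset.Icc 1 n,
      (((i : ℤ) - l).natAbs : ℝ) ^ (-α) * (|f (a + h * i)| * |f (a + h * l)|) ≤
      I.card * (R * B ^ 2) := by
    rw [← nsmul_eq_mul, ← Finset.sum_const, hI, Finset.sum_filter]
    refine Finset.sum_le_sum fun i hi => ?_
    split_ifs with hi'
    · have hiI : i ∈ I := Finset.mem_filter.2 ⟨hi, hi'⟩
      refine le_trans ?_ (mul_le_mul_of_nonneg_right (hrow i hiI) (sq_nonneg B))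
      rw [Finset.sum_mul, hI, Finset.sum_filter]
      refine Finset.sum_le_sum fun l _ => ?_
      split_ifs with hl
      · refine mul_le_mul_of_nonneg_left ?_ (by positivity)
        rw [sq]
        exact mul_le_mul (hf.bound _) (hf.bound _) (abs_nonneg _) hB
      · simp [hf.eq_zero _ hl]
    · exact (Finset.sum_eq_zero fun l _ => by simp [hf.eq_zero _ hi']).le
  have hcard := mul_card_grid_le (N := N) (a := a) hh n
  rw [← hI] at hcard
  have hPle : (P : ℝ) ≤ N / h := Nat.floor_le (by positivity)
  have hRle : h * R ≤ 2 * ((N : ℝ) ^ (1 - α) / (1 - α)) * h ^ α := by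
    have e1 : (P : ℝ) ^ (1 - α) ≤ (N : ℝ) ^ (1 - α) / h ^ (1 - α) := by
      rw [← Real.div_rpow (by positivity) hh.le]
      exact Real.rpow_le_rpow (by positivity) hPle hα.le
    have e2 : h = h ^ (1 - α) * h ^ α := by
      rw [← Real.rpow_add hh]; simp
    calc h * R ≤ h * (2 * ((N : ℝ) ^ (1 - α) / h ^ (1 - α) / (1 - α))) := by
          rw [hR]; gcongr
      _ = (h ^ (1 - α) * h ^ α) * (2 * ((N : ℝ) ^ (1 - α) / h ^ (1 - α) / (1 - α))) := by
          rw [← e2]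
      _ = _ := by
          have : h ^ (1 - α) ≠ 0 := by positivity
          field_simp
  unfold gridForm
  calc h ^ 2 * ∑ i ∈ Finset.Icc 1 n, ∑ l ∈ Finset.Icc 1 n,
      (((i : ℤ) - l).natAbs : ℝ) ^ (-α) * (|f (a + h * i)| * |f (a + h * l)|)
      ≤ h ^ 2 * (I.card * (R * B ^ 2)) := by gcongr
    _ = B ^ 2 * (h * I.card) * (h * R) := by ring
    _ ≤ B ^ 2 * (N + 1) * (2 * ((N : ℝ) ^ (1 - α) / (1 - α)) * h ^ α) := by
        gcongr
        linarith
    _ = _ := by ring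

end PiecewiseHolder

/-! ### Lower bound for the power-law quadratic form by Gaussian mixtures -/

/-- The Gaussian mixture `∫₀^S s^{α/2-1} exp(-s x²) ds`, a truncation of `Γ(α/2) |x|^{-α}`. -/
noncomputable def gaussianMixture (α S x : ℝ) : ℝ :=
  ∫ s in (0 : ℝ)..S, s ^ (α / 2 - 1) * Real.exp (-(s * x ^ 2))

theorem intervalIntegrable_gaussianMixture {α : ℝ} (h0 : 0 < α) (a b x : ℝ) :
    IntervalIntegrable (fun s : ℝ => s ^ (α / 2 - 1) * Real.exp (-(s * x ^ 2))) volume a b :=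
  (intervalIntegral.intervalIntegrable_rpow' (by linarith)).mul_continuousOn
    (Continuous.continuousOn (by fun_prop))

/-- The difference is the tail of the Gamma integral beyond S, estimated with exp(-u) ≤
u^(-(1+α)/4). This exponent makes the power of s integrable at infinity while leaving the power (1 +
α)/2 < 1 of 1/|x|, which is still summable over the grid. -/
theorem abs_sub_gaussianMixture_le {α : ℝ} (h0 : 0 < α) (h1 : α < 1) {S x : ℝ} (hS : 0 < S)
    (hx : x ≠ 0) :
    |Real.Gamma (α / 2) * |x| ^ (-α) - gaussianMixture α S x| ≤
      4 / (1 - α) * S ^ (-((1 - α) / 4)) * |x| ^ (-((1 + α) / 2)) := by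
  have hx2 : 0 < x ^ 2 := by positivity
  have hxa : 0 < |x| := abs_pos.2 hx
  have hpow : ∀ t : ℝ, (x ^ 2) ^ t = |x| ^ (2 * t) := fun t => by
    rw [← sq_abs, ← Real.rpow_natCast, ← Real.rpow_mul hxa.le]; norm_num
  have hG : ∫ s in Set.Ioi (0 : ℝ), s ^ (α / 2 - 1) * Real.exp (-(s * x ^ 2)) =
      Real.Gamma (α / 2) * |x| ^ (-α) := by
    have := Real.integral_rpow_mul_exp_neg_mul_Ioi (a := α / 2) (r := x ^ 2) (by linarith) hx2
    rw [one_div, Real.inv_rpow hx2.le, ← Real.rpow_neg hx2.le, hpow] at this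
    rw [mul_comm, show -α = 2 * -(α / 2) by ring, ← this]
    refine integral_congr_ae (Eventually.of_forall fun s => ?_)
    simp only [mul_comm]
  have hint : IntegrableOn (fun s : ℝ => s ^ (α / 2 - 1) * Real.exp (-(s * x ^ 2)))
      (Set.Ioi 0) := by
    -- Integrability follows from the value of the integral: it is positive, whereas a nonintegrable
    -- function has integral 0 by convention.
    by_contra hni
    have := integral_undef (μ := volume.restrict (Set.Ioi (0 : ℝ))) hni
    rw [hG] at this
    have h2 := Real.Gamma_pos_of_pos (s := α / 2) (by linarith)
    have : 0 < Real.Gamma (α / 2) * |x| ^ (-α) := by positivity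
    linarith
  have hsplit : Real.Gamma (α / 2) * |x| ^ (-α) - gaussianMixture α S x =
      ∫ s in Set.Ioi S, s ^ (α / 2 - 1) * Real.exp (-(s * x ^ 2)) := by
    rw [← hG, gaussianMixture, intervalIntegral.integral_of_le hS.le,
      ← Set.Ioc_union_Ioi_eq_Ioi hS.le, setIntegral_union (Set.Ioc_disjoint_Ioi le_rfl)
        measurableSet_Ioi (hint.mono_set Set.Ioc_subset_Ioi_self)
        (hint.mono_set (Set.Ioi_subset_Ioi hS.le))]
    ring
  have hexp : α / 2 - 1 - (1 + α) / 4 < -1 := by linarith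
  have hni : 0 ≤ ∫ s in Set.Ioi S, s ^ (α / 2 - 1) * Real.exp (-(s * x ^ 2)) :=
    setIntegral_nonneg measurableSet_Ioi fun s hs => by
      have : 0 < s := hS.trans hs
      positivity
  rw [hsplit, abs_of_nonneg hni]
  calc ∫ s in Set.Ioi S, s ^ (α / 2 - 1) * Real.exp (-(s * x ^ 2))
      ≤ ∫ s in Set.Ioi S, s ^ (α / 2 - 1 - (1 + α) / 4) * |x| ^ (-((1 + α) / 2)) := by
        refine setIntegral_mono_on (hint.mono_set (Set.Ioi_subset_Ioi hS.le))
          ((integrableOn_Ioi_rpow_of_lt hexp hS).mul_const _) measurableSet_Ioi fun s hs => ?_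
        have hs0 : 0 < s := hS.trans hs
        have hu : 0 < s * x ^ 2 := by positivity
        have hle : Real.exp (-(s * x ^ 2)) ≤ (s * x ^ 2) ^ (-((1 + α) / 4)) := by
          rw [Real.exp_neg, Real.rpow_neg hu.le]
          refine inv_anti₀ (by positivity) ?_
          calc (s * x ^ 2) ^ ((1 + α) / 4) ≤ (1 + s * x ^ 2) ^ ((1 + α) / 4) :=
                Real.rpow_le_rpow hu.le (by linarith) (by linarith)
            _ ≤ (1 + s * x ^ 2) ^ (1 : ℝ) :=
                Real.rpow_le_rpow_of_exponent_le (by linarith) (by linarith)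
            _ ≤ Real.exp (s * x ^ 2) := by
                rw [Real.rpow_one, add_comm]; exact Real.add_one_le_exp _
        calc s ^ (α / 2 - 1) * Real.exp (-(s * x ^ 2))
            ≤ s ^ (α / 2 - 1) * (s * x ^ 2) ^ (-((1 + α) / 4)) := by gcongr
          _ = s ^ (α / 2 - 1 - (1 + α) / 4) * |x| ^ (-((1 + α) / 2)) := by
              rw [Real.mul_rpow hs0.le hx2.le, hpow, ← mul_assoc, ← Real.rpow_add hs0]
              congr 2
              ring
    _ = _ := by
        rw [integral_mul_const, integral_Ioi_rpow_of_lt hexp hS]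
        congr 1
        have : α / 2 - 1 - (1 + α) / 4 + 1 = -((1 - α) / 4) := by ring
        rw [this]
        have : (1 - α) ≠ 0 := by linarith
        field_simp

/-- Since exp(-s(x - y)²) = exp(-s x²) exp(-s y²) ∑ (2s)^k x^k y^k / k!, the double sum is a series
of nonnegative multiples of squares. Keeping the single term k = p gives the bound. -/
theorem le_sum_sum_exp_mul (s : ℝ) (hs : 0 ≤ s) (p : ℕ) (I : Finset ℕ) (x u : ℕ → ℝ) :
    (2 * s) ^ p / p.factorial * (∑ i ∈ I, x i ^ p * Real.exp (-(s * x i ^ 2)) * u i) ^ 2 ≤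
      ∑ i ∈ I, ∑ l ∈ I, Real.exp (-(s * (x i - x l) ^ 2)) * (u i * u l) := by
  set v : ℕ → ℝ := fun i => Real.exp (-(s * x i ^ 2)) * u i with hv
  have hterm : ∀ i l, HasSum (fun k : ℕ => (2 * s) ^ k / k.factorial *
      ((x i ^ k * v i) * (x l ^ k * v l)))
      (Real.exp (-(s * (x i - x l) ^ 2)) * (u i * u l)) := by
    intro i l
    have h1 := (NormedSpace.expSeries_div_hasSum_exp (𝔸 := ℝ) (2 * s * (x i * x l))).mul_right
      (v i * v l)
    rw [← Real.exp_eq_exp_ℝ] at h1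
    have h2 : Real.exp (2 * s * (x i * x l)) * (v i * v l) =
        Real.exp (-(s * (x i - x l) ^ 2)) * (u i * u l) := by
      simp only [hv]
      rw [show -(s * (x i - x l) ^ 2) = 2 * s * (x i * x l) + -(s * x i ^ 2) + -(s * x l ^ 2) by
        ring, Real.exp_add, Real.exp_add]
      ring
    rw [h2] at h1
    refine h1.congr_fun fun k => ?_
    simp only [mul_pow]
    ring
  have hsum : HasSum (fun k : ℕ => (2 * s) ^ k / k.factorial * (∑ i ∈ I, x i ^ k * v i) ^ 2)
      (∑ i ∈ I, ∑ l ∈ I, Real.exp (-(s * (x i - x l) ^ 2)) * (u i * u l)) := by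
    have := hasSum_sum (s := I) fun i _ => hasSum_sum (s := I) fun l _ => hterm i l
    convert this using 2 with k
    rw [sq, Finset.sum_mul_sum, Finset.mul_sum]
    exact Finset.sum_congr rfl fun i _ => Finset.mul_sum _ _ _
  have := le_hasSum hsum p fun k _ => by positivity
  simpa only [hv, mul_assoc] using this

theorem abs_pow_mul_exp_sub_le {N : ℕ} {s : ℝ} (hs : 0 ≤ s) (hs1 : s ≤ 1) (p : ℕ) {x y : ℝ}
    (hx : x ∈ Set.Icc 0 (N : ℝ)) (hy : y ∈ Set.Icc 0 (N : ℝ)) :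
    |y ^ p * Real.exp (-(s * y ^ 2)) - x ^ p * Real.exp (-(s * x ^ 2))| ≤
      (p * (N : ℝ) ^ (p - 1) + 2 * (N : ℝ) ^ (p + 1)) * |y - x| := by
  have hder : ∀ z : ℝ, HasDerivAt (fun z : ℝ => z ^ p * Real.exp (-(s * z ^ 2)))
      (p * z ^ (p - 1) * Real.exp (-(s * z ^ 2)) +
        z ^ p * (Real.exp (-(s * z ^ 2)) * (-(s * (2 * z))))) z := fun z => by
    have h1 := hasDerivAt_pow p z
    have h2 : HasDerivAt (fun z : ℝ => -(s * z ^ 2)) (-(s * (2 * z))) z := by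
      have := ((hasDerivAt_pow 2 z).const_mul s).fun_neg
      simpa using this
    exact h1.mul h2.exp
  refine (convex_Icc 0 (N : ℝ)).norm_image_sub_le_of_norm_hasDerivWithin_le
    (fun z _ => (hder z).hasDerivWithinAt) (fun z hz => ?_) hx hy
  have hz0 := hz.1
  have hzN := hz.2
  have he : Real.exp (-(s * z ^ 2)) ≤ 1 := Real.exp_le_one_iff.2 (by
    have : 0 ≤ s * z ^ 2 := by positivity
    linarith)
  have he0 := (Real.exp_pos (-(s * z ^ 2))).le
  rw [Real.norm_eq_abs]
  refine (abs_add_le _ _).trans (add_le_add ?_ ?_)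
  · rw [abs_of_nonneg (by positivity)]
    calc p * z ^ (p - 1) * Real.exp (-(s * z ^ 2)) ≤ p * (N : ℝ) ^ (p - 1) * 1 := by gcongr
      _ = _ := mul_one _
  · rw [mul_neg, mul_neg, abs_neg, abs_of_nonneg (by positivity)]
    calc z ^ p * (Real.exp (-(s * z ^ 2)) * (s * (2 * z)))
        ≤ (N : ℝ) ^ p * (1 * (1 * (2 * N))) := by gcongr
      _ = _ := by ring

namespace PiecewiseHolder

variable {N : ℕ} {f : ℝ → ℝ} {S : Finset ℝ} {C B : ℝ}

theorem integral_mul_eq (hf : PiecewiseHolder N f S C B) {G : ℝ → ℝ} {a b : ℝ} (ha : a ≤ 0)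
    (hb : N ≤ b) : ∫ x in a..b, G x * f x = ∫ x in (0 : ℝ)..N, G x * f x := by
  have hN : (0 : ℝ) ≤ N := N.cast_nonneg
  rw [intervalIntegral.integral_of_le (ha.trans (hN.trans hb)),
    intervalIntegral.integral_of_le hN]
  refine setIntegral_eq_of_subset_of_ae_sdiff_eq_zero measurableSet_Ioc.nullMeasurableSet
    (Set.Ioc_subset_Ioc ha hb) ?_
  filter_upwards [compl_mem_ae_iff.2 (measure_singleton (μ := volume) (0 : ℝ))] with x hx0 hx
  rw [hf.eq_zero x, mul_zero]
  intro hxN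
  exact hx.2 ⟨lt_of_le_of_ne hxN.1 fun e => hx0 e.symm, hxN.2⟩

/-- For small s the weight x^p exp(-s x²) is close to x^p, so the sum isolated by
`le_sum_sum_exp_mul` approximates the nonzero moment ν. The conditions on a and h n say that the
grid covers the support. The choice of s₀ keeps the change of weight below |ν|/4, that of h₁ keeps
the Riemann error below |ν|/4, and |ν|/2 remains. -/
theorem exists_le_sum_sum_exp (hf : PiecewiseHolder N f S C B) (p : ℕ)
    (hmom : ∫ x in (0 : ℝ)..N, x ^ p * f x ≠ 0) :
    ∃ s₀ > 0, ∃ h₁ > 0, ∃ c > 0, h₁ ≤ 1 ∧ ∀ s ∈ Set.Icc (s₀ / 2) s₀, ∀ (h a : ℝ) (n : ℕ),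
      0 < h → h ≤ h₁ → a ≤ 0 → N ≤ a + h * n →
      c ≤ h ^ 2 * ∑ i ∈ Finset.Icc 1 n, ∑ l ∈ Finset.Icc 1 n,
        Real.exp (-(s * ((a + h * i) - (a + h * l)) ^ 2)) * (f (a + h * i) * f (a + h * l)) := by
  set ν := ∫ x in (0 : ℝ)..N, x ^ p * f x with hν
  have hν0 : 0 < |ν| := abs_pos.2 hmom
  have hB := hf.bound_nonneg
  have hC := hf.const_nonneg
  have hN : (0 : ℝ) ≤ N := N.cast_nonneg
  set D : ℝ := (N : ℝ) ^ (p + 3) * B with hD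
  have hD0 : 0 ≤ D := by positivity
  set s₀ := min 1 (|ν| / (4 * (D + 1))) with hs₀
  have hs₀0 : 0 < s₀ := by positivity
  have hs₀1 : s₀ ≤ 1 := min_le_left _ _
  have hs₀D : s₀ * D ≤ |ν| / 4 := by
    calc s₀ * D ≤ |ν| / (4 * (D + 1)) * D := by gcongr; exact min_le_right _ _
      _ ≤ |ν| / (4 * (D + 1)) * (D + 1) := by gcongr; linarith
      _ = |ν| / 4 := by field_simp
  set L : ℝ := p * (N : ℝ) ^ (p - 1) + 2 * (N : ℝ) ^ (p + 1) with hL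
  set K : ℝ := ((C + B) * (N + 2) + 4 * B * S.card) * (L + (N : ℝ) ^ p) with hK
  have hL0 : 0 ≤ L := by positivity
  have hK0 : 0 ≤ K := by positivity
  set h₁ := min 1 ((|ν| / (4 * (K + 1))) ^ 2) with hh₁
  have hh₁0 : 0 < h₁ := by positivity
  refine ⟨s₀, hs₀0, h₁, hh₁0, s₀ ^ p / p.factorial * (|ν| / 2) ^ 2, by positivity,
    min_le_left _ _, fun s hs h a n hh hhh ha hb => ?_⟩
  have hs0 : 0 < s := lt_of_lt_of_le (by positivity) hs.1
  have hs1 : s ≤ 1 := hs.2.trans hs₀1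
  set G : ℝ → ℝ := fun x => x ^ p * Real.exp (-(s * x ^ 2)) with hG
  have hGc : Continuous G := by fun_prop
  have hrie := hf.abs_riemann_sum_sub_integral_le (G := G) (a := a) hh
    (hhh.trans (min_le_left _ _)) n hL0 (A := (N : ℝ) ^ p) (by positivity) hGc.continuousOn
    (fun x _ hx => by
      have hx0 := hx.1
      have hxN := hx.2
      simp only [hG]
      rw [abs_of_nonneg (by positivity)]
      have he : Real.exp (-(s * x ^ 2)) ≤ 1 := Real.exp_le_one_iff.2 (by
        have : 0 ≤ s * x ^ 2 := by positivity
        linarith)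
      calc x ^ p * Real.exp (-(s * x ^ 2)) ≤ (N : ℝ) ^ p * 1 := by gcongr
        _ = _ := mul_one _)
    (fun x _ y _ hx hy => abs_pow_mul_exp_sub_le hs0.le hs1 p hx hy)
  rw [hf.integral_mul_eq ha hb, ← hK] at hrie
  have hsqrt : K * √h ≤ |ν| / 4 := by
    have : √h ≤ |ν| / (4 * (K + 1)) := by
      rw [Real.sqrt_le_left (by positivity)]
      exact hhh.trans (min_le_right _ _)
    calc K * √h ≤ (K + 1) * (|ν| / (4 * (K + 1))) := by
          apply mul_le_mul (by linarith) this (Real.sqrt_nonneg _) (by linarith)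
      _ = |ν| / 4 := by field_simp
  have hint : |(∫ x in (0 : ℝ)..N, G x * f x) - ν| ≤ |ν| / 4 := by
    rw [hν, ← intervalIntegral.integral_sub
      (hf.intervalIntegrable_mul hN hGc.continuousOn)
      (hf.intervalIntegrable_mul hN (Continuous.continuousOn (by fun_prop)))]
    have := intervalIntegral.norm_integral_le_of_norm_le_const (a := (0 : ℝ)) (b := N)
      (f := fun x => G x * f x - x ^ p * f x) (C := (N : ℝ) ^ p * (s * N ^ 2) * B)
      (fun x hx => by
        rw [Set.uIoc_of_le hN] at hx
        have hx0 := hx.1.le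
        have hxN := hx.2
        have e1 : G x * f x - x ^ p * f x = -(x ^ p * (1 - Real.exp (-(s * x ^ 2))) * f x) := by
          simp only [hG]; ring
        have e2 : 1 - Real.exp (-(s * x ^ 2)) ≤ s * x ^ 2 := by
          linarith [Real.add_one_le_exp (-(s * x ^ 2))]
        have e3 : 0 ≤ 1 - Real.exp (-(s * x ^ 2)) := by
          have : Real.exp (-(s * x ^ 2)) ≤ 1 := Real.exp_le_one_iff.2 (by
            have : 0 ≤ s * x ^ 2 := by positivity
            linarith)
          linarith
        rw [e1, norm_neg, Real.norm_eq_abs, abs_mul, abs_mul, abs_of_nonneg e3,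
          abs_of_nonneg (by positivity : 0 ≤ x ^ p)]
        have e4 : s * x ^ 2 ≤ s * (N : ℝ) ^ 2 := by gcongr
        exact mul_le_mul (mul_le_mul (by gcongr) (e2.trans e4) e3 (by positivity))
          (hf.bound x) (abs_nonneg _) (by positivity))
    rw [Real.norm_eq_abs] at this
    refine this.trans ?_
    rw [sub_zero, abs_of_nonneg hN]
    calc (N : ℝ) ^ p * (s * N ^ 2) * B * N = s * D := by rw [hD]; ring
      _ ≤ s₀ * D := by gcongr; exact hs.2
      _ ≤ |ν| / 4 := hs₀D
  set T := h * ∑ i ∈ Finset.Icc 1 n, G (a + h * i) * f (a + h * i) with hT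
  have hTge : |ν| / 2 ≤ |T| := by
    have h2 : |ν| ≤ |T| + |T - ∫ x in (0 : ℝ)..N, G x * f x| +
        |(∫ x in (0 : ℝ)..N, G x * f x) - ν| := by
      have e : ν = T - (T - ∫ x in (0 : ℝ)..N, G x * f x) -
        ((∫ x in (0 : ℝ)..N, G x * f x) - ν) := by ring
      calc |ν| = |T - (T - ∫ x in (0 : ℝ)..N, G x * f x) -
            ((∫ x in (0 : ℝ)..N, G x * f x) - ν)| := by rw [← e]
        _ ≤ _ := (abs_sub _ _).trans (add_le_add_left (abs_sub _ _) _)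
    linarith
  have hpd := le_sum_sum_exp_mul s hs0.le p (Finset.Icc 1 n) (fun i : ℕ => a + h * i)
    (fun i => f (a + h * i))
  -- The restriction s ≥ s₀/2 enters here: it gives s₀ ≤ 2s, hence a constant that does not depend
  -- on s.
  calc s₀ ^ p / p.factorial * (|ν| / 2) ^ 2 ≤ (2 * s) ^ p / p.factorial * T ^ 2 := by
        rw [← sq_abs T]
        gcongr
        linarith [hs.1]
    _ = h ^ 2 * ((2 * s) ^ p / p.factorial *
          (∑ i ∈ Finset.Icc 1 n, G (a + h * i) * f (a + h * i)) ^ 2) := by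
        rw [hT]; ring
    _ ≤ _ := by
        simp only [hG]
        exact mul_le_mul_of_nonneg_left hpd (sq_nonneg h)

end PiecewiseHolder

theorem exists_rpow_mul_lt {η : ℝ} (hη : 0 < η) {K ε : ℝ} (hK : 0 ≤ K) (hε : 0 < ε) :
    ∃ h₀ > 0, h₀ ≤ 1 ∧ ∀ h, 0 < h → h ≤ h₀ → K * h ^ η ≤ ε := by
  have hpos : 0 < ε / (K + 1) := by positivity
  refine ⟨min 1 ((ε / (K + 1)) ^ (1 / η)), by positivity, min_le_left _ _, fun h hh hle => ?_⟩
  have h1 : h ^ η ≤ ε / (K + 1) := by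
    calc h ^ η ≤ ((ε / (K + 1)) ^ (1 / η)) ^ η :=
          Real.rpow_le_rpow hh.le (hle.trans (min_le_right _ _)) hη.le
      _ = ε / (K + 1) := by
          rw [← Real.rpow_mul hpos.le, one_div_mul_cancel hη.ne', Real.rpow_one]
  calc K * h ^ η ≤ (K + 1) * (ε / (K + 1)) := by
        apply mul_le_mul (by linarith) h1 (by positivity) (by linarith)
    _ = ε := by field_simp

theorem intervalIntegrable_finsetSum {ι : Type*} {s : Finset ι} {F : ι → ℝ → ℝ} {u v : ℝ}
    (h : ∀ i ∈ s, IntervalIntegrable (F i) volume u v) :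
    IntervalIntegrable (fun x => ∑ i ∈ s, F i x) volume u v := by
  simpa only [Finset.sum_fn] using IntervalIntegrable.sum s h

namespace PiecewiseHolder

variable {N : ℕ} {f : ℝ → ℝ} {S : Finset ℝ} {C B : ℝ}

/-- The form of the mixture is an integral over s of nonnegative Gaussian forms, so the part over
[s₀/2, s₀] already bounds it from below. The constant does not depend on the truncation T, which can
therefore be chosen afterwards. -/
theorem exists_le_sum_sum_gaussianMixture (hf : PiecewiseHolder N f S C B) (p : ℕ)
    (hmom : ∫ x in (0 : ℝ)..N, x ^ p * f x ≠ 0) {α : ℝ} (h0 : 0 < α) (h1 : α < 1) :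
    ∃ s₀ > 0, ∃ h₁ > 0, ∃ c > 0, h₁ ≤ 1 ∧ ∀ T, s₀ ≤ T → ∀ (h a : ℝ) (n : ℕ),
      0 < h → h ≤ h₁ → a ≤ 0 → N ≤ a + h * n →
      c ≤ h ^ 2 * ∑ i ∈ Finset.Icc 1 n, ∑ l ∈ Finset.Icc 1 n,
        gaussianMixture α T ((a + h * i) - (a + h * l)) * (f (a + h * i) * f (a + h * l)) := by
  obtain ⟨s₀, hs₀, h₁, hh₁, c, hc, hle, key⟩ := hf.exists_le_sum_sum_exp p hmom
  refine ⟨s₀, hs₀, h₁, hh₁, (s₀ - s₀ / 2) * (s₀ ^ (α / 2 - 1) * c),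
    mul_pos (by linarith) (by positivity), hle,
    fun T hT h a n hh hhh ha hb => ?_⟩
  set J : ℝ → ℝ := fun s => s ^ (α / 2 - 1) * (h ^ 2 * ∑ i ∈ Finset.Icc 1 n,
    ∑ l ∈ Finset.Icc 1 n, Real.exp (-(s * ((a + h * i) - (a + h * l)) ^ 2)) *
      (f (a + h * i) * f (a + h * l))) with hJ
  have hJexp : J = fun s => ∑ i ∈ Finset.Icc 1 n, ∑ l ∈ Finset.Icc 1 n,
      h ^ 2 * (f (a + h * i) * f (a + h * l)) * (s ^ (α / 2 - 1) *
        Real.exp (-(s * ((a + h * i) - (a + h * l)) ^ 2))) := by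
    funext s
    simp only [hJ, Finset.mul_sum]
    exact Finset.sum_congr rfl fun i _ => Finset.sum_congr rfl fun l _ => by ring
  have hterm : ∀ (u v : ℝ) (i l : ℕ), IntervalIntegrable (fun s : ℝ =>
      h ^ 2 * (f (a + h * i) * f (a + h * l)) * (s ^ (α / 2 - 1) *
        Real.exp (-(s * ((a + h * i) - (a + h * l)) ^ 2)))) volume u v := fun u v i l =>
    (intervalIntegrable_gaussianMixture h0 u v _).const_mul _
  have hJint : ∀ u v, IntervalIntegrable J volume u v := fun u v => by
    rw [hJexp]
    exact intervalIntegrable_finsetSum fun i _ => intervalIntegrable_finsetSum fun l _ =>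
      hterm u v i l
  have hval : h ^ 2 * ∑ i ∈ Finset.Icc 1 n, ∑ l ∈ Finset.Icc 1 n,
        gaussianMixture α T ((a + h * i) - (a + h * l)) * (f (a + h * i) * f (a + h * l)) =
      ∫ s in (0 : ℝ)..T, J s := by
    rw [hJexp, intervalIntegral.integral_finsetSum fun i _ =>
      intervalIntegrable_finsetSum fun l _ => hterm _ _ i l, Finset.mul_sum]
    refine Finset.sum_congr rfl fun i _ => ?_
    rw [intervalIntegral.integral_finsetSum fun l _ => hterm _ _ i l, Finset.mul_sum]
    refine Finset.sum_congr rfl fun l _ => ?_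
    rw [intervalIntegral.integral_const_mul, gaussianMixture]
    ring
  -- The term of order 0 in the series of squares already shows nonnegativity.
  have hJ0 : ∀ s, 0 ≤ s → 0 ≤ J s := fun s hs => by
    have := le_sum_sum_exp_mul s hs 0 (Finset.Icc 1 n) (fun i : ℕ => a + h * i)
      (fun i => f (a + h * i))
    refine mul_nonneg (by positivity) (mul_nonneg (sq_nonneg h) (le_trans ?_ this))
    positivity
  rw [hval, ← intervalIntegral.integral_add_adjacent_intervals (hJint 0 (s₀ / 2))
    (hJint (s₀ / 2) T), ← intervalIntegral.integral_add_adjacent_intervals (hJint (s₀ / 2) s₀)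
    (hJint s₀ T)]
  have e1 : 0 ≤ ∫ s in (0 : ℝ)..(s₀ / 2), J s :=
    intervalIntegral.integral_nonneg (by linarith) fun s hs => hJ0 s hs.1
  have e2 : 0 ≤ ∫ s in s₀..T, J s :=
    intervalIntegral.integral_nonneg hT fun s hs => hJ0 s (hs₀.le.trans hs.1)
  have e3 : (s₀ - s₀ / 2) * (s₀ ^ (α / 2 - 1) * c) ≤ ∫ s in (s₀ / 2)..s₀, J s := by
    have := intervalIntegral.integral_mono_on (μ := volume) (a := s₀ / 2) (b := s₀)
      (f := fun _ => s₀ ^ (α / 2 - 1) * c) (g := J) (by linarith) (by simp) (hJint _ _)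
      (fun s hs => by
        have hs0 : 0 < s := lt_of_lt_of_le (by linarith) hs.1
        refine mul_le_mul (Real.rpow_le_rpow_of_nonpos hs0 hs.2 (by linarith))
          (key s hs h a n hh hhh ha hb) hc.le (by positivity))
    rwa [intervalIntegral.integral_const, smul_eq_mul] at this
  linarith

/-- The power kernel differs from the mixture in two ways. Off the diagonal the tail costs D U, made
at most c/4 by taking T large. On the diagonal the mixture has the finite value A while the power is
0; this costs O(h), made at most c/4 by taking h small. Half of the constant c survives. -/
theorem exists_le_gridForm_rpow (hf : PiecewiseHolder N f S C B) (p : ℕ)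
    (hmom : ∫ x in (0 : ℝ)..N, x ^ p * f x ≠ 0) {α : ℝ} (h0 : 0 < α) (h1 : α < 1) :
    ∃ h₁ > 0, ∃ c > 0, h₁ ≤ 1 ∧ ∀ (h a : ℝ) (n : ℕ),
      0 < h → h ≤ h₁ → a ≤ 0 → N ≤ a + h * n →
      c * h ^ α ≤ gridForm (fun k => (k : ℝ) ^ (-α)) f a h n := by
  obtain ⟨s₀, hs₀, h₁, hh₁, c, hc, hle, key⟩ :=
    hf.exists_le_sum_sum_gaussianMixture p hmom h0 h1
  have hα : 0 < 1 - α := by linarith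
  have hB := hf.bound_nonneg
  have hN : (0 : ℝ) ≤ N := N.cast_nonneg
  set α' := (1 + α) / 2 with hα'
  have hα'0 : 0 < α' := by linarith
  have hα'1 : α' < 1 := by linarith
  set U := B ^ 2 * (N + 1) * (2 * ((N : ℝ) ^ (1 - α') / (1 - α'))) with hU
  have hU0 : 0 ≤ U := by
    have : 0 < 1 - α' := by linarith
    positivity
  -- the truncation level
  obtain ⟨t₀, ht₀, -, htr⟩ := exists_rpow_mul_lt (η := (1 - α) / 4) (by linarith)
    (K := 4 / (1 - α) * U) (ε := c / 4) (by positivity) (by linarith)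
  set T := max s₀ t₀⁻¹ with hT
  have hT0 : 0 < T := lt_max_of_lt_left hs₀
  set D := 4 / (1 - α) * T ^ (-((1 - α) / 4)) with hD
  have hD0 : 0 ≤ D := by positivity
  have hDU : D * U ≤ c / 4 := by
    have := htr T⁻¹ (by positivity) (by
      rw [inv_le_comm₀ hT0 ht₀]; exact le_max_right _ _)
    rw [Real.inv_rpow hT0.le, ← Real.rpow_neg hT0.le] at this
    calc D * U = 4 / (1 - α) * U * T ^ (-((1 - α) / 4)) := by rw [hD]; ring
      _ ≤ c / 4 := this
  set A := gaussianMixture α T 0 with hA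
  have hA0 : 0 ≤ A := intervalIntegral.integral_nonneg hT0.le fun s hs => by
    have := hs.1
    positivity
  obtain ⟨h₂, hh₂, hh₂1, hdiag⟩ := exists_rpow_mul_lt (η := 1) one_pos
    (K := A * (B ^ 2 * (N + 1))) (ε := c / 4) (by positivity) (by linarith)
  have hΓ : 0 < Real.Gamma (α / 2) := Real.Gamma_pos_of_pos (by linarith)
  refine ⟨min h₁ h₂, lt_min hh₁ hh₂, c / 2 / Real.Gamma (α / 2), by positivity,
    (min_le_left _ _).trans hle, fun h a n hh hhh ha hb => ?_⟩
  have hh1 : h ≤ 1 := hhh.trans ((min_le_left _ _).trans hle)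
  have hlow := key T (le_max_left _ _) h a n hh (hhh.trans (min_le_left _ _)) ha hb
  have hup := hf.gridForm_rpow_abs_le hα'0 hα'1 hh hh1 a n
  have hsq := hf.sq_mul_sum_sq_le hh hh1 a n
  have hd := hdiag h hh (hhh.trans (min_le_right _ _))
  rw [Real.rpow_one] at hd
  rw [← hU] at hup
  -- termwise comparison
  have habs : ∀ i l : ℕ, |(a + h * i) - (a + h * l)| = h * (((i : ℤ) - l).natAbs : ℝ) := by
    intro i l
    rw [natAbs_sub_cast, ← abs_of_pos hh, ← abs_mul, abs_of_pos hh]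
    congr 1; ring
  have hterm : ∀ i l : ℕ, gaussianMixture α T ((a + h * i) - (a + h * l)) *
      (f (a + h * i) * f (a + h * l)) ≤
      Real.Gamma (α / 2) * h ^ (-α) * ((((i : ℤ) - l).natAbs : ℝ) ^ (-α) *
        (f (a + h * i) * f (a + h * l))) +
      (if i = l then A * f (a + h * i) ^ 2 else 0) +
      D * h ^ (-α') * ((((i : ℤ) - l).natAbs : ℝ) ^ (-α') *
        (|f (a + h * i)| * |f (a + h * l)|)) := by
    intro i l
    by_cases hil : i = l
    · subst hil
      simp only [sub_self, ← hA, Int.natAbs_zero, Nat.cast_zero,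
        Real.zero_rpow (neg_ne_zero.2 h0.ne'), Real.zero_rpow (neg_ne_zero.2 hα'0.ne'), if_true]
      apply le_of_eq
      ring
    · have hne : (a + h * i) - (a + h * l) ≠ 0 := by
        rw [add_sub_add_left_eq_sub, ← mul_sub]
        exact mul_ne_zero hh.ne' (sub_ne_zero.2 (by exact_mod_cast hil))
      have := abs_sub_gaussianMixture_le h0 h1 hT0 hne
      rw [habs, Real.mul_rpow hh.le (by positivity), Real.mul_rpow hh.le (by positivity)] at this
      rw [if_neg hil, add_zero]
      set k := (((i : ℤ) - l).natAbs : ℝ)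
      set u := f (a + h * i) * f (a + h * l) with hu
      set g := gaussianMixture α T (a + h * i - (a + h * l))
      have e1 : |Real.Gamma (α / 2) * (h ^ (-α) * k ^ (-α)) - g| * |u| ≤
          D * (h ^ (-α') * k ^ (-α')) * |u| := mul_le_mul_of_nonneg_right this (abs_nonneg _)
      rw [← abs_mul] at e1
      have e2 := (abs_le.1 e1).1
      have e3 : |u| = |f (a + h * i)| * |f (a + h * l)| := abs_mul _ _
      rw [← e3]
      nlinarith
  have hsum := Finset.sum_le_sum fun i (_ : i ∈ Finset.Icc 1 n) =>
    Finset.sum_le_sum fun l (_ : l ∈ Finset.Icc 1 n) => hterm i l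
  simp only [Finset.sum_add_distrib, ← Finset.mul_sum, Finset.sum_ite_eq] at hsum
  have hsum2 : ∑ i ∈ Finset.Icc 1 n, (if i ∈ Finset.Icc 1 n then A * f (a + h * i) ^ 2 else 0) =
      A * ∑ i ∈ Finset.Icc 1 n, f (a + h * i) ^ 2 := by
    rw [Finset.mul_sum]
    exact Finset.sum_congr rfl fun i hi => if_pos hi
  rw [hsum2] at hsum
  have hsum3 := mul_le_mul_of_nonneg_left hsum (sq_nonneg h)
  have hfin : c ≤ Real.Gamma (α / 2) * h ^ (-α) * gridForm (fun k => (k : ℝ) ^ (-α)) f a h n +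
      A * (B ^ 2 * (N + 1) * h) + D * h ^ (-α') * (U * h ^ α') := by
    calc c ≤ _ := hlow
      _ ≤ _ := hsum3
      _ = Real.Gamma (α / 2) * h ^ (-α) * gridForm (fun k => (k : ℝ) ^ (-α)) f a h n +
          A * (h ^ 2 * ∑ i ∈ Finset.Icc 1 n, f (a + h * i) ^ 2) + D * h ^ (-α') *
            gridForm (fun k => (k : ℝ) ^ (-α')) (fun x => |f x|) a h n := by
          unfold gridForm
          ring
      _ ≤ _ := by gcongr
  have e4 : D * h ^ (-α') * (U * h ^ α') = D * U := by
    have : h ^ (-α') * h ^ α' = 1 := by rw [← Real.rpow_add hh]; simp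
    calc _ = D * U * (h ^ (-α') * h ^ α') := by ring
      _ = _ := by rw [this, mul_one]
  have e5 : c / 2 ≤ Real.Gamma (α / 2) * h ^ (-α) *
      gridForm (fun k => (k : ℝ) ^ (-α)) f a h n := by
    rw [e4] at hfin
    nlinarith
  have e6 : h ^ α * h ^ (-α) = 1 := by rw [← Real.rpow_add hh]; simp
  calc c / 2 / Real.Gamma (α / 2) * h ^ α
      ≤ (Real.Gamma (α / 2) * h ^ (-α) * gridForm (fun k => (k : ℝ) ^ (-α)) f a h n) /
        Real.Gamma (α / 2) * h ^ α := by gcongr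
    _ = (h ^ α * h ^ (-α)) * gridForm (fun k => (k : ℝ) ^ (-α)) f a h n := by
        field_simp
    _ = _ := by rw [e6, one_mul]

end PiecewiseHolder

/-! ### From the power law to the autocovariance -/

/-- The equivalence controls all large lags with relative error ε. The finitely many remaining lags
are absorbed by D k^(-α'), whatever the exponent α'. -/
theorem exists_abs_sub_le_of_isEquivalent {γ : ℕ → ℝ} {Cγ α : ℝ} (α' : ℝ) (hCγ : 0 < Cγ)
    (hdecay : Asymptotics.IsEquivalent atTop γ (fun k : ℕ => Cγ * (k : ℝ) ^ (-α)))
    {ε : ℝ} (hε : 0 < ε) :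
    ∃ D ≥ 0, ∀ k : ℕ, k ≠ 0 →
      |γ k - Cγ * (k : ℝ) ^ (-α)| ≤ ε * (k : ℝ) ^ (-α) + D * (k : ℝ) ^ (-α') := by
  have h := hdecay.isLittleO.def (c := ε / Cγ) (by positivity)
  obtain ⟨K, hK⟩ := eventually_atTop.1 h
  refine ⟨∑ k ∈ Finset.range K, |γ k - Cγ * (k : ℝ) ^ (-α)| * (k : ℝ) ^ α',
    Finset.sum_nonneg fun k _ => by positivity, fun k hk => ?_⟩
  have hkpos : (0 : ℝ) < k := by exact_mod_cast Nat.pos_of_ne_zero hk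
  have hDn : 0 ≤ ∑ k ∈ Finset.range K, |γ k - Cγ * (k : ℝ) ^ (-α)| * (k : ℝ) ^ α' :=
    Finset.sum_nonneg fun k _ => by positivity
  by_cases hkK : K ≤ k
  · have := hK k hkK
    simp only [Pi.sub_apply, Real.norm_eq_abs] at this
    rw [abs_of_pos (by positivity : 0 < Cγ * (k : ℝ) ^ (-α))] at this
    have e : ε / Cγ * (Cγ * (k : ℝ) ^ (-α)) = ε * (k : ℝ) ^ (-α) := by field_simp
    have : 0 ≤ (∑ k ∈ Finset.range K, |γ k - Cγ * (k : ℝ) ^ (-α)| * (k : ℝ) ^ α') *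
      (k : ℝ) ^ (-α') := by positivity
    linarith
  · have hs := Finset.single_le_sum
      (f := fun k : ℕ => |γ k - Cγ * (k : ℝ) ^ (-α)| * (k : ℝ) ^ α')
      (fun k _ => by positivity) (Finset.mem_range.2 (not_le.1 hkK))
    have h1 : (k : ℝ) ^ α' * (k : ℝ) ^ (-α') = 1 := by rw [← Real.rpow_add hkpos]; simp
    have h2 : 0 ≤ ε * (k : ℝ) ^ (-α) := by positivity
    calc |γ k - Cγ * (k : ℝ) ^ (-α)|
        = |γ k - Cγ * (k : ℝ) ^ (-α)| * (k : ℝ) ^ α' * (k : ℝ) ^ (-α') := by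
          rw [mul_assoc, h1, mul_one]
      _ ≤ (∑ k ∈ Finset.range K, |γ k - Cγ * (k : ℝ) ^ (-α)| * (k : ℝ) ^ α') *
          (k : ℝ) ^ (-α') := by gcongr
      _ ≤ _ := by linarith

theorem abs_gridForm_sub_le {γ : ℕ → ℝ} {Cγ α α' ε D : ℝ} (hα : 0 < α) (hα' : 0 < α')
    (hγ : ∀ k : ℕ, k ≠ 0 →
      |γ k - Cγ * (k : ℝ) ^ (-α)| ≤ ε * (k : ℝ) ^ (-α) + D * (k : ℝ) ^ (-α'))
    (f : ℝ → ℝ) (a h : ℝ) (n : ℕ) :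
    |gridForm γ f a h n - Cγ * gridForm (fun k => (k : ℝ) ^ (-α)) f a h n| ≤
      |γ 0| * (h ^ 2 * ∑ i ∈ Finset.Icc 1 n, f (a + h * i) ^ 2) +
      ε * gridForm (fun k => (k : ℝ) ^ (-α)) (fun x => |f x|) a h n +
      D * gridForm (fun k => (k : ℝ) ^ (-α')) (fun x => |f x|) a h n := by
  have hterm : ∀ i l : ℕ, |γ ((i : ℤ) - l).natAbs * (f (a + h * i) * f (a + h * l)) -
      Cγ * ((((i : ℤ) - l).natAbs : ℝ) ^ (-α) * (f (a + h * i) * f (a + h * l)))| ≤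
      (if i = l then |γ 0| * f (a + h * i) ^ 2 else 0) +
      ε * ((((i : ℤ) - l).natAbs : ℝ) ^ (-α) * (|f (a + h * i)| * |f (a + h * l)|)) +
      D * ((((i : ℤ) - l).natAbs : ℝ) ^ (-α') * (|f (a + h * i)| * |f (a + h * l)|)) := by
    intro i l
    by_cases hil : i = l
    · subst hil
      simp only [sub_self, Int.natAbs_zero, Nat.cast_zero,
        Real.zero_rpow (neg_ne_zero.2 hα.ne'), Real.zero_rpow (neg_ne_zero.2 hα'.ne'), if_true]
      rw [← sq, zero_mul, mul_zero, sub_zero, abs_mul,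
        abs_of_nonneg (sq_nonneg (f (a + h * i)))]
      simp
    · rw [if_neg hil, zero_add, ← abs_mul (f _) (f _)]
      generalize f (a + h * i) * f (a + h * l) = u
      rw [← mul_assoc, ← sub_mul, abs_mul]
      have := hγ ((i : ℤ) - l).natAbs (by omega)
      refine (mul_le_mul_of_nonneg_right this (abs_nonneg _)).trans (le_of_eq ?_)
      ring
  unfold gridForm
  have e : h ^ 2 * ∑ i ∈ Finset.Icc 1 n, ∑ l ∈ Finset.Icc 1 n,
        γ ((i : ℤ) - l).natAbs * (f (a + h * i) * f (a + h * l)) -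
      Cγ * (h ^ 2 * ∑ i ∈ Finset.Icc 1 n, ∑ l ∈ Finset.Icc 1 n,
        (((i : ℤ) - l).natAbs : ℝ) ^ (-α) * (f (a + h * i) * f (a + h * l))) =
      h ^ 2 * ∑ i ∈ Finset.Icc 1 n, ∑ l ∈ Finset.Icc 1 n,
        (γ ((i : ℤ) - l).natAbs * (f (a + h * i) * f (a + h * l)) -
        Cγ * ((((i : ℤ) - l).natAbs : ℝ) ^ (-α) * (f (a + h * i) * f (a + h * l)))) := by
    simp only [Finset.sum_sub_distrib, ← Finset.mul_sum]
    ring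
  rw [e, abs_mul, abs_of_nonneg (sq_nonneg h)]
  have hs : |∑ i ∈ Finset.Icc 1 n, ∑ l ∈ Finset.Icc 1 n,
        (γ ((i : ℤ) - l).natAbs * (f (a + h * i) * f (a + h * l)) -
        Cγ * ((((i : ℤ) - l).natAbs : ℝ) ^ (-α) * (f (a + h * i) * f (a + h * l))))| ≤ _ :=
    (Finset.abs_sum_le_sum_abs _ _).trans (Finset.sum_le_sum fun i _ =>
      (Finset.abs_sum_le_sum_abs _ _).trans (Finset.sum_le_sum fun l _ => hterm i l))
  refine (mul_le_mul_of_nonneg_left hs (sq_nonneg h)).trans (le_of_eq ?_)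
  simp only [Finset.sum_add_distrib, ← Finset.mul_sum, Finset.sum_ite_eq]
  have hsum2 : ∑ i ∈ Finset.Icc 1 n,
      (if i ∈ Finset.Icc 1 n then |γ 0| * f (a + h * i) ^ 2 else 0) =
      |γ 0| * ∑ i ∈ Finset.Icc 1 n, f (a + h * i) ^ 2 := by
    rw [Finset.mul_sum]
    exact Finset.sum_congr rfl fun i hi => if_pos hi
  rw [hsum2]
  ring

namespace PiecewiseHolder

variable {N : ℕ} {f : ℝ → ℝ} {S : Finset ℝ} {C B : ℝ} {γ : ℕ → ℝ} {Cγ α : ℝ}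

/-- The diagonal and the finitely many bad lags are of order h^((1+α)/2), smaller than h^α because
(1 + α)/2 > α. Only the arbitrarily small relative error remains at the leading order. -/
theorem exists_abs_gridForm_sub_le (hf : PiecewiseHolder N f S C B) (h0 : 0 < α) (h1 : α < 1)
    (hCγ : 0 < Cγ)
    (hdecay : Asymptotics.IsEquivalent atTop γ (fun k : ℕ => Cγ * (k : ℝ) ^ (-α)))
    {ε : ℝ} (hε : 0 < ε) :
    ∃ V ≥ 0, ∀ (h a : ℝ) (n : ℕ), 0 < h → h ≤ 1 →
      |gridForm γ f a h n - Cγ * gridForm (fun k => (k : ℝ) ^ (-α)) f a h n| ≤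
        ε * h ^ α + V * h ^ ((1 + α) / 2) := by
  have hα : 0 < 1 - α := by linarith
  have hB := hf.bound_nonneg
  set U := B ^ 2 * (N + 1) * (2 * ((N : ℝ) ^ (1 - α) / (1 - α))) with hU
  have hU0 : 0 ≤ U := by positivity
  set α' := (1 + α) / 2 with hα'
  have hα'0 : 0 < α' := by linarith
  have hα'1 : α' < 1 := by linarith
  have hα'2 : 0 < 1 - α' := by linarith
  set U' := B ^ 2 * (N + 1) * (2 * ((N : ℝ) ^ (1 - α') / (1 - α'))) with hU'
  have hU'0 : 0 ≤ U' := by positivity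
  obtain ⟨D, hD, hγ⟩ := exists_abs_sub_le_of_isEquivalent α' hCγ hdecay
    (ε := ε / (U + 1)) (by positivity)
  refine ⟨|γ 0| * (B ^ 2 * (N + 1)) + D * U', by positivity, fun h a n hh hh1 => ?_⟩
  refine (abs_gridForm_sub_le h0 hα'0 hγ f a h n).trans ?_
  have e1 := hf.sq_mul_sum_sq_le hh hh1 a n
  have e2 := hf.gridForm_rpow_abs_le h0 h1 hh hh1 a n
  have e3 := hf.gridForm_rpow_abs_le hα'0 hα'1 hh hh1 a n
  rw [← hU] at e2
  rw [← hU'] at e3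
  have e4 : h ≤ h ^ α' := by
    calc h = h ^ (1 : ℝ) := (Real.rpow_one h).symm
      _ ≤ h ^ α' := Real.rpow_le_rpow_of_exponent_ge hh hh1 hα'1.le
  have e5 : ε / (U + 1) * U ≤ ε := by
    rw [div_mul_eq_mul_div, div_le_iff₀ (by linarith)]
    nlinarith
  calc _ ≤ |γ 0| * (B ^ 2 * (N + 1) * h ^ α') + ε / (U + 1) * (U * h ^ α) +
        D * (U' * h ^ α') := by
        have e6 := e1.trans (mul_le_mul_of_nonneg_left e4
          (by positivity : (0 : ℝ) ≤ B ^ 2 * (N + 1)))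
        exact add_le_add (add_le_add (mul_le_mul_of_nonneg_left e6 (abs_nonneg _))
          (mul_le_mul_of_nonneg_left e2 (by positivity))) (mul_le_mul_of_nonneg_left e3 hD)
    _ = ε / (U + 1) * U * h ^ α + (|γ 0| * (B ^ 2 * (N + 1)) + D * U') * h ^ α' := by ring
    _ ≤ _ := by gcongr

theorem exists_gridForm_le (hf : PiecewiseHolder N f S C B) (h0 : 0 < α) (h1 : α < 1)
    (hCγ : 0 < Cγ)
    (hdecay : Asymptotics.IsEquivalent atTop γ (fun k : ℕ => Cγ * (k : ℝ) ^ (-α))) :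
    ∃ V ≥ 0, ∀ (h a : ℝ) (n : ℕ), 0 < h → h ≤ 1 → gridForm γ f a h n ≤ V * h ^ α := by
  have hα : 0 < 1 - α := by linarith
  have hB := hf.bound_nonneg
  obtain ⟨V, hV, key⟩ := hf.exists_abs_gridForm_sub_le h0 h1 hCγ hdecay one_pos
  set U := B ^ 2 * (N + 1) * (2 * ((N : ℝ) ^ (1 - α) / (1 - α))) with hU
  have hU0 : 0 ≤ U := by positivity
  refine ⟨Cγ * U + 1 + V, by positivity, fun h a n hh hh1 => ?_⟩
  have e1 := (abs_le.1 (key h a n hh hh1)).2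
  have e2 := hf.gridForm_rpow_abs_le h0 h1 hh hh1 a n
  rw [← hU] at e2
  have e3 : gridForm (fun k => (k : ℝ) ^ (-α)) f a h n ≤
      gridForm (fun k => (k : ℝ) ^ (-α)) (fun x => |f x|) a h n := by
    unfold gridForm
    refine mul_le_mul_of_nonneg_left (Finset.sum_le_sum fun i _ => Finset.sum_le_sum fun l _ =>
      mul_le_mul_of_nonneg_left ?_ (by positivity)) (sq_nonneg h)
    rw [← abs_mul]
    exact le_abs_self _
  have e4 : h ^ ((1 + α) / 2) ≤ h ^ α :=
    Real.rpow_le_rpow_of_exponent_ge hh hh1 (by linarith)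
  have e5 := mul_le_mul_of_nonneg_left (e3.trans e2) hCγ.le
  have e6 := mul_le_mul_of_nonneg_left e4 hV
  linarith

theorem exists_le_gridForm (hf : PiecewiseHolder N f S C B) (p : ℕ)
    (hmom : ∫ x in (0 : ℝ)..N, x ^ p * f x ≠ 0) (h0 : 0 < α) (h1 : α < 1) (hCγ : 0 < Cγ)
    (hdecay : Asymptotics.IsEquivalent atTop γ (fun k : ℕ => Cγ * (k : ℝ) ^ (-α))) :
    ∃ h₁ > 0, ∃ c > 0, h₁ ≤ 1 ∧ ∀ (h a : ℝ) (n : ℕ),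
      0 < h → h ≤ h₁ → a ≤ 0 → N ≤ a + h * n → c * h ^ α ≤ gridForm γ f a h n := by
  obtain ⟨h₁, hh₁, c, hc, hle, hlow⟩ := hf.exists_le_gridForm_rpow p hmom h0 h1
  -- The relative error and the lower-order remainder may each use a quarter of the main constant Cγ
  -- c, which leaves Cγ c / 2.
  obtain ⟨V, hV, key⟩ := hf.exists_abs_gridForm_sub_le h0 h1 hCγ hdecay
    (ε := Cγ * c / 4) (by positivity)
  obtain ⟨h₂, hh₂, -, hsmall⟩ := exists_rpow_mul_lt (η := (1 - α) / 2) (by linarith) hV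
    (ε := Cγ * c / 4) (by positivity)
  refine ⟨min h₁ h₂, lt_min hh₁ hh₂, Cγ * c / 2, by positivity, (min_le_left _ _).trans hle,
    fun h a n hh hhh ha hb => ?_⟩
  have e1 := (abs_le.1 (key h a n hh ((hhh.trans (min_le_left _ _)).trans hle))).1
  have e2 := mul_le_mul_of_nonneg_left
    (hlow h a n hh (hhh.trans (min_le_left _ _)) ha hb) hCγ.le
  have e3 := mul_le_mul_of_nonneg_right (hsmall h hh (hhh.trans (min_le_right _ _)))
    (Real.rpow_nonneg hh.le α)
  rw [mul_assoc, ← Real.rpow_add hh, show (1 - α) / 2 + α = (1 + α) / 2 by ring] at e3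
  linarith

end PiecewiseHolder

/-! ### Risk of a single Gaussian coefficient -/

section GaussianVariable

variable {Ω : Type*} [MeasurableSpace Ω] {P : Measure Ω} {X : Ω → ℝ} {μ v : ℝ}

/-- The density is at most 1/(2√v), because 2π ≥ 4, and the interval has length √v. The bound is
uniform in the centre d, so no bias can help the estimator. -/
theorem gaussianReal_abs_sub_lt_le (hv : 0 < v) (d : ℝ) :
    gaussianReal μ v.toNNReal {x | (x - d) ^ 2 < v / 4} ≤ 1 / 2 := by
  have hv' : v.toNNReal ≠ 0 := (Real.toNNReal_pos.2 hv).ne'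
  have hsub : {x : ℝ | (x - d) ^ 2 < v / 4} ⊆ Set.Icc (d - √v / 2) (d + √v / 2) := by
    intro x hx
    have h1 : (x - d) ^ 2 < (√v / 2) ^ 2 := by
      rw [div_pow, Real.sq_sqrt hv.le]
      norm_num
      exact hx
    have h2 := abs_lt_of_sq_lt_sq h1 (by positivity)
    rw [abs_lt] at h2
    exact ⟨by linarith, by linarith⟩
  refine (measure_mono hsub).trans ?_
  rw [gaussianReal_apply μ hv']
  have hpdf : ∀ x, gaussianPDF μ v.toNNReal x ≤ ENNReal.ofReal (1 / (2 * √v)) := by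
    intro x
    rw [gaussianPDF]
    refine ENNReal.ofReal_le_ofReal ?_
    rw [gaussianPDFReal, Real.coe_toNNReal v hv.le]
    have h1 : Real.exp (-(x - μ) ^ 2 / (2 * v)) ≤ 1 := Real.exp_le_one_iff.2
      (div_nonpos_of_nonpos_of_nonneg (neg_nonpos.2 (sq_nonneg _)) (by positivity))
    have h2 : 2 * √v ≤ √(2 * Real.pi * v) := by
      rw [show 2 * √v = √(4 * v) by
        rw [Real.sqrt_mul (by norm_num), show (4 : ℝ) = 2 ^ 2 by norm_num,
          Real.sqrt_sq (by norm_num)]]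
      refine Real.sqrt_le_sqrt ?_
      nlinarith [Real.pi_gt_three]
    have hsv : 0 < √v := Real.sqrt_pos.2 hv
    calc (√(2 * Real.pi * v))⁻¹ * Real.exp (-(x - μ) ^ 2 / (2 * v))
        ≤ (2 * √v)⁻¹ * 1 := by gcongr
      _ = _ := by rw [mul_one, one_div]
  have hsv : 0 < √v := Real.sqrt_pos.2 hv
  calc ∫⁻ x in Set.Icc (d - √v / 2) (d + √v / 2), gaussianPDF μ v.toNNReal x
      ≤ ∫⁻ _ in Set.Icc (d - √v / 2) (d + √v / 2), ENNReal.ofReal (1 / (2 * √v)) :=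
        lintegral_mono fun x => hpdf x
    _ = ENNReal.ofReal (1 / (2 * √v)) * ENNReal.ofReal (√v) := by
        rw [setLIntegral_const, Real.volume_Icc]
        congr 2
        ring
    _ = ENNReal.ofReal (1 / 2) := by
        rw [← ENNReal.ofReal_mul (by positivity)]
        congr 1
        field_simp
    _ = 1 / 2 := by
        rw [ENNReal.ofReal_div_of_pos (by norm_num)]
        simp

theorem half_le_measure_of_gaussian (hX : AEMeasurable X P)
    (hlaw : P.map X = gaussianReal μ v.toNNReal) (hv : 0 < v) (d : ℝ) :
    1 / 2 ≤ P {ω | v / 4 ≤ (X ω - d) ^ 2} := by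
  have hmeas : MeasurableSet {x : ℝ | (x - d) ^ 2 < v / 4} :=
    measurableSet_lt (by fun_prop) measurable_const
  have h1 := gaussianReal_abs_sub_lt_le (μ := μ) hv d
  have h2 : P {ω | v / 4 ≤ (X ω - d) ^ 2} =
      gaussianReal μ v.toNNReal {x | (x - d) ^ 2 < v / 4}ᶜ := by
    rw [← hlaw, Measure.map_apply_of_aemeasurable hX hmeas.compl]
    congr 1
    ext ω
    simp
  rw [h2, prob_compl_eq_one_sub hmeas]
  calc (1 / 2 : ℝ≥0∞) = 1 - 1 / 2 := by
        rw [one_div, ENNReal.one_sub_inv_two]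
    _ ≤ _ := tsub_le_tsub_left h1 1

theorem ofReal_half_le_lintegral_of_gaussian (hX : AEMeasurable X P)
    (hlaw : P.map X = gaussianReal μ v.toNNReal) (hv : 0 < v) {t d : ℝ} {F : Ω → ℝ}
    (hF : ∀ ω, v / 4 ≤ (X ω - d) ^ 2 → t ≤ F ω) :
    ENNReal.ofReal (t / 2) ≤ ∫⁻ ω, ENNReal.ofReal (F ω) ∂P := by
  have hms : NullMeasurableSet {ω | v / 4 ≤ (X ω - d) ^ 2} P :=
    nullMeasurableSet_le aemeasurable_const ((hX.sub_const d).pow_const 2)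
  calc ENNReal.ofReal (t / 2) = ENNReal.ofReal t * (1 / 2) := by
        rw [ENNReal.ofReal_div_of_pos (by norm_num), ENNReal.div_eq_inv_mul, mul_comm]
        simp
    _ ≤ ENNReal.ofReal t * P {ω | v / 4 ≤ (X ω - d) ^ 2} := by
        gcongr
        exact half_le_measure_of_gaussian hX hlaw hv d
    _ = ∫⁻ _ in {ω | v / 4 ≤ (X ω - d) ^ 2}, ENNReal.ofReal t ∂P := by
        rw [setLIntegral_const]
    _ = ∫⁻ ω, {ω | v / 4 ≤ (X ω - d) ^ 2}.indicator (fun _ => ENNReal.ofReal t) ω ∂P := by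
        rw [lintegral_indicator₀ hms]
    _ ≤ ∫⁻ ω, ENNReal.ofReal (F ω) ∂P := by
        refine lintegral_mono fun ω => ?_
        by_cases hω : ω ∈ {ω | v / 4 ≤ (X ω - d) ^ 2}
        · rw [Set.indicator_of_mem hω]
          exact ENNReal.ofReal_le_ofReal (hF ω hω)
        · rw [Set.indicator_of_notMem hω]
          exact zero_le

/-- A kept coefficient pays its own error and a discarded one pays d². This is what makes the lower
bound uniform over all thresholds. -/
theorem min_le_sq_sub_hardThreshold (δ : ℝ≥0∞) (d x : ℝ) :
    min (d ^ 2) ((x - d) ^ 2) ≤ (d - hardThreshold δ x) ^ 2 := by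
  unfold hardThreshold
  split_ifs
  · refine (min_le_right _ _).trans (le_of_eq (by ring))
  · refine (min_le_left _ _).trans (le_of_eq (by ring))

/-- Writing X as μ + √v Z with Z standard Gaussian, c is the moment of order 2p of Z. -/
theorem exists_lintegral_pow_le_of_gaussian (p : ℕ) :
    ∃ c ≥ (0 : ℝ), ∀ {Ω : Type*} [MeasurableSpace Ω] {P : Measure Ω} {X : Ω → ℝ} {μ v : ℝ},
      AEMeasurable X P → P.map X = gaussianReal μ v.toNNReal → 0 ≤ v →
      ∫⁻ ω, ENNReal.ofReal ((X ω - μ) ^ (2 * p)) ∂P ≤ ENNReal.ofReal (c * v ^ p) := by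
  have hint : Integrable (fun x : ℝ => x ^ (2 * p)) (gaussianReal 0 1) := by
    have := (memLp_id_gaussianReal (μ := 0) (v := 1) ((2 * p : ℕ) : ℝ≥0)).integrable_norm_pow'
    simpa [pow_mul] using this
  refine ⟨∫ x, x ^ (2 * p) ∂gaussianReal 0 1, integral_nonneg fun x => by
    simp only [pow_mul]; positivity, fun {Ω} _ {P} {X} {μ v} hX hlaw hv => ?_⟩
  have hsc : gaussianReal μ v.toNNReal = (gaussianReal 0 1).map (fun x => μ + √v * x) := by
    have h1 := gaussianReal_map_const_mul (μ := 0) (v := 1) (√v)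
    have h2 := gaussianReal_map_const_add (μ := √v * 0) (v := .mk (√v ^ 2) (sq_nonneg _) * 1) μ
    rw [← h1, Measure.map_map (by fun_prop) (by fun_prop)] at h2
    have hvv : v.toNNReal = .mk (√v ^ 2) (sq_nonneg _) * 1 := by
      ext
      simp [Real.sq_sqrt hv, hv]
    rw [hvv]
    have h3 : √v * 0 + μ = μ := by ring
    rw [h3] at h2
    exact h2.symm
  calc ∫⁻ ω, ENNReal.ofReal ((X ω - μ) ^ (2 * p)) ∂P
      = ∫⁻ x, ENNReal.ofReal ((x - μ) ^ (2 * p)) ∂(P.map X) := by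
        rw [lintegral_map' (by fun_prop) hX]
    _ = ∫⁻ x, ENNReal.ofReal ((x - μ) ^ (2 * p)) ∂((gaussianReal 0 1).map
          (fun x => μ + √v * x)) := by rw [hlaw, hsc]
    _ = ∫⁻ x, ENNReal.ofReal (v ^ p * x ^ (2 * p)) ∂(gaussianReal 0 1) := by
        rw [lintegral_map (by fun_prop) (by fun_prop)]
        refine lintegral_congr fun x => ?_
        rw [add_sub_cancel_left, mul_pow, pow_mul (√v), Real.sq_sqrt hv]
    _ = ENNReal.ofReal (∫ x, v ^ p * x ^ (2 * p) ∂(gaussianReal 0 1)) := by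
        rw [ofReal_integral_eq_lintegral_ofReal (hint.const_mul _)
          (Eventually.of_forall fun x => ?_)]
        simp only [pow_mul, Pi.zero_apply]
        positivity
    _ ≤ _ := by rw [integral_const_mul, mul_comm]

theorem lintegral_sq_sub_le_of_gaussian {c : ℝ} (hc : 0 ≤ c) (hv : 0 ≤ v) (hX : AEMeasurable X P)
    [IsProbabilityMeasure P]
    (hmom : ∫⁻ ω, ENNReal.ofReal ((X ω - μ) ^ (2 * 1)) ∂P ≤ ENNReal.ofReal (c * v ^ 1))
    (d : ℝ) {e : ℝ} (he : 0 ≤ e) :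
    ∫⁻ ω, ENNReal.ofReal (2 * (d - X ω) ^ 2 + e) ∂P ≤
      ENNReal.ofReal (4 * c * v + 4 * (μ - d) ^ 2 + e) := by
  simp only [mul_one, pow_one] at hmom
  calc ∫⁻ ω, ENNReal.ofReal (2 * (d - X ω) ^ 2 + e) ∂P
      ≤ ∫⁻ ω, (ENNReal.ofReal 4 * ENNReal.ofReal ((X ω - μ) ^ 2) +
          ENNReal.ofReal (4 * (μ - d) ^ 2 + e)) ∂P := by
        refine lintegral_mono fun ω => ?_
        rw [← ENNReal.ofReal_mul (by norm_num), ← ENNReal.ofReal_add (by positivity)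
          (by positivity)]
        refine ENNReal.ofReal_le_ofReal ?_
        nlinarith [sq_nonneg ((X ω - μ) - (μ - d))]
    _ = ENNReal.ofReal 4 * ∫⁻ ω, ENNReal.ofReal ((X ω - μ) ^ 2) ∂P +
          ENNReal.ofReal (4 * (μ - d) ^ 2 + e) := by
        rw [lintegral_add_right _ measurable_const, lintegral_const, measure_univ, mul_one,
          lintegral_const_mul'' _ (((hX.sub_const μ).pow_const _).ennreal_ofReal)]
    _ ≤ ENNReal.ofReal 4 * ENNReal.ofReal (c * v) +
          ENNReal.ofReal (4 * (μ - d) ^ 2 + e) := by gcongr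
    _ = _ := by
        rw [← ENNReal.ofReal_mul (by norm_num), ← ENNReal.ofReal_add (by positivity)
          (by positivity)]
        congr 1
        ring

/-- A crude bound without assumption on the mean. It serves the boundary coefficients, whose number
per level is bounded. -/
theorem sq_sub_hardThreshold_le {δ : ℝ} (d x : ℝ) :
    (d - hardThreshold (ENNReal.ofReal δ) x) ^ 2 ≤ 2 * (d - x) ^ 2 + 2 * δ ^ 2 := by
  unfold hardThreshold
  split_ifs with h
  · nlinarith [sq_nonneg (d - x), sq_nonneg δ]
  · rw [not_lt] at h
    by_cases hδ : 0 ≤ δ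
    · have h1 := (ENNReal.ofReal_le_ofReal_iff hδ).1 h
      have h2 : x ^ 2 ≤ δ ^ 2 := sq_le_sq' (by linarith [(abs_le.1 h1).1]) (abs_le.1 h1).2
      nlinarith [sq_nonneg (d - 2 * x)]
    · rw [ENNReal.ofReal_of_nonpos (not_le.1 hδ).le] at h
      have h1 : |x| ≤ 0 := by simpa using h
      have : x = 0 := abs_nonpos_iff.1 h1
      subst this
      nlinarith [sq_nonneg d, sq_nonneg δ]

theorem lintegral_sq_sub_hardThreshold_le {c δ : ℝ} (hc : 0 ≤ c) (hv : 0 ≤ v)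
    (hX : AEMeasurable X P) [IsProbabilityMeasure P]
    (hmom : ∫⁻ ω, ENNReal.ofReal ((X ω - μ) ^ (2 * 1)) ∂P ≤ ENNReal.ofReal (c * v ^ 1))
    (d : ℝ) :
    ∫⁻ ω, ENNReal.ofReal ((d - hardThreshold (ENNReal.ofReal δ) (X ω)) ^ 2) ∂P ≤
      ENNReal.ofReal (4 * c * v + 4 * (μ - d) ^ 2 + 2 * δ ^ 2) :=
  (lintegral_mono fun ω => ENNReal.ofReal_le_ofReal (sq_sub_hardThreshold_le d (X ω))).trans
    (lintegral_sq_sub_le_of_gaussian hc hv hX hmom d (by positivity))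

/-- When |μ| ≤ δ/2, passing the threshold forces |x - μ| ≥ δ/2, so the factor (4(x - μ)²/δ²)^p is at
least 1 and may be inserted. After integration this is Markov's inequality with as many moments as
needed. -/
theorem sq_sub_hardThreshold_le_of_small {δ : ℝ} (hδ : 0 < δ) (hμ : |μ| ≤ δ / 2) (p : ℕ)
    (d x : ℝ) :
    (d - hardThreshold (ENNReal.ofReal δ) x) ^ 2 ≤
      8 * (4 / δ ^ 2) ^ p * (x - μ) ^ (2 * (p + 1)) + 2 * d ^ 2 := by
  have hp : 0 ≤ (x - μ) ^ (2 * (p + 1)) := by rw [pow_mul]; positivity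
  unfold hardThreshold
  split_ifs with h
  · have h1 : δ < |x| := ENNReal.ofReal_lt_ofReal_iff'.1 h |>.1
    have h2 : |x| ≤ |x - μ| + |μ| := by
      calc |x| = |(x - μ) + μ| := by ring_nf
        _ ≤ _ := abs_add_le _ _
    have h3 : |x| ≤ 2 * |x - μ| := by linarith
    have h4 : δ ≤ 2 * |x - μ| := by linarith
    have h5 : x ^ 2 ≤ 4 * (x - μ) ^ 2 := by
      calc x ^ 2 = |x| ^ 2 := (sq_abs x).symm
        _ ≤ (2 * |x - μ|) ^ 2 := by gcongr
        _ = 4 * (x - μ) ^ 2 := by rw [mul_pow, sq_abs]; norm_num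
    have h6 : 1 ≤ 4 / δ ^ 2 * (x - μ) ^ 2 := by
      rw [div_mul_eq_mul_div, le_div_iff₀ (by positivity), one_mul]
      calc δ ^ 2 ≤ (2 * |x - μ|) ^ 2 := by gcongr
        _ = 4 * (x - μ) ^ 2 := by rw [mul_pow, sq_abs]; norm_num
    have h7 : 1 ≤ (4 / δ ^ 2 * (x - μ) ^ 2) ^ p := one_le_pow₀ h6
    have h8 : (x - μ) ^ 2 ≤ (4 / δ ^ 2) ^ p * (x - μ) ^ (2 * (p + 1)) := by
      calc (x - μ) ^ 2 = 1 * (x - μ) ^ 2 := (one_mul _).symm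
        _ ≤ (4 / δ ^ 2 * (x - μ) ^ 2) ^ p * (x - μ) ^ 2 := by gcongr
        _ = _ := by rw [mul_pow, ← pow_mul, mul_add, mul_one, pow_add]; ring
    nlinarith [sq_nonneg (d + x)]
  · have : 0 ≤ 8 * (4 / δ ^ 2) ^ p * (x - μ) ^ (2 * (p + 1)) := by positivity
    nlinarith [sq_nonneg d]

theorem lintegral_sq_sub_hardThreshold_le_of_small {c δ : ℝ} (hc : 0 ≤ c) (hv : 0 ≤ v)
    (hX : AEMeasurable X P) [IsProbabilityMeasure P] {p : ℕ}
    (hmom : ∫⁻ ω, ENNReal.ofReal ((X ω - μ) ^ (2 * (p + 1))) ∂P ≤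
      ENNReal.ofReal (c * v ^ (p + 1)))
    (hδ : 0 < δ) (hμ : |μ| ≤ δ / 2) (d : ℝ) :
    ∫⁻ ω, ENNReal.ofReal ((d - hardThreshold (ENNReal.ofReal δ) (X ω)) ^ 2) ∂P ≤
      ENNReal.ofReal (8 * (4 / δ ^ 2) ^ p * (c * v ^ (p + 1)) + 2 * d ^ 2) := by
  calc ∫⁻ ω, ENNReal.ofReal ((d - hardThreshold (ENNReal.ofReal δ) (X ω)) ^ 2) ∂P
      ≤ ∫⁻ ω, (ENNReal.ofReal (8 * (4 / δ ^ 2) ^ p) *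
          ENNReal.ofReal ((X ω - μ) ^ (2 * (p + 1))) + ENNReal.ofReal (2 * d ^ 2)) ∂P := by
        refine lintegral_mono fun ω => ?_
        have hp : 0 ≤ (X ω - μ) ^ (2 * (p + 1)) := by rw [pow_mul]; positivity
        rw [← ENNReal.ofReal_mul (by positivity), ← ENNReal.ofReal_add (by positivity)
          (by positivity)]
        exact ENNReal.ofReal_le_ofReal (sq_sub_hardThreshold_le_of_small hδ hμ p d (X ω))
    _ = ENNReal.ofReal (8 * (4 / δ ^ 2) ^ p) *
          ∫⁻ ω, ENNReal.ofReal ((X ω - μ) ^ (2 * (p + 1))) ∂P + ENNReal.ofReal (2 * d ^ 2) := by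
        rw [lintegral_add_right _ measurable_const, lintegral_const, measure_univ, mul_one,
          lintegral_const_mul'' _ (((hX.sub_const μ).pow_const _).ennreal_ofReal)]
    _ ≤ ENNReal.ofReal (8 * (4 / δ ^ 2) ^ p) * ENNReal.ofReal (c * v ^ (p + 1)) +
          ENNReal.ofReal (2 * d ^ 2) := by gcongr
    _ = _ := by
        rw [← ENNReal.ofReal_mul (by positivity), ← ENNReal.ofReal_add (by positivity)
          (by positivity)]

end GaussianVariable

/-! ### Law of linear combinations of the errors -/

section GaussianFamily

variable {Ω : Type*} [MeasurableSpace Ω] {P : Measure Ω}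
  {ξ : ℕ → Ω → ℝ} {γ : ℕ → ℝ} {Cγ α : ℝ}

theorem IsLongMemoryGaussian.integral_mul (hξ : IsLongMemoryGaussian P ξ γ Cγ α) (i l : ℕ) :
    ∫ ω, ξ i ω * ξ l ω ∂P = γ ((i : ℤ) - l).natAbs := by
  rcases le_total i l with h | h
  · have := hξ.covariance i (l - i)
    rw [Nat.add_sub_cancel' h] at this
    rw [this]
    congr 1
    omega
  · have := hξ.covariance l (i - l)
    rw [Nat.add_sub_cancel' h] at this
    simp_rw [mul_comm (ξ i _)]
    rw [this]
    congr 1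
    omega

/-- A linear combination of a Gaussian process is Gaussian, and expanding the square gives its
variance. The nonnegativity of the quadratic form is read off from this identity. -/
theorem IsLongMemoryGaussian.map_affine [IsProbabilityMeasure P] (hξ : IsLongMemoryGaussian P ξ γ Cγ α) (I : Finset ℕ)
    (w : ℕ → ℝ) (c : ℝ) :
    0 ≤ ∑ i ∈ I, ∑ l ∈ I, γ ((i : ℤ) - l).natAbs * (w i * w l) ∧
    AEMeasurable (fun ω => c + ∑ i ∈ I, w i * ξ i ω) P ∧
    P.map (fun ω => c + ∑ i ∈ I, w i * ξ i ω) =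
      gaussianReal c (∑ i ∈ I, ∑ l ∈ I, γ ((i : ℤ) - l).natAbs * (w i * w l)).toNNReal := by
  set X : Ω → ℝ := fun ω => ∑ i ∈ I, w i * ξ i ω with hX
  have hlaw : HasGaussianLaw X P := by
    have := (hξ.gaussian.smul w).hasGaussianLaw_fun_sum (I := I)
    simpa [hX] using this
  have hmeas := hlaw.aemeasurable
  have hL2 : ∀ i, MemLp (ξ i) 2 P := fun i => (hξ.gaussian.hasGaussianLaw_eval i).memLp_two
  have hmean : ∫ ω, X ω ∂P = 0 := by
    simp only [hX]
    rw [integral_finsetSum _ fun i _ => ((hL2 i).integrable one_le_two).const_mul _]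
    refine Finset.sum_eq_zero fun i _ => ?_
    rw [integral_const_mul, hξ.mean_zero, mul_zero]
  have hvar : Var[X; P] = ∑ i ∈ I, ∑ l ∈ I, γ ((i : ℤ) - l).natAbs * (w i * w l) := by
    rw [variance_of_integral_eq_zero hmeas hmean]
    have hsq : ∀ ω, (X ^ 2) ω = ∑ i ∈ I, ∑ l ∈ I, (ξ i ω * ξ l ω) * (w i * w l) := fun ω => by
      simp only [hX, Pi.pow_apply]
      rw [sq, Finset.sum_mul_sum]
      exact Finset.sum_congr rfl fun i _ => Finset.sum_congr rfl fun l _ => by ring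
    have hint : ∀ i l, Integrable (fun ω => (ξ i ω * ξ l ω) * (w i * w l)) P := fun i l =>
      ((hL2 i).integrable_mul (hL2 l)).mul_const _
    have : ∫ ω, X ω ^ 2 ∂P = ∫ ω, ∑ i ∈ I, ∑ l ∈ I, (ξ i ω * ξ l ω) * (w i * w l) ∂P :=
      integral_congr_ae (Eventually.of_forall hsq)
    rw [this, integral_finsetSum _ fun i _ => integrable_finsetSum _ fun l _ => hint i l]
    refine Finset.sum_congr rfl fun i _ => ?_
    rw [integral_finsetSum _ fun l _ => hint i l]
    refine Finset.sum_congr rfl fun l _ => ?_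
    rw [integral_mul_const, hξ.integral_mul]
  refine ⟨hvar ▸ variance_nonneg X P, aemeasurable_const.add hmeas, ?_⟩
  have h1 := hlaw.map_eq_gaussianReal
  rw [hvar, hmean] at h1
  have h2 := gaussianReal_map_const_add (μ := 0)
    (v := (∑ i ∈ I, ∑ l ∈ I, γ ((i : ℤ) - l).natAbs * (w i * w l)).toNNReal) c
  rw [← h1, AEMeasurable.map_map_of_aemeasurable (by fun_prop) hmeas, zero_add] at h2
  exact h2

end GaussianFamily

/-! ### Parseval's identity and coefficient risks -/

section HilbertBasis

variable {ι : Type*} {W : ι → ℝ → ℝ} {b : HilbertBasis ι ℝ (Lp ℝ 2 (volume : Measure ℝ))}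

theorem memLp_of_hilbertBasis (hb : ∀ i, (b i : ℝ → ℝ) =ᵐ[volume] W i) (i : ι) :
    MemLp (W i) 2 volume :=
  (memLp_congr_ae (hb i)).1 (Lp.memLp (b i))

theorem integral_mul_hilbertBasis [DecidableEq ι] (hb : ∀ i, (b i : ℝ → ℝ) =ᵐ[volume] W i)
    (i j : ι) : ∫ t, W i t * W j t = if i = j then 1 else 0 := by
  have h := orthonormal_iff_ite.1 b.orthonormal i j
  rw [L2.inner_def] at h
  rw [← h]
  refine integral_congr_ae ?_
  filter_upwards [hb i, hb j] with t hi hj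
  simp [hi, hj, mul_comm]

theorem hasSum_sq_integral_mul (hb : ∀ i, (b i : ℝ → ℝ) =ᵐ[volume] W i) {u : ℝ → ℝ}
    (hu : MemLp u 2 volume) :
    HasSum (fun i => (∫ t, W i t * u t) ^ 2) (∫ t, u t ^ 2) := by
  have h := b.hasSum_inner_mul_inner (hu.toLp u) (hu.toLp u)
  have hi : ∀ i, inner ℝ (b i) (hu.toLp u) = ∫ t, W i t * u t := fun i => by
    rw [L2.inner_def]
    refine integral_congr_ae ?_
    filter_upwards [hb i, hu.coeFn_toLp] with t h1 h2
    simp [h1, h2, mul_comm]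
  have hu2 : inner ℝ (hu.toLp u) (hu.toLp u) = ∫ t, u t ^ 2 := by
    rw [L2.inner_def]
    refine integral_congr_ae ?_
    filter_upwards [hu.coeFn_toLp] with t h2
    simp [h2, sq]
  rw [hu2] at h
  refine h.congr_fun fun i => ?_
  rw [real_inner_comm, hi, sq]

end HilbertBasis

/-- The wavelet coefficients of `g` restricted to `[0, 1]`. -/
noncomputable def trueCoeff (g : ℝ → ℝ) (f : ℝ → ℝ) : ℝ := ∫ t in Set.Icc (0 : ℝ) 1, g t * f t

/-- The coefficients of the estimator with respect to the wavelet system. -/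
noncomputable def estimatorCoeff (N : ℕ) (φ ψ : ℝ → ℝ) (n : ℕ) (Y : ℕ → ℝ) (J q : ℕ)
    (δ : ℕ → ℝ≥0∞) : ℤ ⊕ ℕ × ℤ → ℝ
  | Sum.inl k => if k ∈ Finset.Icc (-(N : ℤ) + 1) ((N : ℤ) * 2 ^ J - 1) then
      empiricalCoeff N n Y φ J k else 0
  | Sum.inr (j, k) => if j ∈ Finset.range (q + 1) ∧
      k ∈ Finset.Icc (-(N : ℤ) + 1) ((N : ℤ) * 2 ^ (J + j) - 1) then
      hardThreshold (δ j) (empiricalCoeff N n Y ψ (J + j) k) else 0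

section Estimator

variable {N : ℕ} {φ ψ : ℝ → ℝ} {n J q : ℕ} {Y : ℕ → ℝ} {δ : ℕ → ℝ≥0∞}
  {b : HilbertBasis (ℤ ⊕ ℕ × ℤ) ℝ (Lp ℝ 2 (volume : Measure ℝ))}

theorem memLp_estimator (hb : ∀ i, (b i : ℝ → ℝ) =ᵐ[volume] waveletSystem N φ ψ J i) :
    MemLp (estimator N φ ψ n Y J q δ) 2 volume := by
  have h1 : ∀ k, MemLp (scaled N φ J k) 2 volume := fun k =>
    memLp_of_hilbertBasis hb (Sum.inl k)
  have h2 : ∀ j k, MemLp (scaled N ψ (J + j) k) 2 volume := fun j k =>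
    memLp_of_hilbertBasis hb (Sum.inr (j, k))
  refine MemLp.add (memLp_finsetSum _ fun k _ => (h1 k).const_mul _)
    (memLp_finsetSum _ fun j _ => memLp_finsetSum _ fun k _ => (h2 j k).const_mul _)

theorem integral_mul_estimator (hb : ∀ i, (b i : ℝ → ℝ) =ᵐ[volume] waveletSystem N φ ψ J i)
    (i : ℤ ⊕ ℕ × ℤ) :
    ∫ t, waveletSystem N φ ψ J i t * estimator N φ ψ n Y J q δ t =
      estimatorCoeff N φ ψ n Y J q δ i := by
  classical
  have hL2 := memLp_of_hilbertBasis hb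
  have hint : ∀ (j : ℤ ⊕ ℕ × ℤ) (c : ℝ), Integrable (fun t =>
      c * (waveletSystem N φ ψ J i t * waveletSystem N φ ψ J j t)) := fun j c =>
    ((hL2 i).integrable_mul (hL2 j)).const_mul c
  have e : ∀ t, waveletSystem N φ ψ J i t * estimator N φ ψ n Y J q δ t =
      (∑ k ∈ Finset.Icc (-(N : ℤ) + 1) ((N : ℤ) * 2 ^ J - 1), empiricalCoeff N n Y φ J k *
        (waveletSystem N φ ψ J i t * waveletSystem N φ ψ J (Sum.inl k) t)) +
      ∑ j ∈ Finset.range (q + 1), ∑ k ∈ Finset.Icc (-(N : ℤ) + 1) ((N : ℤ) * 2 ^ (J + j) - 1),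
        hardThreshold (δ j) (empiricalCoeff N n Y ψ (J + j) k) *
        (waveletSystem N φ ψ J i t * waveletSystem N φ ψ J (Sum.inr (j, k)) t) := fun t => by
    rw [estimator, mul_add, Finset.mul_sum, Finset.mul_sum]
    congr 1
    · exact Finset.sum_congr rfl fun k _ => mul_left_comm _ _ _
    · refine Finset.sum_congr rfl fun j _ => ?_
      rw [Finset.mul_sum]
      exact Finset.sum_congr rfl fun k _ => mul_left_comm _ _ _
  simp_rw [e]
  rw [integral_add (integrable_finsetSum _ fun k _ => hint _ _)
    (integrable_finsetSum _ fun j _ => integrable_finsetSum _ fun k _ => hint _ _),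
    integral_finsetSum _ fun k _ => hint _ _,
    integral_finsetSum _ fun j _ => integrable_finsetSum _ fun k _ => hint _ _]
  simp_rw [integral_finsetSum _ fun k _ => hint _ _, integral_const_mul,
    integral_mul_hilbertBasis hb]
  rcases i with k | ⟨j, k⟩
  · simp [estimatorCoeff]
  · simp only [estimatorCoeff, reduceCtorEq, if_false, mul_zero, Finset.sum_const_zero, zero_add,
      Sum.inr.injEq, Prod.mk.injEq]
    rw [Finset.sum_congr rfl (g := fun j' => if j = j' then
      (if k ∈ Finset.Icc (-(N : ℤ) + 1) ((N : ℤ) * 2 ^ (J + j') - 1) then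
        hardThreshold (δ j') (empiricalCoeff N n Y ψ (J + j') k) else 0) else 0),
      Finset.sum_ite_eq, ite_and]
    intro j' _
    by_cases hj : j = j'
    · simp [hj]
    · simp [hj]

theorem memLp_indicator_of_continuousOn {g : ℝ → ℝ} (hg : ContinuousOn g (Set.Icc 0 1)) :
    MemLp ((Set.Icc (0 : ℝ) 1).indicator g) 2 volume := by
  rw [memLp_indicator_iff_restrict measurableSet_Icc]
  obtain ⟨B, hB⟩ := isCompact_Icc.exists_bound_of_continuousOn hg
  exact MemLp.of_bound (hg.aestronglyMeasurable measurableSet_Icc) B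
    ((ae_restrict_iff' measurableSet_Icc).2 (Eventually.of_forall hB))

theorem integral_mul_indicator (g f : ℝ → ℝ) :
    ∫ t, f t * (Set.Icc (0 : ℝ) 1).indicator g t = trueCoeff g f := by
  rw [trueCoeff, ← integral_indicator measurableSet_Icc]
  refine integral_congr_ae (Eventually.of_forall fun t => ?_)
  by_cases ht : t ∈ Set.Icc (0 : ℝ) 1
  · simp [ht, mul_comm]
  · simp [ht]

theorem integral_mul_sub_estimator {g : ℝ → ℝ} (hg : ContinuousOn g (Set.Icc 0 1))
    (hb : ∀ i, (b i : ℝ → ℝ) =ᵐ[volume] waveletSystem N φ ψ J i) (i : ℤ ⊕ ℕ × ℤ) :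
    ∫ t, waveletSystem N φ ψ J i t *
      ((Set.Icc (0 : ℝ) 1).indicator g t - estimator N φ ψ n Y J q δ t) =
      trueCoeff g (waveletSystem N φ ψ J i) - estimatorCoeff N φ ψ n Y J q δ i := by
  have hW := memLp_of_hilbertBasis hb i
  have h1 : Integrable fun t => waveletSystem N φ ψ J i t * (Set.Icc (0 : ℝ) 1).indicator g t :=
    hW.integrable_mul (memLp_indicator_of_continuousOn hg)
  have h2 : Integrable fun t => waveletSystem N φ ψ J i t * estimator N φ ψ n Y J q δ t :=
    hW.integrable_mul (memLp_estimator hb)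
  simp_rw [mul_sub]
  rw [integral_sub h1 h2, integral_mul_indicator, integral_mul_estimator hb]

/-- Extending g by 0 and integrating the squared error over the whole line can only increase it;
Parseval's identity then gives the sum over coefficients. -/
theorem lintegral_sq_sub_estimator_le {g : ℝ → ℝ} (hg : ContinuousOn g (Set.Icc 0 1))
    (hb : ∀ i, (b i : ℝ → ℝ) =ᵐ[volume] waveletSystem N φ ψ J i) :
    ∫⁻ t in Set.Icc (0 : ℝ) 1, ENNReal.ofReal ((g t - estimator N φ ψ n Y J q δ t) ^ 2) ≤
      ∑' i, ENNReal.ofReal ((trueCoeff g (waveletSystem N φ ψ J i) -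
        estimatorCoeff N φ ψ n Y J q δ i) ^ 2) := by
  set u : ℝ → ℝ := fun t => (Set.Icc (0 : ℝ) 1).indicator g t - estimator N φ ψ n Y J q δ t
    with hu
  have hL2 : MemLp u 2 volume := (memLp_indicator_of_continuousOn hg).sub (memLp_estimator hb)
  have hsum := hasSum_sq_integral_mul hb hL2
  simp only [hu, integral_mul_sub_estimator hg hb] at hsum
  rw [← ENNReal.ofReal_tsum_of_nonneg (fun i => sq_nonneg _) hsum.summable, hsum.tsum_eq,
    ofReal_integral_eq_lintegral_ofReal hL2.integrable_sq
      (Eventually.of_forall fun t => sq_nonneg _)]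
  calc ∫⁻ t in Set.Icc (0 : ℝ) 1, ENNReal.ofReal ((g t - estimator N φ ψ n Y J q δ t) ^ 2)
      = ∫⁻ t in Set.Icc (0 : ℝ) 1, ENNReal.ofReal (u t ^ 2) :=
        setLIntegral_congr_fun measurableSet_Icc fun t ht => by simp [hu, ht]
    _ ≤ _ := setLIntegral_le_lintegral _ _

/-- Here the error itself is cut off outside [0, 1]. Wavelets supported in [0, 1] do not notice the
cut, so their coefficients are unchanged and Bessel's inequality applies. -/
theorem sum_le_lintegral_sq_sub_estimator {g : ℝ → ℝ} (hg : ContinuousOn g (Set.Icc 0 1))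
    (hb : ∀ i, (b i : ℝ → ℝ) =ᵐ[volume] waveletSystem N φ ψ J i) (K : Finset (ℤ ⊕ ℕ × ℤ))
    (hK : ∀ i ∈ K, ∀ t, t ∉ Set.Icc (0 : ℝ) 1 → waveletSystem N φ ψ J i t = 0) :
    ∑ i ∈ K, ENNReal.ofReal ((trueCoeff g (waveletSystem N φ ψ J i) -
        estimatorCoeff N φ ψ n Y J q δ i) ^ 2) ≤
      ∫⁻ t in Set.Icc (0 : ℝ) 1, ENNReal.ofReal ((g t - estimator N φ ψ n Y J q δ t) ^ 2) := by
  set u : ℝ → ℝ := (Set.Icc (0 : ℝ) 1).indicator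
    (fun t => (Set.Icc (0 : ℝ) 1).indicator g t - estimator N φ ψ n Y J q δ t) with hu
  have hL2 : MemLp u 2 volume :=
    ((memLp_indicator_of_continuousOn hg).sub (memLp_estimator hb)).indicator measurableSet_Icc
  have hsum := hasSum_sq_integral_mul hb hL2
  have hle := sum_le_hasSum K (fun i _ => sq_nonneg _) hsum
  have hcoef : ∀ i ∈ K, ∫ t, waveletSystem N φ ψ J i t * u t =
      trueCoeff g (waveletSystem N φ ψ J i) - estimatorCoeff N φ ψ n Y J q δ i := by
    intro i hi
    rw [← integral_mul_sub_estimator hg hb]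
    refine integral_congr_ae (Eventually.of_forall fun t => ?_)
    by_cases ht : t ∈ Set.Icc (0 : ℝ) 1
    · simp [hu, ht]
    · simp [hK i hi t ht]
  have hval : ∫⁻ t in Set.Icc (0 : ℝ) 1,
      ENNReal.ofReal ((g t - estimator N φ ψ n Y J q δ t) ^ 2) =
      ENNReal.ofReal (∫ t, u t ^ 2) := by
    rw [ofReal_integral_eq_lintegral_ofReal hL2.integrable_sq
      (Eventually.of_forall fun t => sq_nonneg _), ← lintegral_indicator measurableSet_Icc]
    refine lintegral_congr fun t => ?_
    by_cases ht : t ∈ Set.Icc (0 : ℝ) 1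
    · simp [hu, ht]
    · simp [hu, ht]
  rw [hval, ← ENNReal.ofReal_sum_of_nonneg fun i _ => sq_nonneg _]
  refine ENNReal.ofReal_le_ofReal (le_trans (le_of_eq ?_) hle)
  exact Finset.sum_congr rfl fun i hi => by rw [hcoef i hi]

end Estimator

section Risk

variable {Ω : Type*} [MeasurableSpace Ω] {P : Measure Ω} {ξ : ℕ → Ω → ℝ}
  {N : ℕ} {φ ψ g : ℝ → ℝ} {n J q : ℕ} {δ : ℕ → ℝ≥0∞}
  {b : HilbertBasis (ℤ ⊕ ℕ × ℤ) ℝ (Lp ℝ 2 (volume : Measure ℝ))}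

theorem measurable_hardThreshold (δ : ℝ≥0∞) : Measurable (hardThreshold δ) := by
  unfold hardThreshold
  exact Measurable.ite (measurableSet_lt measurable_const
    (ENNReal.measurable_ofReal.comp measurable_norm)) measurable_id measurable_const

theorem aemeasurable_empiricalCoeff (hξ : ∀ i, AEMeasurable (ξ i) P) (f : ℝ → ℝ) (m : ℕ)
    (k : ℤ) : AEMeasurable (fun ω => empiricalCoeff N n (observation n g ξ ω) f m k) P := by
  unfold empiricalCoeff observation
  refine AEMeasurable.const_mul (Finset.aemeasurable_fun_sum _ fun i _ => ?_) _
  exact ((hξ i).const_add _).mul_const _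

theorem aemeasurable_estimatorCoeff (hξ : ∀ i, AEMeasurable (ξ i) P) (i : ℤ ⊕ ℕ × ℤ) :
    AEMeasurable (fun ω => estimatorCoeff N φ ψ n (observation n g ξ ω) J q δ i) P := by
  rcases i with k | ⟨j, k⟩
  · simp only [estimatorCoeff]
    split_ifs
    · exact aemeasurable_empiricalCoeff hξ _ _ _
    · exact aemeasurable_const
  · simp only [estimatorCoeff]
    split_ifs
    · exact (measurable_hardThreshold _).comp_aemeasurable (aemeasurable_empiricalCoeff hξ _ _ _)
    · exact aemeasurable_const

/-- The mean squared error of the coefficient with index `i`. -/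
noncomputable def coeffRisk (P : Measure Ω) (ξ : ℕ → Ω → ℝ) (g : ℝ → ℝ)
    (N : ℕ) (φ ψ : ℝ → ℝ) (n J q : ℕ) (δ : ℕ → ℝ≥0∞) (i : ℤ ⊕ ℕ × ℤ) : ℝ≥0∞ :=
  ∫⁻ ω, ENNReal.ofReal ((trueCoeff g (waveletSystem N φ ψ J i) -
        estimatorCoeff N φ ψ n (observation n g ξ ω) J q δ i) ^ 2) ∂P

theorem MISE_le_tsum_coeffRisk (hg : ContinuousOn g (Set.Icc 0 1))
    (hξ : ∀ i, AEMeasurable (ξ i) P)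
    (hb : ∀ i, (b i : ℝ → ℝ) =ᵐ[volume] waveletSystem N φ ψ J i) :
    MISE P ξ g N φ ψ n J q δ ≤ ∑' i, coeffRisk P ξ g N φ ψ n J q δ i := by
  unfold coeffRisk
  rw [← lintegral_tsum fun i =>
    (((aemeasurable_estimatorCoeff hξ i).const_sub _).pow_const 2).ennreal_ofReal]
  exact lintegral_mono fun ω => lintegral_sq_sub_estimator_le hg hb

theorem sum_coeffRisk_le_MISE (hg : ContinuousOn g (Set.Icc 0 1))
    (hξ : ∀ i, AEMeasurable (ξ i) P)
    (hb : ∀ i, (b i : ℝ → ℝ) =ᵐ[volume] waveletSystem N φ ψ J i) (K : Finset (ℤ ⊕ ℕ × ℤ))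
    (hK : ∀ i ∈ K, ∀ t, t ∉ Set.Icc (0 : ℝ) 1 → waveletSystem N φ ψ J i t = 0) :
    ∑ i ∈ K, coeffRisk P ξ g N φ ψ n J q δ i ≤ MISE P ξ g N φ ψ n J q δ := by
  unfold coeffRisk
  rw [← lintegral_finsetSum' _ fun i _ =>
    (((aemeasurable_estimatorCoeff hξ i).const_sub _).pow_const 2).ennreal_ofReal]
  exact lintegral_mono fun ω => sum_le_lintegral_sq_sub_estimator hg hb K hK

end Risk

/-! ### Mean and variance of the empirical coefficients -/

theorem scaled_eq (N : ℕ) (f : ℝ → ℝ) (m : ℕ) (k : ℤ) (t : ℝ) :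
    scaled N f m k t = √((N : ℝ) * 2 ^ m) * f ((N : ℝ) * 2 ^ m * t - k) := by
  rw [scaled, Real.sqrt_eq_rpow, Real.mul_rpow (by positivity) (by positivity),
    ← Real.rpow_natCast, ← Real.rpow_mul (by norm_num)]
  norm_num
  left
  left
  congr 1
  ring

theorem trueCoeff_scaled_eq {N : ℕ} (hN : 0 < N) (g f : ℝ → ℝ) (m : ℕ) (k : ℤ) :
    trueCoeff g (scaled N f m k) = (√((N : ℝ) * 2 ^ m))⁻¹ *
      ∫ x in (-(k : ℝ))..((N : ℝ) * 2 ^ m - k), g ((x + k) / ((N : ℝ) * 2 ^ m)) * f x := by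
  set M : ℝ := (N : ℝ) * 2 ^ m with hM
  have hM0 : 0 < M := by positivity
  have h1 := intervalIntegral.integral_comp_mul_sub (a := 0) (b := 1)
    (fun x => g ((x + k) / M) * f x) hM0.ne' (k : ℝ)
  rw [mul_zero, zero_sub, mul_one, smul_eq_mul] at h1
  rw [trueCoeff, integral_Icc_eq_integral_Ioc, ← intervalIntegral.integral_of_le zero_le_one]
  have h2 : ∫ t in (0 : ℝ)..1, g t * scaled N f m k t =
      √M * ∫ t in (0 : ℝ)..1, g ((M * t - k + k) / M) * f (M * t - k) := by
    rw [← intervalIntegral.integral_const_mul]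
    refine intervalIntegral.integral_congr fun t _ => ?_
    rw [scaled_eq, ← hM, sub_add_cancel, mul_div_cancel_left₀ _ hM0.ne']
    ring
  rw [h2, h1, ← mul_assoc]
  congr 1
  have := Real.sq_sqrt hM0.le
  have hs : √M ≠ 0 := (Real.sqrt_pos.2 hM0).ne'
  field_simp
  exact this

/-- The variance of the empirical coefficient of `f` at level `m` and position `k`. -/
noncomputable def coeffVariance (γ : ℕ → ℝ) (N n : ℕ) (f : ℝ → ℝ) (m : ℕ) (k : ℤ) : ℝ :=
  ((N : ℝ) * 2 ^ m)⁻¹ * gridForm γ f (-k) ((N : ℝ) * 2 ^ m / n) n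

/-- The mean of the empirical coefficient of `f` at level `m` and position `k`. -/
noncomputable def coeffMean (g : ℝ → ℝ) (N n : ℕ) (f : ℝ → ℝ) (m : ℕ) (k : ℤ) : ℝ :=
  (√((N : ℝ) * 2 ^ m))⁻¹ * ((N : ℝ) * 2 ^ m / n *
    ∑ i ∈ Finset.Icc 1 n, g ((i : ℝ) / n) * f (-k + (N : ℝ) * 2 ^ m / n * i))

section Law

variable {Ω : Type*} [MeasurableSpace Ω] {P : Measure Ω} [IsProbabilityMeasure P]
  {ξ : ℕ → Ω → ℝ} {γ : ℕ → ℝ} {Cγ α : ℝ}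

/-- In the variable x = M t - k the design points form the grid with origin -k and step M/n. The
normalisation √M / n equals M^(-1/2) times this step, which produces the factor M⁻¹ in front of
`gridForm`. -/
theorem IsLongMemoryGaussian.map_empiricalCoeff (hξ : IsLongMemoryGaussian P ξ γ Cγ α) {N : ℕ}
    (hN : 0 < N) (n : ℕ) (g f : ℝ → ℝ) (m : ℕ) (k : ℤ) :
    0 ≤ coeffVariance γ N n f m k ∧
    P.map (fun ω => empiricalCoeff N n (observation n g ξ ω) f m k) =
      gaussianReal (coeffMean g N n f m k) (coeffVariance γ N n f m k).toNNReal := by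
  set M : ℝ := (N : ℝ) * 2 ^ m with hM
  have hM0 : 0 < M := by positivity
  have hs : √M ≠ 0 := (Real.sqrt_pos.2 hM0).ne'
  have hss : √M * √M = M := Real.mul_self_sqrt hM0.le
  have hsinv : (√M)⁻¹ * M = √M := by
    rw [inv_mul_eq_div, div_eq_iff hs, hss]
  have harg : ∀ i : ℕ, M * ((i : ℝ) / n) - k = -k + M / n * i := fun i => by ring
  have hw := hξ.map_affine (Finset.Icc 1 n) (fun i => (√M)⁻¹ * (M / n) * f (-k + M / n * i))
    (coeffMean g N n f m k)
  have hvar : ∑ i ∈ Finset.Icc 1 n, ∑ l ∈ Finset.Icc 1 n, γ ((i : ℤ) - l).natAbs *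
      ((√M)⁻¹ * (M / n) * f (-k + M / n * i) * ((√M)⁻¹ * (M / n) * f (-k + M / n * l))) =
      coeffVariance γ N n f m k := by
    rw [coeffVariance, gridForm, ← hM, ← mul_assoc]
    have : M⁻¹ = (√M)⁻¹ * (√M)⁻¹ := by rw [← mul_inv, hss]
    rw [this]
    simp only [Finset.mul_sum]
    exact Finset.sum_congr rfl fun i _ => Finset.sum_congr rfl fun l _ => by ring
  have hX : (fun ω => empiricalCoeff N n (observation n g ξ ω) f m k) =
      fun ω => coeffMean g N n f m k +
        ∑ i ∈ Finset.Icc 1 n, (√M)⁻¹ * (M / n) * f (-k + M / n * i) * ξ i ω := by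
    funext ω
    rw [empiricalCoeff, coeffMean, ← hM]
    simp only [Finset.mul_sum, ← Finset.sum_add_distrib]
    refine Finset.sum_congr rfl fun i _ => ?_
    rw [observation, scaled_eq, ← hM, harg]
    rw [show ∀ y, (√M)⁻¹ * (M / n * y) = ((√M)⁻¹ * M) * ((n : ℝ)⁻¹ * y) from fun y => by ring,
      show (√M)⁻¹ * (M / n) = ((√M)⁻¹ * M) * (n : ℝ)⁻¹ by ring, hsinv]
    ring
  rw [hvar] at hw
  rw [hX]
  exact ⟨hw.1, hw.2.2⟩

end Law

theorem ContDiffOn.exists_bound_and_lipschitz {g : ℝ → ℝ} {r : ℕ} (hr : 1 ≤ r)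
    (hg : ContDiffOn ℝ r g (Set.Icc 0 1)) :
    ∃ A L : ℝ, 0 ≤ A ∧ 0 ≤ L ∧ (∀ x ∈ Set.Icc (0 : ℝ) 1, |g x| ≤ A) ∧
      ∀ x ∈ Set.Icc (0 : ℝ) 1, ∀ y ∈ Set.Icc (0 : ℝ) 1, |g y - g x| ≤ L * |y - x| := by
  have hr' : ((1 : ℕ) : WithTop ℕ∞) ≤ (r : WithTop ℕ∞) := by exact_mod_cast hr
  obtain ⟨A, hA⟩ := isCompact_Icc.exists_bound_of_continuousOn hg.continuousOn
  have hd : ContinuousOn (derivWithin g (Set.Icc 0 1)) (Set.Icc 0 1) :=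
    hg.continuousOn_derivWithin (uniqueDiffOn_Icc zero_lt_one) hr'
  obtain ⟨L, hL⟩ := isCompact_Icc.exists_bound_of_continuousOn hd
  have h0 : (0 : ℝ) ∈ Set.Icc (0 : ℝ) 1 := by simp
  refine ⟨A, L, (norm_nonneg _).trans (hA 0 h0), (norm_nonneg _).trans (hL 0 h0), hA,
    fun x hx y hy => ?_⟩
  exact (convex_Icc (0 : ℝ) 1).norm_image_sub_le_of_norm_derivWithin_le
    ((hg.of_le hr').differentiableOn (by simp)) hL hx hy

section Coefficients

variable {N : ℕ} {f : ℝ → ℝ} {S : Finset ℝ} {C B : ℝ}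

/-- The Riemann error √(M/n) times the normalisation M^(-1/2) is n^(-1/2), whatever the level.
Rescaling does not increase the Lipschitz constant of g because M ≥ 1. -/
theorem PiecewiseHolder.abs_coeffMean_sub_trueCoeff_le (hf : PiecewiseHolder N f S C B)
    (hN : 0 < N) {g : ℝ → ℝ} (hgc : ContinuousOn g (Set.Icc 0 1)) {A L : ℝ} (hA : 0 ≤ A)
    (hL : 0 ≤ L) (hgA : ∀ x ∈ Set.Icc (0 : ℝ) 1, |g x| ≤ A)
    (hgL : ∀ x ∈ Set.Icc (0 : ℝ) 1, ∀ y ∈ Set.Icc (0 : ℝ) 1, |g y - g x| ≤ L * |y - x|)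
    {n m : ℕ} (hn : 0 < n) (hmn : (N : ℝ) * 2 ^ m ≤ n) (k : ℤ) :
    |coeffMean g N n f m k - trueCoeff g (scaled N f m k)| ≤
      ((C + B) * (N + 2) + 4 * B * S.card) * (L + A) * (√n)⁻¹ := by
  have hn0 : (0 : ℝ) < n := by exact_mod_cast hn
  rw [trueCoeff_scaled_eq hN, coeffMean]
  set M : ℝ := (N : ℝ) * 2 ^ m with hM
  have hM0 : 0 < M := by positivity
  have hM1 : 1 ≤ M := by
    have h1 : (1 : ℝ) ≤ N := by exact_mod_cast hN
    have h2 : (1 : ℝ) ≤ 2 ^ m := one_le_pow₀ (by norm_num)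
    nlinarith
  have hend : -(k : ℝ) + M / n * n = M - k := by field_simp; ring
  have hmem : ∀ x ∈ Set.Icc (-(k : ℝ)) (-(k : ℝ) + M / n * n), (x + k) / M ∈ Set.Icc (0 : ℝ) 1 := by
    intro x hx
    rw [hend] at hx
    exact ⟨div_nonneg (by linarith [hx.1]) hM0.le,
      (div_le_one hM0).2 (by linarith [hx.2])⟩
  have key := hf.abs_riemann_sum_sub_integral_le (G := fun x => g ((x + k) / M)) (a := -(k : ℝ))
    (h := M / n) (by positivity) ((div_le_one hn0).2 hmn) n hL hA
    (hgc.comp (Continuous.continuousOn (by fun_prop)) hmem)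
    (fun x hx _ => hgA _ (hmem x hx)) (fun x hx y hy _ _ => by
      refine (hgL _ (hmem x hx) _ (hmem y hy)).trans (mul_le_mul_of_nonneg_left ?_ hL)
      rw [← sub_div, add_sub_add_right_eq_sub, abs_div, abs_of_pos hM0]
      exact div_le_self (abs_nonneg _) hM1)
  rw [hend] at key
  have hsum : ∀ i : ℕ, (-(k : ℝ) + M / n * i + k) / M = (i : ℝ) / n := fun i => by
    field_simp; ring
  simp only [hsum] at key
  rw [← mul_sub, abs_mul, abs_of_nonneg (by positivity)]
  calc (√M)⁻¹ * _ ≤ (√M)⁻¹ * (((C + B) * (N + 2) + 4 * B * S.card) * (L + A) * √(M / n)) :=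
        mul_le_mul_of_nonneg_left key (by positivity)
    _ = _ := by
        rw [Real.sqrt_div hM0.le]
        have hs : √M ≠ 0 := (Real.sqrt_pos.2 hM0).ne'
        field_simp

/-- This bound uses no cancellation. It is meant for wavelets overlapping an end of [0, 1], where
the vanishing moments are of no use. -/
theorem PiecewiseHolder.abs_trueCoeff_le (hf : PiecewiseHolder N f S C B)
    (hN : 0 < N) {g : ℝ → ℝ} {A : ℝ} (hA : 0 ≤ A)
    (hgA : ∀ x ∈ Set.Icc (0 : ℝ) 1, |g x| ≤ A) (m : ℕ) (k : ℤ) :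
    |trueCoeff g (scaled N f m k)| ≤ A * B * N * (√((N : ℝ) * 2 ^ m))⁻¹ := by
  rw [trueCoeff_scaled_eq hN]
  set M : ℝ := (N : ℝ) * 2 ^ m with hM
  have hM0 : 0 < M := by positivity
  have hB := hf.bound_nonneg
  have hle : -(k : ℝ) ≤ M - k := by linarith
  set E : ℝ → ℝ := (Set.Icc (0 : ℝ) N).indicator fun _ => A * B with hE
  have hEi : Integrable E :=
    (integrable_indicator_iff measurableSet_Icc).2 (integrableOn_const measure_Icc_lt_top.ne)
  have hE0 : ∀ x, 0 ≤ E x := fun x => Set.indicator_nonneg (fun _ _ => by positivity) x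
  have h1 := intervalIntegral.norm_integral_le_of_norm_le (μ := volume) hle
    (f := fun x => g ((x + k) / M) * f x) (g := E)
    (Eventually.of_forall fun x hx => by
      have hmem : (x + k) / M ∈ Set.Icc (0 : ℝ) 1 :=
        ⟨div_nonneg (by linarith [hx.1]) hM0.le, (div_le_one hM0).2 (by linarith [hx.2])⟩
      by_cases hxN : x ∈ Set.Icc (0 : ℝ) N
      · rw [hE, Set.indicator_of_mem hxN, Real.norm_eq_abs, abs_mul]
        exact mul_le_mul (hgA _ hmem) (hf.bound x) (abs_nonneg _) hA
      · rw [hf.eq_zero x hxN, mul_zero, norm_zero]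
        exact hE0 x) hEi.intervalIntegrable
  have h2 : ∫ x in (-(k : ℝ))..(M - k), E x ≤ A * B * N := by
    rw [intervalIntegral.integral_of_le hle]
    refine (setIntegral_le_integral hEi (Eventually.of_forall hE0)).trans (le_of_eq ?_)
    rw [hE, integral_indicator measurableSet_Icc, setIntegral_const, Measure.real,
      Real.volume_Icc, sub_zero, ENNReal.toReal_ofReal N.cast_nonneg, smul_eq_mul]
    ring
  rw [abs_mul, abs_of_nonneg (by positivity), mul_comm]
  exact mul_le_mul_of_nonneg_right (h1.trans h2) (by positivity)

theorem PiecewiseHolder.trueCoeff_eq_zero (hf : PiecewiseHolder N f S C B)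
    (hN : 0 < N) (g : ℝ → ℝ) (m : ℕ)
    {k : ℤ} (hk : k ∉ Finset.Icc (-(N : ℤ) + 1) ((N : ℤ) * 2 ^ m - 1)) :
    trueCoeff g (scaled N f m k) = 0 := by
  -- The open interval matters: for k = -N and k = N 2^m the closed support still touches [0, 1] at
  -- one end point.
  rw [trueCoeff, integral_Icc_eq_integral_Ioo]
  refine setIntegral_eq_zero_of_forall_eq_zero fun t ht => ?_
  rw [scaled_eq, hf.eq_zero, mul_zero, mul_zero]
  intro hmem
  rw [Finset.mem_Icc, not_and_or] at hk
  have e1 := hmem.1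
  have e2 := hmem.2
  have hM0 : (0 : ℝ) < (N : ℝ) * 2 ^ m := by positivity
  rcases hk with hk | hk
  · have hk' : k ≤ -(N : ℤ) := by omega
    have hk'' : (k : ℝ) ≤ -(N : ℝ) := by exact_mod_cast hk'
    nlinarith [ht.1]
  · have hk' : (N : ℤ) * 2 ^ m ≤ k := by omega
    have hk'' : (N : ℝ) * 2 ^ m ≤ k := by exact_mod_cast hk'
    nlinarith [ht.2]

end Coefficients

/-! ### Taylor expansion of the true wavelet coefficients -/

theorem iteratedDerivWithin_Icc_eq {g : ℝ → ℝ} {r j : ℕ} (hj : j ≤ r)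
    (hg : ContDiffOn ℝ r g (Set.Icc 0 1)) {x₀ x y : ℝ} (h0 : 0 ≤ x₀) (hx : x₀ < x) (h1 : x ≤ 1)
    (hy : y ∈ Set.Icc x₀ x) :
    iteratedDerivWithin j g (Set.Icc x₀ x) y = iteratedDerivWithin j g (Set.Icc 0 1) y := by
  rw [iteratedDerivWithin_eq_iteratedFDerivWithin, iteratedDerivWithin_eq_iteratedFDerivWithin,
    iteratedFDerivWithin_subset (Set.Icc_subset_Icc h0 h1) (uniqueDiffOn_Icc hx)
    (uniqueDiffOn_Icc zero_lt_one) (hg.of_le (by exact_mod_cast hj)) hy]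

/-- Lagrange's form of the remainder on [x₀, t], with derivatives within that interval identified
with derivatives within [0, 1]. The polynomial coefficients then do not depend on t. -/
theorem exists_taylor_coeff {g : ℝ → ℝ} {r : ℕ} (hr : 1 ≤ r)
    (hg : ContDiffOn ℝ r g (Set.Icc 0 1)) {x₀ : ℝ} (h0 : 0 ≤ x₀) :
    ∃ c : ℕ → ℝ, ∀ t ∈ Set.Icc x₀ 1, ∃ s ∈ Set.Icc x₀ t,
      g t = ∑ j ∈ Finset.range r, c j * (t - x₀) ^ j +
        iteratedDerivWithin r g (Set.Icc 0 1) s * (t - x₀) ^ r / r.factorial := by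
  obtain ⟨n, rfl⟩ : ∃ n, r = n + 1 := ⟨r - 1, by omega⟩
  refine ⟨fun j => (j.factorial : ℝ)⁻¹ * iteratedDerivWithin j g (Set.Icc 0 1) x₀,
    fun t ht => ?_⟩
  rcases eq_or_lt_of_le ht.1 with rfl | hlt
  · refine ⟨x₀, ⟨le_rfl, le_rfl⟩, ?_⟩
    rw [Finset.sum_range_succ']
    simp
  · have hcd : ContDiffOn ℝ ((n + 1 : ℕ) : WithTop ℕ∞) g (Set.Icc x₀ t) :=
      hg.mono (Set.Icc_subset_Icc h0 ht.2)
    have hdiff : DifferentiableOn ℝ (iteratedDerivWithin n g (Set.Icc x₀ t)) (Set.Icc x₀ t) :=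
      hcd.differentiableOn_iteratedDerivWithin (by exact_mod_cast n.lt_succ_self)
        (uniqueDiffOn_Icc hlt)
    have huI : Set.uIcc x₀ t = Set.Icc x₀ t := Set.uIcc_of_le ht.1
    obtain ⟨s, hs, he⟩ := taylor_mean_remainder_lagrange (f := g) (n := n) hlt.ne
      (by rw [huI]; exact hcd.of_le (by exact_mod_cast n.le_succ))
      (by rw [huI, Set.uIoo_of_le ht.1]; exact hdiff.mono Set.Ioo_subset_Icc_self)
    rw [Set.uIoo_of_le ht.1] at hs
    have hs' := Set.Ioo_subset_Icc_self hs
    refine ⟨s, hs', ?_⟩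
    rw [huI, iteratedDerivWithin_Icc_eq le_rfl hg h0 hlt ht.2 hs', taylor_within_apply] at he
    rw [sub_eq_iff_eq_add] at he
    rw [he, add_comm]
    congr 1
    refine Finset.sum_congr rfl fun j hj => ?_
    rw [iteratedDerivWithin_Icc_eq (Finset.mem_range.1 hj).le hg h0 hlt ht.2
      (Set.left_mem_Icc.2 ht.1), smul_eq_mul]
    ring

/-- Expand g at t₀ = k/M, the left end of the wavelet's support. The moments of order below r remove
the lower terms, the term of order r gives the main part, and the remainder is governed by the
oscillation η of g^(r) over the support. A small η yields the lower bound for d², a crude η the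
upper bound. -/
theorem PiecewiseHolder.abs_trueCoeff_sub_le {N : ℕ} {ψ : ℝ → ℝ} {S : Finset ℝ} {C B : ℝ}
    (hψ : PiecewiseHolder N ψ S C B) (hN : 0 < N) {r : ℕ} (hr : 1 ≤ r)
    (hmom : ∀ k < r, ∫ t in (0 : ℝ)..N, t ^ k * ψ t = 0) {g : ℝ → ℝ}
    (hg : ContDiffOn ℝ r g (Set.Icc 0 1)) {m : ℕ} {k : ℤ} (hk0 : 0 ≤ k)
    (hkN : (k : ℝ) + N ≤ (N : ℝ) * 2 ^ m) {η : ℝ}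
    (hη : ∀ s ∈ Set.Icc (0 : ℝ) 1, s ∈ Set.Icc ((k : ℝ) / ((N : ℝ) * 2 ^ m))
      ((k : ℝ) / ((N : ℝ) * 2 ^ m) + N / ((N : ℝ) * 2 ^ m)) →
      |iteratedDerivWithin r g (Set.Icc 0 1) s -
        iteratedDerivWithin r g (Set.Icc 0 1) (k / ((N : ℝ) * 2 ^ m))| ≤ η) :
    |trueCoeff g (scaled N ψ m k) * √((N : ℝ) * 2 ^ m) * ((N : ℝ) * 2 ^ m) ^ r -
      iteratedDerivWithin r g (Set.Icc 0 1) (k / ((N : ℝ) * 2 ^ m)) / r.factorial *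
        ∫ t in (0 : ℝ)..N, t ^ r * ψ t| ≤ η * (N : ℝ) ^ (r + 1) * B / r.factorial := by
  rw [trueCoeff_scaled_eq hN]
  set M : ℝ := (N : ℝ) * 2 ^ m with hM
  have hM0 : 0 < M := by positivity
  have hN0 : (0 : ℝ) < N := by exact_mod_cast hN
  have hk0' : (0 : ℝ) ≤ k := by exact_mod_cast hk0
  have hs : √M ≠ 0 := (Real.sqrt_pos.2 hM0).ne'
  set D := iteratedDerivWithin r g (Set.Icc 0 1) with hD
  set t₀ : ℝ := k / M with ht₀
  have ht₀0 : 0 ≤ t₀ := by positivity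
  obtain ⟨c, hc⟩ := exists_taylor_coeff hr hg ht₀0
  rw [hψ.integral_mul_eq (G := fun x => g ((x + k) / M)) (by linarith) (by linarith)]
  set ρ : ℝ → ℝ := fun x => g ((x + k) / M) - ∑ j ∈ Finset.range r, c j / M ^ j * x ^ j -
    D t₀ / (r.factorial * M ^ r) * x ^ r with hρ
  have hmem : ∀ x ∈ Set.Icc (0 : ℝ) N, (x + k) / M ∈ Set.Icc t₀ 1 := fun x hx =>
    ⟨div_le_div_of_nonneg_right (by linarith [hx.1]) hM0.le,
      (div_le_one hM0).2 (by linarith [hx.2])⟩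
  have hgc : ContinuousOn (fun x => g ((x + k) / M)) (Set.Icc (0 : ℝ) N) :=
    hg.continuousOn.comp (Continuous.continuousOn (by fun_prop)) fun x hx =>
      ⟨ht₀0.trans (hmem x hx).1, (hmem x hx).2⟩
  have hρc : ContinuousOn ρ (Set.Icc (0 : ℝ) N) :=
    (hgc.sub (Continuous.continuousOn (by fun_prop))).sub (Continuous.continuousOn (by fun_prop))
  have hρb : ∀ x ∈ Set.Icc (0 : ℝ) N, |ρ x| ≤ η * (N / M) ^ r / r.factorial := by
    intro x hx
    obtain ⟨s, hs, he⟩ := hc _ (hmem x hx)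
    have hsub : (x + k) / M - t₀ = x / M := by rw [ht₀]; ring
    rw [hsub] at he
    have hρx : ρ x = (D s - D t₀) * (x / M) ^ r / r.factorial := by
      simp only [hρ]
      rw [he, Finset.sum_congr rfl fun j _ => show c j * (x / M) ^ j = c j / M ^ j * x ^ j by
        rw [div_pow]; ring]
      rw [div_pow]
      have : (r.factorial : ℝ) ≠ 0 := by positivity
      field_simp
      ring
    have hsx : s ≤ t₀ + N / M := by
      have : (x + k) / M = t₀ + x / M := by rw [ht₀]; ring
      refine hs.2.trans (this.le.trans ?_)
      have := div_le_div_of_nonneg_right hx.2 hM0.le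
      linarith
    have hb := hη s ⟨ht₀0.trans hs.1, hs.2.trans (hmem x hx).2⟩ ⟨hs.1, hsx⟩
    have hx0 := hx.1
    rw [hρx, abs_div, abs_mul, abs_of_nonneg (by positivity : 0 ≤ (x / M) ^ r),
      abs_of_nonneg (by positivity : (0 : ℝ) ≤ r.factorial)]
    have hη0 : 0 ≤ η := (abs_nonneg _).trans hb
    gcongr
    exact hx.2
  have hη0 : 0 ≤ η := by
    have := hρb 0 ⟨le_rfl, hN0.le⟩
    have h2 : 0 ≤ η * ((N / M) ^ r / r.factorial) := by
      rw [← mul_div_assoc]; exact (abs_nonneg _).trans this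
    exact nonneg_of_mul_nonneg_left h2 (by positivity)
  have hpow : ∀ j : ℕ, IntervalIntegrable (fun x : ℝ => x ^ j * ψ x) volume 0 N := fun j =>
    hψ.intervalIntegrable_mul hN0.le (Continuous.continuousOn (by fun_prop))
  have hρi : IntervalIntegrable (fun x : ℝ => ρ x * ψ x) volume 0 N :=
    hψ.intervalIntegrable_mul hN0.le hρc
  have hsplit : ∫ x in (0 : ℝ)..N, g ((x + k) / M) * ψ x =
      D t₀ / (r.factorial * M ^ r) * (∫ t in (0 : ℝ)..N, t ^ r * ψ t) +
        ∫ x in (0 : ℝ)..N, ρ x * ψ x := by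
    have e : ∀ x, g ((x + k) / M) * ψ x = (∑ j ∈ Finset.range r, c j / M ^ j * (x ^ j * ψ x) +
        D t₀ / (r.factorial * M ^ r) * (x ^ r * ψ x)) + ρ x * ψ x := by
      intro x
      have : ∑ j ∈ Finset.range r, c j / M ^ j * (x ^ j * ψ x) =
          (∑ j ∈ Finset.range r, c j / M ^ j * x ^ j) * ψ x := by
        rw [Finset.sum_mul]
        exact Finset.sum_congr rfl fun j _ => by ring
      rw [this]
      simp only [hρ]
      ring
    have hsi : IntervalIntegrable (fun x => ∑ j ∈ Finset.range r, c j / M ^ j * (x ^ j * ψ x))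
        volume 0 N := intervalIntegrable_finsetSum fun j _ => (hpow j).const_mul _
    have hri := (hpow r).const_mul (D t₀ / (r.factorial * M ^ r))
    simp_rw [e]
    rw [intervalIntegral.integral_add (hsi.add hri) hρi, intervalIntegral.integral_add hsi hri,
      intervalIntegral.integral_finsetSum fun j _ => (hpow j).const_mul _]
    simp_rw [intervalIntegral.integral_const_mul]
    rw [Finset.sum_eq_zero fun j hj => by rw [hmom j (Finset.mem_range.1 hj), mul_zero], zero_add]
  have hρint : |∫ x in (0 : ℝ)..N, ρ x * ψ x| ≤ η * (N / M) ^ r / r.factorial * B * N := by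
    have := intervalIntegral.norm_integral_le_of_norm_le_const (a := (0 : ℝ)) (b := N)
      (f := fun x => ρ x * ψ x) (C := η * (N / M) ^ r / r.factorial * B) (fun x hx => by
        rw [Set.uIoc_of_le hN0.le] at hx
        rw [Real.norm_eq_abs, abs_mul]
        exact mul_le_mul (hρb x ⟨hx.1.le, hx.2⟩) (hψ.bound x) (abs_nonneg _) (by positivity))
    rwa [sub_zero, abs_of_pos hN0] at this
  have hfac : (r.factorial : ℝ) ≠ 0 := by positivity
  have e2 : (√M)⁻¹ * (∫ x in (0 : ℝ)..N, g ((x + k) / M) * ψ x) * √M * M ^ r -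
      D t₀ / r.factorial * (∫ t in (0 : ℝ)..N, t ^ r * ψ t) =
      M ^ r * ∫ x in (0 : ℝ)..N, ρ x * ψ x := by
    rw [hsplit]
    field_simp
    ring
  rw [e2, abs_mul, abs_of_pos (by positivity)]
  calc M ^ r * |∫ x in (0 : ℝ)..N, ρ x * ψ x|
      ≤ M ^ r * (η * (N / M) ^ r / r.factorial * B * N) := by gcongr
    _ = η * (N : ℝ) ^ (r + 1) * B / r.factorial := by
        rw [div_pow]
        field_simp
        ring

theorem PiecewiseHolder.scaled_eq_zero {N : ℕ} {f : ℝ → ℝ} {S : Finset ℝ} {C B : ℝ}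
    (hf : PiecewiseHolder N f S C B) (hN : 0 < N) {m : ℕ} {k : ℤ} (hk0 : 0 ≤ k)
    (hkN : (k : ℝ) + N ≤ (N : ℝ) * 2 ^ m) {t : ℝ} (ht : t ∉ Set.Icc (0 : ℝ) 1) :
    scaled N f m k t = 0 := by
  rw [scaled_eq, hf.eq_zero, mul_zero]
  intro hmem
  have hM0 : (0 : ℝ) < (N : ℝ) * 2 ^ m := by positivity
  have hk0' : (0 : ℝ) ≤ k := by exact_mod_cast hk0
  have e1 := hmem.1
  have e2 := hmem.2
  refine ht ⟨?_, ?_⟩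
  · by_contra hlt
    nlinarith [not_le.1 hlt]
  · by_contra hlt
    nlinarith [not_le.1 hlt]

/-! ### The lower bound -/

theorem PiecewiseHolder.exists_le_coeffVariance {N : ℕ} {f : ℝ → ℝ} {S : Finset ℝ} {C B : ℝ}
    {γ : ℕ → ℝ} {Cγ α : ℝ} (hf : PiecewiseHolder N f S C B) (hN : 0 < N) (p : ℕ)
    (hmom : ∫ x in (0 : ℝ)..N, x ^ p * f x ≠ 0) (h0 : 0 < α) (h1 : α < 1) (hCγ : 0 < Cγ)
    (hdecay : Asymptotics.IsEquivalent atTop γ (fun k : ℕ => Cγ * (k : ℝ) ^ (-α))) :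
    ∃ h₁ > 0, ∃ c > 0, ∀ (n m : ℕ) (k : ℤ), 0 < n → (N : ℝ) * 2 ^ m / n ≤ h₁ → 0 ≤ k →
      (k : ℝ) + N ≤ (N : ℝ) * 2 ^ m →
      c * ((N : ℝ) * 2 ^ m)⁻¹ * ((2 : ℝ) ^ m / n) ^ α ≤ coeffVariance γ N n f m k := by
  obtain ⟨h₁, hh₁, c, hc, hle, key⟩ := hf.exists_le_gridForm p hmom h0 h1 hCγ hdecay
  refine ⟨h₁, hh₁, c, hc, fun n m k hn hnm hk0 hkN => ?_⟩
  have hn0 : (0 : ℝ) < n := by exact_mod_cast hn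
  have hN1 : (1 : ℝ) ≤ N := by exact_mod_cast hN
  have hk0' : (0 : ℝ) ≤ k := by exact_mod_cast hk0
  rw [coeffVariance]
  have := key ((N : ℝ) * 2 ^ m / n) (-k) n (by positivity) hnm (by linarith) (by
    rw [div_mul_cancel₀ _ hn0.ne']; linarith)
  have h2 : ((2 : ℝ) ^ m / n) ^ α ≤ ((N : ℝ) * 2 ^ m / n) ^ α := by
    refine Real.rpow_le_rpow (by positivity) ?_ h0.le
    gcongr
    exact le_mul_of_one_le_left (by positivity) hN1
  calc c * ((N : ℝ) * 2 ^ m)⁻¹ * ((2 : ℝ) ^ m / n) ^ α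
      = ((N : ℝ) * 2 ^ m)⁻¹ * (c * ((2 : ℝ) ^ m / n) ^ α) := by ring
    _ ≤ ((N : ℝ) * 2 ^ m)⁻¹ * (c * ((N : ℝ) * 2 ^ m / n) ^ α) := by gcongr
    _ ≤ _ := by gcongr

theorem interior_mem_Icc {N m : ℕ} (hN : 0 < N) {k : ℤ} (hk0 : 0 ≤ k)
    (hkN : (k : ℝ) + N ≤ (N : ℝ) * 2 ^ m) :
    k ∈ Finset.Icc (-(N : ℤ) + 1) ((N : ℤ) * 2 ^ m - 1) := by
  have : k + N ≤ (N : ℤ) * 2 ^ m := by exact_mod_cast hkN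
  rw [Finset.mem_Icc]
  constructor <;> omega

section Lower

variable {Ω : Type*} [MeasurableSpace Ω] {P : Measure Ω} [IsProbabilityMeasure P]
  {N : ℕ} {φ ψ g : ℝ → ℝ} {ξ : ℕ → Ω → ℝ} {γ : ℕ → ℝ} {Cγ α : ℝ}

/-- The φ coefficients are never thresholded, so each pays a multiple of its variance, which is
bounded below through ∫ φ = 1, the moment of order 0. At least 2^J of the functions lie inside [0,
1]. -/
theorem exists_le_MISE_of_father (hwav : IsWaveletPair N φ ψ) (hN : 0 < N)
    (hφ : WaveletRegular N φ) (h0 : 0 < α) (h1 : α < 1) (hCγ : 0 < Cγ)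
    (hξ : IsLongMemoryGaussian P ξ γ Cγ α) (hg : ContinuousOn g (Set.Icc 0 1)) :
    ∃ h₁ > 0, ∃ c > 0, ∀ (n J : ℕ), 0 < n → (N : ℝ) * 2 ^ J / n ≤ h₁ →
      ∀ (q : ℕ) (δ : ℕ → ℝ≥0∞), ENNReal.ofReal (c * ((2 : ℝ) ^ J / n) ^ α) ≤
        MISE P ξ g N φ ψ n J q δ := by
  obtain ⟨S, C, B, hf⟩ := hφ.piecewiseHolder hwav.support_father
  obtain ⟨h₁, hh₁, c, hc, key⟩ := hf.exists_le_coeffVariance hN 0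
    (by simp [hwav.integral_father]) h0 h1 hCγ hξ.decay
  have hN1 : (1 : ℝ) ≤ N := by exact_mod_cast hN
  refine ⟨h₁, hh₁, c / 8 / N, by positivity, fun n J hn hnJ q δ => ?_⟩
  have hn0 : (0 : ℝ) < n := by exact_mod_cast hn
  obtain ⟨b, hb⟩ := hwav.orthonormal_basis J
  set M : ℝ := (N : ℝ) * 2 ^ J with hM
  set v₀ : ℝ := c * M⁻¹ * ((2 : ℝ) ^ J / n) ^ α with hv₀
  have hM0 : 0 < M := by positivity
  have hv₀0 : 0 < v₀ := by positivity
  set K : Finset ℤ := Finset.Icc 0 ((N : ℤ) * 2 ^ J - N) with hK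
  have hKm : ∀ k ∈ K, 0 ≤ k ∧ (k : ℝ) + N ≤ M := fun k hk => by
    have := Finset.mem_Icc.1 hk
    refine ⟨this.1, ?_⟩
    have h2 : k + N ≤ (N : ℤ) * 2 ^ J := by omega
    rw [hM]
    exact_mod_cast h2
  have hrisk : ∀ k ∈ K, ENNReal.ofReal (v₀ / 4 / 2) ≤
      coeffRisk P ξ g N φ ψ n J q δ (Sum.inl k) := by
    intro k hk
    obtain ⟨hk0, hkN⟩ := hKm k hk
    have hv := key n J k hn hnJ hk0 hkN
    have hX := aemeasurable_empiricalCoeff (g := g) (N := N) (n := n)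
      (fun i => hξ.gaussian.aemeasurable i) φ J k
    have hlaw := (hξ.map_empiricalCoeff hN n g φ J k).2
    refine ofReal_half_le_lintegral_of_gaussian hX hlaw (hv₀0.trans_le hv)
      (d := trueCoeff g (scaled N φ J k)) fun ω hω => ?_
    simp only [estimatorCoeff, if_pos (interior_mem_Icc hN hk0 hkN), waveletSystem]
    calc v₀ / 4 ≤ coeffVariance γ N n φ J k / 4 := by linarith
      _ ≤ _ := hω
      _ = _ := by ring
  have hcard : (2 : ℝ) ^ J ≤ K.card := by
    rw [hK, Int.card_Icc]
    have h2 : (1 : ℤ) ≤ 2 ^ J := one_le_pow₀ (by norm_num)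
    have hN1' : (1 : ℤ) ≤ N := by exact_mod_cast hN
    have h3 : (2 : ℤ) ^ J ≤ (N : ℤ) * 2 ^ J - N + 1 - 0 := by nlinarith
    have h4 : (2 : ℤ) ^ J ≤ (((N : ℤ) * 2 ^ J - N + 1 - 0).toNat : ℤ) :=
      h3.trans (Int.self_le_toNat _)
    exact_mod_cast h4
  have hmise := sum_coeffRisk_le_MISE (P := P) (ξ := ξ) (n := n) (q := q) (δ := δ) hg
    (fun i => hξ.gaussian.aemeasurable i) hb (K.map ⟨Sum.inl, Sum.inl_injective⟩) (by
      intro i hi t ht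
      obtain ⟨k, hk, rfl⟩ := Finset.mem_map.1 hi
      exact hf.scaled_eq_zero hN (hKm k hk).1 (hKm k hk).2 ht)
  rw [Finset.sum_map] at hmise
  refine le_trans ?_ hmise
  calc ENNReal.ofReal (c / 8 / N * ((2 : ℝ) ^ J / n) ^ α)
      = ENNReal.ofReal (2 ^ J * (v₀ / 4 / 2)) := by
        congr 1
        rw [hv₀, hM]
        have : (2 : ℝ) ^ J ≠ 0 := by positivity
        field_simp
        norm_num
    _ ≤ ENNReal.ofReal (K.card * (v₀ / 4 / 2)) := by
        refine ENNReal.ofReal_le_ofReal ?_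
        gcongr
    _ = K.card • ENNReal.ofReal (v₀ / 4 / 2) := by
        rw [ENNReal.ofReal_mul (by positivity), ENNReal.ofReal_natCast, nsmul_eq_mul]
    _ = ∑ k ∈ K, ENNReal.ofReal (v₀ / 4 / 2) := (Finset.sum_const _).symm
    _ ≤ _ := Finset.sum_le_sum hrisk

/-- The two end points form a null set, so g^(r) is nonzero at some interior point; continuity
spreads this to an interval. -/
theorem exists_Icc_le_abs_iteratedDerivWithin {r : ℕ}
    (hg : ContDiffOn ℝ r g (Set.Icc 0 1))
    (hsupp : 0 < volume {t ∈ Set.Icc (0 : ℝ) 1 | iteratedDerivWithin r g (Set.Icc 0 1) t ≠ 0}) :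
    ∃ a b η : ℝ, 0 < a ∧ a < b ∧ b < 1 ∧ 0 < η ∧ ∀ t ∈ Set.Icc a b,
      η ≤ |iteratedDerivWithin r g (Set.Icc 0 1) t| := by
  set D := iteratedDerivWithin r g (Set.Icc 0 1) with hD
  have hDc : ContinuousOn D (Set.Icc 0 1) :=
    hg.continuousOn_iteratedDerivWithin le_rfl (uniqueDiffOn_Icc zero_lt_one)
  obtain ⟨t₀, ht₀, hne⟩ : ∃ t₀ ∈ Set.Ioo (0 : ℝ) 1, D t₀ ≠ 0 := by
    by_contra! hcon
    refine hsupp.ne' (measure_mono_null (t := {0, 1}) (fun t ht => ?_)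
      (Set.Finite.measure_zero (by simp) _))
    by_contra hnot
    simp only [Set.mem_insert_iff, Set.mem_singleton_iff, not_or] at hnot
    exact ht.2 (hcon t ⟨lt_of_le_of_ne ht.1.1 (Ne.symm hnot.1), lt_of_le_of_ne ht.1.2 hnot.2⟩)
  have hcat : ContinuousAt (fun t => |D t|) t₀ :=
    (hDc.continuousAt (Icc_mem_nhds ht₀.1 ht₀.2)).abs
  have hev : ∀ᶠ t in 𝓝 t₀, |D t₀| / 2 < |D t| ∧ t ∈ Set.Ioo (0 : ℝ) 1 :=
    (hcat.eventually_const_lt (by linarith [abs_pos.2 hne] : |D t₀| / 2 < |D t₀|)).and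
      (Ioo_mem_nhds ht₀.1 ht₀.2)
  obtain ⟨ε, hε, hball⟩ := Metric.eventually_nhds_iff.1 hev
  have hin : ∀ t, t ∈ Set.Icc (t₀ - ε / 2) (t₀ + ε / 2) → |D t₀| / 2 < |D t| ∧
      t ∈ Set.Ioo (0 : ℝ) 1 := fun t ht => hball (by
    rw [Real.dist_eq, abs_lt]
    constructor <;> linarith [ht.1, ht.2])
  exact ⟨t₀ - ε / 2, t₀ + ε / 2, |D t₀| / 2,
    (hin _ ⟨le_rfl, by linarith⟩).2.1, by linarith, (hin _ ⟨by linarith, le_rfl⟩).2.2,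
    by linarith [abs_pos.2 hne], fun t ht => (hin t ht).1.le⟩

theorem exists_le_sq_trueCoeff {S : Finset ℝ} {C B : ℝ} (hψ : PiecewiseHolder N ψ S C B)
    (hN : 0 < N) {r : ℕ} (hr : 1 ≤ r) (hmom : HasVanishingMoments N ψ r)
    (hg : ContDiffOn ℝ r g (Set.Icc 0 1)) {a b η : ℝ} (ha : 0 < a) (hb : b < 1) (hη : 0 < η)
    (hD : ∀ t ∈ Set.Icc a b, η ≤ |iteratedDerivWithin r g (Set.Icc 0 1) t|) :
    ∃ M₀ c : ℝ, 0 < c ∧ ∀ (m : ℕ) (k : ℤ), M₀ ≤ (N : ℝ) * 2 ^ m → a * ((N : ℝ) * 2 ^ m) ≤ k →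
      k ≤ b * ((N : ℝ) * 2 ^ m) → 0 ≤ k ∧ (k : ℝ) + N ≤ (N : ℝ) * 2 ^ m ∧
      c * ((N : ℝ) * 2 ^ m)⁻¹ * (((N : ℝ) * 2 ^ m) ^ (2 * r))⁻¹ ≤
        trueCoeff g (scaled N ψ m k) ^ 2 := by
  set D := iteratedDerivWithin r g (Set.Icc 0 1) with hDdef
  have hDc : ContinuousOn D (Set.Icc 0 1) :=
    hg.continuousOn_iteratedDerivWithin le_rfl (uniqueDiffOn_Icc zero_lt_one)
  have huc := isCompact_Icc.uniformContinuousOn_of_continuous hDc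
  rw [Metric.uniformContinuousOn_iff] at huc
  set ν := ∫ t in (0 : ℝ)..N, t ^ r * ψ t with hν
  have hν0 : 0 < |ν| := abs_pos.2 hmom.2
  have hB := hψ.bound_nonneg
  have hN0 : (0 : ℝ) < N := by exact_mod_cast hN
  have hfac : (0 : ℝ) < r.factorial := by positivity
  -- This tolerance makes the Taylor error at most half of the main term, whose size is at least η
  -- |ν| / r!.
  obtain ⟨ε, hε, hmod⟩ := huc (η * |ν| / (2 * ((N : ℝ) ^ (r + 1) * B + 1))) (by positivity)
  -- The first lower bound on M keeps the supports inside [0, 1]; the second makes them shorter than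
  -- the modulus of continuity ε.
  refine ⟨max (N / (1 - b)) (2 * N / ε), (η * |ν| / (2 * r.factorial)) ^ 2, by positivity,
    fun m k hm hak hkb => ?_⟩
  have hM0 : (0 : ℝ) < (N : ℝ) * 2 ^ m := by positivity
  have hk0' : (0 : ℝ) ≤ k := le_trans (by positivity) hak
  have hk0 : 0 ≤ k := by exact_mod_cast hk0'
  have hkN : (k : ℝ) + N ≤ (N : ℝ) * 2 ^ m := by
    have := (le_max_left _ _).trans hm
    rw [div_le_iff₀ (by linarith)] at this
    linarith
  refine ⟨hk0, hkN, ?_⟩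
  have hNM : 2 * (N : ℝ) / ((N : ℝ) * 2 ^ m) ≤ ε := by
    have := (le_max_right _ _).trans hm
    rw [div_le_iff₀ hε] at this
    rw [div_le_iff₀ hM0]
    linarith
  have key := hψ.abs_trueCoeff_sub_le hN hr hmom.1 hg hk0 hkN
    (η := η * |ν| / (2 * ((N : ℝ) ^ (r + 1) * B + 1))) (by
      intro s hs hs'
      refine (hmod s hs _ ⟨by positivity, ?_⟩ ?_).le
      · rw [div_le_one hM0]; linarith
      · have hpos : 0 < (N : ℝ) / ((N : ℝ) * 2 ^ m) := by positivity
        rw [mul_div_assoc] at hNM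
        rw [Real.dist_eq, abs_lt]
        constructor <;> linarith [hs'.1, hs'.2])
  rw [← hDdef, ← hν] at key
  set M : ℝ := (N : ℝ) * 2 ^ m with hM
  have hDk := hD (k / M) ⟨(le_div_iff₀ hM0).2 hak, (div_le_iff₀ hM0).2 hkb⟩
  set d := trueCoeff g (scaled N ψ m k) with hd
  have h1 : η * |ν| / r.factorial ≤ |D (k / M) / r.factorial * ν| := by
    rw [abs_mul, abs_div, abs_of_pos hfac]
    calc η * |ν| / r.factorial = η / r.factorial * |ν| := by ring
      _ ≤ _ := by gcongr
  have h2 : η * |ν| / (2 * ((N : ℝ) ^ (r + 1) * B + 1)) * (N : ℝ) ^ (r + 1) * B / r.factorial ≤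
      η * |ν| / (2 * r.factorial) := by
    rw [show η * |ν| / (2 * ((N : ℝ) ^ (r + 1) * B + 1)) * (N : ℝ) ^ (r + 1) * B / r.factorial =
      η * |ν| / (2 * r.factorial) * (((N : ℝ) ^ (r + 1) * B) / ((N : ℝ) ^ (r + 1) * B + 1)) by
        field_simp]
    refine mul_le_of_le_one_right (by positivity) ?_
    rw [div_le_one (by positivity)]
    linarith
  have h3 : η * |ν| / (2 * r.factorial) ≤ |d * √M * M ^ r| := by
    have h4 := abs_sub_abs_le_abs_sub (D (k / M) / r.factorial * ν) (d * √M * M ^ r)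
    rw [abs_sub_comm] at h4
    have h5 : η * |ν| / r.factorial = 2 * (η * |ν| / (2 * r.factorial)) := by field_simp
    linarith
  have h6 : (η * |ν| / (2 * r.factorial)) ^ 2 ≤ d ^ 2 * M * M ^ (2 * r) := by
    calc (η * |ν| / (2 * r.factorial)) ^ 2 ≤ |d * √M * M ^ r| ^ 2 := by gcongr
      _ = d ^ 2 * M * M ^ (2 * r) := by
        rw [sq_abs, mul_pow, mul_pow, Real.sq_sqrt hM0.le, ← pow_mul, mul_comm r 2]
  calc (η * |ν| / (2 * r.factorial)) ^ 2 * M⁻¹ * (M ^ (2 * r))⁻¹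
      ≤ d ^ 2 * M * M ^ (2 * r) * M⁻¹ * (M ^ (2 * r))⁻¹ := by gcongr
    _ = d ^ 2 := by field_simp

theorem exists_le_MISE_of_mother (hwav : IsWaveletPair N φ ψ) (hN : 0 < N)
    (hψ : WaveletRegular N ψ) {r : ℕ} (hr : 1 ≤ r) (hmom : HasVanishingMoments N ψ r)
    (h0 : 0 < α) (h1 : α < 1) (hCγ : 0 < Cγ)
    (hξ : IsLongMemoryGaussian P ξ γ Cγ α) (hg : ContDiffOn ℝ r g (Set.Icc 0 1))
    (hsupp : 0 < volume {t ∈ Set.Icc (0 : ℝ) 1 | iteratedDerivWithin r g (Set.Icc 0 1) t ≠ 0}) :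
    ∃ h₁ > 0, ∃ c > 0, ∃ M₀ : ℝ, ∀ (n m J : ℕ), 0 < n → (N : ℝ) * 2 ^ m / n ≤ h₁ →
      M₀ ≤ 2 ^ m → J ≤ m → ∀ (q : ℕ) (δ : ℕ → ℝ≥0∞),
      ENNReal.ofReal (c * min (((2 : ℝ) ^ m) ^ (2 * r))⁻¹ (((2 : ℝ) ^ m / n) ^ α)) ≤
        MISE P ξ g N φ ψ n J q δ := by
  obtain ⟨S, C, B, hf⟩ := hψ.piecewiseHolder hwav.support_mother
  obtain ⟨h₁, hh₁, cv, hcv, key⟩ := hf.exists_le_coeffVariance hN r hmom.2 h0 h1 hCγ hξ.decay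
  obtain ⟨a, b', η, ha, hab, hb1, hη, hD⟩ := exists_Icc_le_abs_iteratedDerivWithin hg hsupp
  obtain ⟨M₀, cd, hcd, hcoef⟩ := exists_le_sq_trueCoeff hf hN hr hmom hg ha hb1 hη hD
  have hN1 : (1 : ℝ) ≤ N := by exact_mod_cast hN
  set c₀ := min (cd * ((N : ℝ) ^ (2 * r))⁻¹) (cv / 4) with hc₀
  have hc₀0 : 0 < c₀ := by positivity
  have hba : 0 < b' - a := by linarith
  refine ⟨h₁, hh₁, (b' - a) / 4 * c₀, by positivity, max M₀ (2 / (b' - a)),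
    fun n m J hn hnm hM₀ hJm q δ => ?_⟩
  have hn0 : (0 : ℝ) < n := by exact_mod_cast hn
  obtain ⟨b, hb⟩ := hwav.orthonormal_basis J
  set M : ℝ := (N : ℝ) * 2 ^ m with hM
  have hM0 : 0 < M := by positivity
  have h2M : (2 : ℝ) ^ m ≤ M := le_mul_of_one_le_left (by positivity) hN1
  set w := min (((2 : ℝ) ^ m) ^ (2 * r))⁻¹ (((2 : ℝ) ^ m / n) ^ α) with hw
  have hw0 : 0 < w := by positivity
  set t₀ : ℝ := M⁻¹ * (c₀ * w) with ht₀
  set K : Finset ℤ := Finset.Icc ⌈a * M⌉ ⌊b' * M⌋ with hK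
  have hKm : ∀ k ∈ K, 0 ≤ k ∧ (k : ℝ) + N ≤ M ∧
      cd * M⁻¹ * (M ^ (2 * r))⁻¹ ≤ trueCoeff g (scaled N ψ m k) ^ 2 := fun k hk => by
    have := Finset.mem_Icc.1 hk
    exact hcoef m k (((le_max_left _ _).trans hM₀).trans h2M) (Int.ceil_le.1 this.1)
      (Int.le_floor.1 this.2)
  have hlev : J + (m - J) = m := Nat.add_sub_cancel' hJm
  have hrisk : ∀ k ∈ K, ENNReal.ofReal (t₀ / 2) ≤
      coeffRisk P ξ g N φ ψ n J q δ (Sum.inr (m - J, k)) := by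
    intro k hk
    obtain ⟨hk0, hkN, hd⟩ := hKm k hk
    have hv := key n m k hn hnm hk0 hkN
    have hX := aemeasurable_empiricalCoeff (g := g) (N := N) (n := n)
      (fun i => hξ.gaussian.aemeasurable i) ψ m k
    have hlaw := (hξ.map_empiricalCoeff hN n g ψ m k).2
    have htd : t₀ ≤ trueCoeff g (scaled N ψ m k) ^ 2 := by
      refine le_trans ?_ hd
      rw [ht₀, mul_comm cd, mul_assoc]
      refine mul_le_mul_of_nonneg_left ?_ (by positivity)
      calc c₀ * w ≤ (cd * ((N : ℝ) ^ (2 * r))⁻¹) * (((2 : ℝ) ^ m) ^ (2 * r))⁻¹ := by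
            gcongr
            · exact min_le_left _ _
            · exact min_le_left _ _
        _ = cd * (M ^ (2 * r))⁻¹ := by rw [hM, mul_pow, mul_inv]; ring
    have htv : t₀ ≤ coeffVariance γ N n ψ m k / 4 := by
      have : t₀ ≤ cv * M⁻¹ * ((2 : ℝ) ^ m / n) ^ α / 4 := by
        rw [ht₀, show cv * M⁻¹ * ((2 : ℝ) ^ m / n) ^ α / 4 =
          M⁻¹ * (cv / 4 * ((2 : ℝ) ^ m / n) ^ α) by ring]
        refine mul_le_mul_of_nonneg_left ?_ (by positivity)
        gcongr
        · exact min_le_right _ _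
        · exact min_le_right _ _
      linarith
    refine ofReal_half_le_lintegral_of_gaussian hX hlaw (lt_of_lt_of_le (by positivity) hv)
      (d := trueCoeff g (scaled N ψ m k)) fun ω hω => ?_
    simp only [estimatorCoeff, waveletSystem, hlev]
    -- If level m lies beyond the smoothing parameter, the coefficient is estimated by 0 and the
    -- error d² is large enough by itself.
    split_ifs
    · exact (le_min htd (htv.trans hω)).trans (min_le_sq_sub_hardThreshold _ _ _)
    · rwa [sub_zero]
  -- There are at least (b' - a) M - 1 integers in the range, and the second entry of the maximum
  -- bounding 2^m from below makes (b' - a) M ≥ 2.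
  have hcard : (b' - a) / 2 * M ≤ K.card := by
    rw [hK, Int.card_Icc]
    have e1 := Int.sub_one_lt_floor (b' * M)
    have e2 := Int.ceil_lt_add_one (a * M)
    have e3 : (((⌊b' * M⌋ + 1 - ⌈a * M⌉ : ℤ)) : ℝ) ≤
        ((((⌊b' * M⌋ + 1 - ⌈a * M⌉).toNat : ℕ) : ℤ) : ℝ) := by
      exact_mod_cast Int.self_le_toNat _
    push_cast at e3
    have e4 := ((le_max_right _ _).trans hM₀).trans h2M
    rw [div_le_iff₀ hba] at e4
    linarith
  have hmise := sum_coeffRisk_le_MISE (P := P) (ξ := ξ) (n := n) (q := q) (δ := δ) hg.continuousOn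
    (fun i => hξ.gaussian.aemeasurable i) hb
    (K.map ⟨fun k => Sum.inr (m - J, k), fun x y h => by simpa using h⟩) (by
      intro i hi t ht
      obtain ⟨k, hk, rfl⟩ := Finset.mem_map.1 hi
      change scaled N ψ (J + (m - J)) k t = 0
      rw [hlev]
      exact hf.scaled_eq_zero hN (hKm k hk).1 (hKm k hk).2.1 ht)
  rw [Finset.sum_map] at hmise
  refine le_trans ?_ hmise
  calc ENNReal.ofReal ((b' - a) / 4 * c₀ * w)
      = ENNReal.ofReal ((b' - a) / 2 * M * (t₀ / 2)) := by
        congr 1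
        rw [ht₀]
        field_simp
        norm_num
    _ ≤ ENNReal.ofReal (K.card * (t₀ / 2)) := by
        refine ENNReal.ofReal_le_ofReal ?_
        gcongr
    _ = K.card • ENNReal.ofReal (t₀ / 2) := by
        rw [ENNReal.ofReal_mul (by positivity), ENNReal.ofReal_natCast, nsmul_eq_mul]
    _ = ∑ k ∈ K, ENNReal.ofReal (t₀ / 2) := (Finset.sum_const _).symm
    _ ≤ _ := Finset.sum_le_sum hrisk

/-- The dyadic level whose resolution is of order `n ^ κ`. -/
theorem exists_dyadic_level {κ : ℝ} (hκ : 0 ≤ κ) {n : ℕ} (hn : 0 < n) :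
    ∃ m : ℕ, (2 : ℝ) ^ m ≤ (n : ℝ) ^ κ ∧ (n : ℝ) ^ κ / 2 ≤ 2 ^ m := by
  have hn1 : (1 : ℝ) ≤ n := by exact_mod_cast hn
  obtain ⟨m, h1, h2⟩ := exists_nat_pow_near (Real.one_le_rpow hn1 hκ) (one_lt_two (α := ℝ))
  exact ⟨m, h1, by rw [pow_succ] at h2; linarith⟩

/-- The exponent κ balances squared bias and variance: 2rκ = (1 - κ)α = β. The reference level m
depends on n alone; whichever side of it J n falls on, one of the two preceding bounds is of order
n^(-β). The constant loses (1/2)^α because 2^m matches n^κ only up to a factor 2. -/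
theorem exists_eventually_le_MISE (hwav : IsWaveletPair N φ ψ) (hN : 0 < N)
    (hφ : WaveletRegular N φ)
    (hψ : WaveletRegular N ψ) {r : ℕ} (hr : 1 ≤ r) (hmom : HasVanishingMoments N ψ r)
    (h0 : 0 < α) (h1 : α < 1) (hCγ : 0 < Cγ)
    (hξ : IsLongMemoryGaussian P ξ γ Cγ α) (hg : ContDiffOn ℝ r g (Set.Icc 0 1))
    (hsupp : 0 < volume {t ∈ Set.Icc (0 : ℝ) 1 | iteratedDerivWithin r g (Set.Icc 0 1) t ≠ 0}) :
    ∃ c : ℝ, 0 < c ∧ ∀ J : ℕ → ℕ, AdmissibleLevel J →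
      ∀ᶠ n : ℕ in atTop, ∀ (q : ℕ) (δ : ℕ → ℝ≥0∞),
        ENNReal.ofReal (c * (n : ℝ) ^ (-(2 * r * α / (2 * r + α)))) ≤
          MISE P ξ g N φ ψ n (J n) q δ := by
  obtain ⟨h₁, hh₁, c₁, hc₁, key₁⟩ :=
    exists_le_MISE_of_father hwav hN hφ h0 h1 hCγ hξ hg.continuousOn
  obtain ⟨h₂, hh₂, c₂, hc₂, M₀, key₂⟩ :=
    exists_le_MISE_of_mother hwav hN hψ hr hmom h0 h1 hCγ hξ hg hsupp
  have hr0 : (0 : ℝ) < r := by exact_mod_cast hr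
  have hN0 : (0 : ℝ) < N := by exact_mod_cast hN
  set κ := α / (2 * r + α) with hκ
  have hκ0 : 0 < κ := by positivity
  have hκ1 : κ < 1 := by rw [hκ, div_lt_one (by positivity)]; linarith
  have hβ : (κ - 1) * α = -(2 * r * α / (2 * r + α)) := by rw [hκ]; field_simp; ring
  have hβ' : -(κ * (2 * r)) = -(2 * r * α / (2 * r + α)) := by rw [hκ]; field_simp
  refine ⟨min c₁ c₂ * (1 / 2) ^ α, by positivity, fun J hJ => ?_⟩
  have ev1 : ∀ᶠ n : ℕ in atTop, (2 : ℝ) ^ J n ≤ h₁ / N * n := by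
    have := hJ.def (c := h₁ / N) (by positivity)
    filter_upwards [this] with n hn
    simpa using hn
  have hlim : Tendsto (fun n : ℕ => (n : ℝ) ^ κ) atTop atTop :=
    (tendsto_rpow_atTop hκ0).comp tendsto_natCast_atTop_atTop
  have ev2 : ∀ᶠ n : ℕ in atTop, 2 * M₀ ≤ (n : ℝ) ^ κ := hlim.eventually_ge_atTop _
  have hlim' : Tendsto (fun n : ℕ => N * (n : ℝ) ^ (-(1 - κ))) atTop (𝓝 0) := by
    have := ((tendsto_rpow_neg_atTop (by linarith : 0 < 1 - κ)).comp
      tendsto_natCast_atTop_atTop).const_mul (N : ℝ)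
    simpa using this
  have ev3 : ∀ᶠ n : ℕ in atTop, N * (n : ℝ) ^ (-(1 - κ)) ≤ h₂ := hlim'.eventually_le_const hh₂
  filter_upwards [ev1, ev2, ev3, eventually_gt_atTop 0] with n hn1 hn2 hn3 hn q δ
  have hn0 : (0 : ℝ) < n := by exact_mod_cast hn
  obtain ⟨m, hm1, hm2⟩ := exists_dyadic_level hκ0.le hn
  have hrate : ∀ x : ℝ, (n : ℝ) ^ κ / 2 ≤ x →
      (1 / 2) ^ α * (n : ℝ) ^ (-(2 * r * α / (2 * r + α))) ≤ (x / n) ^ α := fun x hx => by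
    calc (1 / 2) ^ α * (n : ℝ) ^ (-(2 * r * α / (2 * r + α)))
        = (1 / 2 * (n : ℝ) ^ (κ - 1)) ^ α := by
          rw [← hβ, Real.rpow_mul hn0.le, ← Real.mul_rpow (by norm_num) (by positivity)]
      _ ≤ (x / n) ^ α := by
          refine Real.rpow_le_rpow (by positivity) ?_ h0.le
          rw [Real.rpow_sub hn0, Real.rpow_one, le_div_iff₀ hn0]
          calc 1 / 2 * ((n : ℝ) ^ κ / n) * n = (n : ℝ) ^ κ / 2 := by field_simp
            _ ≤ x := hx
  by_cases hJm : J n ≤ m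
  · refine le_trans ?_ (key₂ n m (J n) hn ?_ (by linarith) hJm q δ)
    · refine ENNReal.ofReal_le_ofReal ?_
      rw [mul_assoc]
      refine mul_le_mul (min_le_right _ _) (le_min ?_ (hrate _ hm2)) (by positivity) hc₂.le
      have e1 : (((2 : ℝ) ^ m) ^ (2 * r)) ≤ (n : ℝ) ^ (2 * r * α / (2 * r + α)) := by
        calc ((2 : ℝ) ^ m) ^ (2 * r) ≤ ((n : ℝ) ^ κ) ^ (2 * r) := by gcongr
          _ = (n : ℝ) ^ (2 * r * α / (2 * r + α)) := by
            rw [← Real.rpow_natCast, ← Real.rpow_mul hn0.le]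
            congr 1
            push_cast
            linarith
      rw [Real.rpow_neg hn0.le]
      calc (1 / 2) ^ α * ((n : ℝ) ^ (2 * r * α / (2 * r + α)))⁻¹
          ≤ 1 * ((n : ℝ) ^ (2 * r * α / (2 * r + α)))⁻¹ := by
            gcongr
            exact Real.rpow_le_one (by norm_num) (by norm_num) h0.le
        _ ≤ _ := by
            rw [one_mul]
            exact inv_anti₀ (by positivity) e1
    · refine le_trans ?_ hn3
      rw [neg_sub, Real.rpow_sub hn0, Real.rpow_one, mul_div_assoc]
      gcongr
  · have hJm' : (2 : ℝ) ^ m ≤ 2 ^ J n := pow_le_pow_right₀ (by norm_num) (not_le.1 hJm).le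
    refine le_trans ?_ (key₁ n (J n) hn ?_ q δ)
    · refine ENNReal.ofReal_le_ofReal ?_
      rw [mul_assoc]
      exact mul_le_mul (min_le_left _ _) (hrate _ (hm2.trans hJm')) (by positivity) hc₁.le
    · rw [div_le_iff₀ hn0]
      calc (N : ℝ) * 2 ^ J n ≤ N * (h₁ / N * n) := by gcongr
        _ = h₁ * n := by field_simp

end Lower

/-! ### The upper bound -/

theorem card_interior_le {N m : ℕ} (hN : 0 < N) :
    ((Finset.Icc (-(N : ℤ) + 1) ((N : ℤ) * 2 ^ m - 1)).card : ℝ) ≤ 2 * ((N : ℝ) * 2 ^ m) := by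
  have h1 : (1 : ℤ) ≤ 2 ^ m := one_le_pow₀ (by norm_num)
  have hN' : (1 : ℤ) ≤ N := by exact_mod_cast hN
  have h2 : (((Finset.Icc (-(N : ℤ) + 1) ((N : ℤ) * 2 ^ m - 1)).card : ℕ) : ℤ) ≤
      2 * ((N : ℤ) * 2 ^ m) := by
    rw [Int.card_Icc, Int.toNat_of_nonneg (by nlinarith)]
    nlinarith
  exact_mod_cast h2

theorem card_boundary_le (N m : ℕ) :
    (((Finset.Icc (-(N : ℤ) + 1) ((N : ℤ) * 2 ^ m - 1)).filter
      fun k : ℤ => ¬ (0 ≤ k ∧ (k : ℝ) + N ≤ (N : ℝ) * 2 ^ m)).card : ℝ) ≤ 2 * N := by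
  have hsub : (Finset.Icc (-(N : ℤ) + 1) ((N : ℤ) * 2 ^ m - 1)).filter
      (fun k : ℤ => ¬ (0 ≤ k ∧ (k : ℝ) + N ≤ (N : ℝ) * 2 ^ m)) ⊆
      Finset.Ico (-(N : ℤ)) 0 ∪ Finset.Ico ((N : ℤ) * 2 ^ m - N) ((N : ℤ) * 2 ^ m) := by
    intro k hk
    rw [Finset.mem_filter, Finset.mem_Icc] at hk
    rw [Finset.mem_union, Finset.mem_Ico, Finset.mem_Ico]
    by_cases h0 : 0 ≤ k
    · right
      have h2 : ¬ (k + N ≤ (N : ℤ) * 2 ^ m) := fun h => hk.2 ⟨h0, by exact_mod_cast h⟩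
      constructor <;> omega
    · left
      constructor <;> omega
  have hc := (Finset.card_le_card hsub).trans (Finset.card_union_le _ _)
  rw [Int.card_Ico, Int.card_Ico] at hc
  have h3 : (0 - -(N : ℤ)).toNat = N := by simp
  have h4 : ((N : ℤ) * 2 ^ m - ((N : ℤ) * 2 ^ m - N)).toNat = N := by simp
  rw [h3, h4] at hc
  have : ((((Finset.Icc (-(N : ℤ) + 1) ((N : ℤ) * 2 ^ m - 1)).filter
      fun k : ℤ => ¬ (0 ≤ k ∧ (k : ℝ) + N ≤ (N : ℝ) * 2 ^ m)).card : ℕ) : ℝ) ≤ ((N + N : ℕ) : ℝ) :=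
    Nat.cast_le.2 hc
  push_cast at this
  linarith

/-- A sum over all positions at one level, split into interior and boundary positions. -/
theorem sum_le_interior_add_boundary {N m : ℕ} (hN : 0 < N) (F : ℤ → ℝ≥0∞) {x y : ℝ}
    (hx : 0 ≤ x) (hy : 0 ≤ y)
    (hint : ∀ k : ℤ, 0 ≤ k → (k : ℝ) + N ≤ (N : ℝ) * 2 ^ m → F k ≤ ENNReal.ofReal x)
    (hbdry : ∀ k : ℤ, F k ≤ ENNReal.ofReal y) :
    ∑ k ∈ Finset.Icc (-(N : ℤ) + 1) ((N : ℤ) * 2 ^ m - 1), F k ≤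
      ENNReal.ofReal (2 * ((N : ℝ) * 2 ^ m) * x + 2 * N * y) := by
  rw [← Finset.sum_filter_add_sum_filter_not _
    (fun k : ℤ => 0 ≤ k ∧ (k : ℝ) + N ≤ (N : ℝ) * 2 ^ m),
    ENNReal.ofReal_add (by positivity) (by positivity)]
  refine add_le_add ?_ ?_
  · calc _ ≤ ∑ k ∈ (Finset.Icc (-(N : ℤ) + 1) ((N : ℤ) * 2 ^ m - 1)).filter
          (fun k : ℤ => 0 ≤ k ∧ (k : ℝ) + N ≤ (N : ℝ) * 2 ^ m), ENNReal.ofReal x :=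
          Finset.sum_le_sum fun k hk =>
            hint k (Finset.mem_filter.1 hk).2.1 (Finset.mem_filter.1 hk).2.2
      _ ≤ ∑ k ∈ Finset.Icc (-(N : ℤ) + 1) ((N : ℤ) * 2 ^ m - 1), ENNReal.ofReal x :=
          Finset.sum_le_sum_of_subset (Finset.filter_subset _ _)
      _ = ENNReal.ofReal ((Finset.Icc (-(N : ℤ) + 1) ((N : ℤ) * 2 ^ m - 1)).card * x) := by
          rw [Finset.sum_const, nsmul_eq_mul, ENNReal.ofReal_mul (by positivity),
            ENNReal.ofReal_natCast]
      _ ≤ _ := ENNReal.ofReal_le_ofReal (mul_le_mul_of_nonneg_right (card_interior_le hN) hx)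
  · calc _ ≤ ∑ k ∈ (Finset.Icc (-(N : ℤ) + 1) ((N : ℤ) * 2 ^ m - 1)).filter
          (fun k : ℤ => ¬ (0 ≤ k ∧ (k : ℝ) + N ≤ (N : ℝ) * 2 ^ m)), ENNReal.ofReal y :=
          Finset.sum_le_sum fun k _ => hbdry k
      _ = ENNReal.ofReal (((Finset.Icc (-(N : ℤ) + 1) ((N : ℤ) * 2 ^ m - 1)).filter
          (fun k : ℤ => ¬ (0 ≤ k ∧ (k : ℝ) + N ≤ (N : ℝ) * 2 ^ m))).card * y) := by
          rw [Finset.sum_const, nsmul_eq_mul, ENNReal.ofReal_mul (by positivity),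
            ENNReal.ofReal_natCast]
      _ ≤ _ := ENNReal.ofReal_le_ofReal (mul_le_mul_of_nonneg_right (card_boundary_le N m) hy)

theorem sum_geometric_half (q : ℕ) :
    ∑ j ∈ Finset.range (q + 1), (1 / 2 : ℝ) ^ j = 2 - (1 / 2) ^ q := by
  induction q with
  | zero => norm_num
  | succ q ih => rw [Finset.sum_range_succ, ih, pow_succ]; ring

theorem tsum_ofReal_level_le {D : ℕ → ℝ≥0∞} {q : ℕ} {a b c : ℝ} (ha : 0 ≤ a) (hb : 0 ≤ b)
    (hc : 0 ≤ c) (hlow : ∀ j ≤ q, D j ≤ ENNReal.ofReal (a * (1 / 2) ^ j + b))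
    (hhigh : ∀ j, q < j → D j ≤ ENNReal.ofReal (a * (1 / 2) ^ j + c * (1 / 2) ^ j)) :
    ∑' j, D j ≤ ENNReal.ofReal (2 * a + (q + 1) * b + c * (1 / 2) ^ q) := by
  have s1 : HasSum (fun j : ℕ => a * (1 / 2 : ℝ) ^ j) (a * 2) := hasSum_geometric_two.mul_left a
  -- The majorant is a single series: c (1/2)^j is added at every level, and up to level q this
  -- correction replaces it by b.
  have s2 : HasSum (fun j : ℕ => if j ∈ Finset.range (q + 1) then b - c * (1 / 2 : ℝ) ^ j else 0)
      (∑ j ∈ Finset.range (q + 1), (b - c * (1 / 2 : ℝ) ^ j)) := by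
    have : HasSum (fun j : ℕ => if j ∈ Finset.range (q + 1) then b - c * (1 / 2 : ℝ) ^ j else 0)
        (∑ j ∈ Finset.range (q + 1),
          if j ∈ Finset.range (q + 1) then b - c * (1 / 2 : ℝ) ^ j else 0) :=
      hasSum_sum_of_ne_finset_zero fun j hj => if_neg hj
    rwa [Finset.sum_congr rfl fun j hj => if_pos hj] at this
  have s3 : HasSum (fun j : ℕ => c * (1 / 2 : ℝ) ^ j) (c * 2) := hasSum_geometric_two.mul_left c
  have hs := (s1.add s2).add s3
  have hval : a * 2 + (∑ j ∈ Finset.range (q + 1), (b - c * (1 / 2 : ℝ) ^ j)) + c * 2 =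
      2 * a + (q + 1) * b + c * (1 / 2) ^ q := by
    rw [Finset.sum_sub_distrib, ← Finset.mul_sum, sum_geometric_half, Finset.sum_const,
      Finset.card_range, nsmul_eq_mul]
    push_cast
    ring
  rw [hval] at hs
  have hle : ∀ j, D j ≤ ENNReal.ofReal (a * (1 / 2 : ℝ) ^ j +
      (if j ∈ Finset.range (q + 1) then b - c * (1 / 2 : ℝ) ^ j else 0) + c * (1 / 2 : ℝ) ^ j) ∧
      0 ≤ a * (1 / 2 : ℝ) ^ j +
      (if j ∈ Finset.range (q + 1) then b - c * (1 / 2 : ℝ) ^ j else 0) + c * (1 / 2 : ℝ) ^ j := by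
    intro j
    split_ifs with hj
    · have e : a * (1 / 2 : ℝ) ^ j + (b - c * (1 / 2 : ℝ) ^ j) + c * (1 / 2 : ℝ) ^ j =
        a * (1 / 2) ^ j + b := by ring
      rw [e]
      exact ⟨hlow j (Nat.lt_succ_iff.1 (Finset.mem_range.1 hj)), by positivity⟩
    · rw [add_zero]
      refine ⟨hhigh j ?_, by positivity⟩
      rw [Finset.mem_range] at hj
      omega
  calc ∑' j, D j ≤ ∑' j, ENNReal.ofReal (a * (1 / 2 : ℝ) ^ j +
      (if j ∈ Finset.range (q + 1) then b - c * (1 / 2 : ℝ) ^ j else 0) + c * (1 / 2 : ℝ) ^ j) :=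
        ENNReal.tsum_le_tsum fun j => (hle j).1
    _ = _ := by
        rw [← ENNReal.ofReal_tsum_of_nonneg (fun j => (hle j).2) hs.summable, hs.tsum_eq]

section Upper

variable {Ω : Type*} [MeasurableSpace Ω] {P : Measure Ω} [IsProbabilityMeasure P]
  {N : ℕ} {φ ψ g : ℝ → ℝ} {ξ : ℕ → Ω → ℝ} {γ : ℕ → ℝ} {Cγ α : ℝ}

theorem MISE_le_sum_add_tsum {n J q : ℕ} {δ : ℕ → ℝ≥0∞} (hwav : IsWaveletPair N φ ψ)
    (hN : 0 < N) (hφ : WaveletRegular N φ) (hψ : WaveletRegular N ψ)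
    (hξ : ∀ i, AEMeasurable (ξ i) P) (hg : ContinuousOn g (Set.Icc 0 1)) :
    MISE P ξ g N φ ψ n J q δ ≤
      ∑ k ∈ Finset.Icc (-(N : ℤ) + 1) ((N : ℤ) * 2 ^ J - 1),
        coeffRisk P ξ g N φ ψ n J q δ (Sum.inl k) +
      ∑' j : ℕ, ∑ k ∈ Finset.Icc (-(N : ℤ) + 1) ((N : ℤ) * 2 ^ (J + j) - 1),
        coeffRisk P ξ g N φ ψ n J q δ (Sum.inr (j, k)) := by
  obtain ⟨b, hb⟩ := hwav.orthonormal_basis J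
  obtain ⟨S, C, B, hfφ⟩ := hφ.piecewiseHolder hwav.support_father
  obtain ⟨S', C', B', hfψ⟩ := hψ.piecewiseHolder hwav.support_mother
  refine (MISE_le_tsum_coeffRisk hg hξ hb).trans (le_of_eq ?_)
  rw [ENNReal.summable.tsum_sum ENNReal.summable]
  congr 1
  · refine tsum_eq_sum fun k hk => ?_
    simp [coeffRisk, estimatorCoeff, waveletSystem, hfφ.trueCoeff_eq_zero hN g J hk, hk]
  · have hp := ENNReal.tsum_prod' (f := fun i : ℕ × ℤ =>
      coeffRisk P ξ g N φ ψ n J q δ (Sum.inr i))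
    refine Eq.trans hp (tsum_congr fun j => tsum_eq_sum fun k hk => ?_)
    simp only [coeffRisk, estimatorCoeff, waveletSystem, hfψ.trueCoeff_eq_zero hN g (J + j) hk, hk,
      and_false, if_false]
    simp

end Upper

theorem PiecewiseHolder.exists_sq_trueCoeff_le {N : ℕ} {ψ : ℝ → ℝ} {S : Finset ℝ} {C B : ℝ}
    (hψ : PiecewiseHolder N ψ S C B) (hN : 0 < N) {r : ℕ} (hr : 1 ≤ r)
    (hmom : ∀ k < r, ∫ t in (0 : ℝ)..N, t ^ k * ψ t = 0) {g : ℝ → ℝ}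
    (hg : ContDiffOn ℝ r g (Set.Icc 0 1)) :
    ∃ c ≥ 0, ∀ (m : ℕ) (k : ℤ), 0 ≤ k → (k : ℝ) + N ≤ (N : ℝ) * 2 ^ m →
      trueCoeff g (scaled N ψ m k) ^ 2 ≤
        c * (((N : ℝ) * 2 ^ m)⁻¹ * (((N : ℝ) * 2 ^ m) ^ (2 * r))⁻¹) := by
  set D := iteratedDerivWithin r g (Set.Icc 0 1) with hD
  have hDc : ContinuousOn D (Set.Icc 0 1) :=
    hg.continuousOn_iteratedDerivWithin le_rfl (uniqueDiffOn_Icc zero_lt_one)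
  obtain ⟨E, hE⟩ := isCompact_Icc.exists_bound_of_continuousOn hDc
  simp only [Real.norm_eq_abs] at hE
  have hN0 : (0 : ℝ) < N := by exact_mod_cast hN
  set ν := ∫ t in (0 : ℝ)..N, t ^ r * ψ t with hν
  refine ⟨(2 * E * (N : ℝ) ^ (r + 1) * B / r.factorial + E / r.factorial * |ν|) ^ 2,
    sq_nonneg _, fun m k hk0 hkN => ?_⟩
  have hk0' : (0 : ℝ) ≤ k := by exact_mod_cast hk0
  have hM0 : (0 : ℝ) < (N : ℝ) * 2 ^ m := by positivity
  have hkM : (k : ℝ) / ((N : ℝ) * 2 ^ m) ∈ Set.Icc (0 : ℝ) 1 :=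
    ⟨by positivity, by rw [div_le_one hM0]; linarith⟩
  have key := hψ.abs_trueCoeff_sub_le hN hr hmom hg hk0 hkN (η := 2 * E) (fun s hs _ => by
    rw [← hD, abs_le]
    have e1 := abs_le.1 (hE s hs)
    have e2 := abs_le.1 (hE _ hkM)
    constructor <;> linarith)
  rw [← hD, ← hν] at key
  set M : ℝ := (N : ℝ) * 2 ^ m with hM
  set d := trueCoeff g (scaled N ψ m k) with hd
  have h1 : |D (k / M) / r.factorial * ν| ≤ E / r.factorial * |ν| := by
    rw [abs_mul, abs_div, Nat.abs_cast]
    have := hE _ hkM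
    gcongr
  have h2 : |d * √M * M ^ r| ≤
      2 * E * (N : ℝ) ^ (r + 1) * B / r.factorial + E / r.factorial * |ν| := by
    have := abs_sub_abs_le_abs_sub (d * √M * M ^ r) (D (k / M) / r.factorial * ν)
    linarith
  have h3 : d ^ 2 * M * M ^ (2 * r) ≤
      (2 * E * (N : ℝ) ^ (r + 1) * B / r.factorial + E / r.factorial * |ν|) ^ 2 := by
    calc d ^ 2 * M * M ^ (2 * r) = |d * √M * M ^ r| ^ 2 := by
          rw [sq_abs, mul_pow _ (M ^ r), mul_pow d, Real.sq_sqrt hM0.le, ← pow_mul, mul_comm r 2]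
      _ ≤ _ := by gcongr
  calc d ^ 2 = d ^ 2 * M * M ^ (2 * r) * (M⁻¹ * (M ^ (2 * r))⁻¹) := by field_simp
    _ ≤ _ := by gcongr

theorem PiecewiseHolder.exists_coeffVariance_le {N : ℕ} {f : ℝ → ℝ} {S : Finset ℝ} {C B : ℝ}
    {γ : ℕ → ℝ} {Cγ α : ℝ} (hf : PiecewiseHolder N f S C B) (hN : 0 < N)
    (h0 : 0 < α) (h1 : α < 1) (hCγ : 0 < Cγ)
    (hdecay : Asymptotics.IsEquivalent atTop γ (fun k : ℕ => Cγ * (k : ℝ) ^ (-α))) :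
    ∃ V ≥ 0, ∀ (n m : ℕ) (k : ℤ), 0 < n → (N : ℝ) * 2 ^ m ≤ n →
      coeffVariance γ N n f m k ≤
        V * (((N : ℝ) * 2 ^ m)⁻¹ * ((N : ℝ) * 2 ^ m / n) ^ α) := by
  obtain ⟨V, hV, key⟩ := hf.exists_gridForm_le h0 h1 hCγ hdecay
  refine ⟨V, hV, fun n m k hn hmn => ?_⟩
  have hn0 : (0 : ℝ) < n := by exact_mod_cast hn
  rw [coeffVariance]
  calc ((N : ℝ) * 2 ^ m)⁻¹ * gridForm γ f (-k) ((N : ℝ) * 2 ^ m / n) n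
      ≤ ((N : ℝ) * 2 ^ m)⁻¹ * (V * ((N : ℝ) * 2 ^ m / n) ^ α) := by
        gcongr
        exact key _ _ _ (by positivity) ((div_le_one hn0).2 hmn)
    _ = _ := by ring

theorem inv_mul_div_rpow_le {M n α : ℝ} (hM : 1 ≤ M) (hn : 0 < n) (h1 : α < 1) :
    M⁻¹ * (M / n) ^ α ≤ n ^ (-α) := by
  have hM0 : 0 < M := by linarith
  rw [Real.div_rpow hM0.le hn.le, Real.rpow_neg hn.le, ← mul_div_assoc, div_eq_mul_inv]
  refine mul_le_of_le_one_left (by positivity) ?_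
  rw [inv_mul_le_one₀ hM0]
  calc M ^ α ≤ M ^ (1 : ℝ) := Real.rpow_le_rpow_of_exponent_le hM h1.le
    _ = M := Real.rpow_one M

theorem PiecewiseHolder.exists_sq_coeffMean_sub_trueCoeff_le {N : ℕ} {f g : ℝ → ℝ}
    {S : Finset ℝ} {C B : ℝ} (hf : PiecewiseHolder N f S C B) (hN : 0 < N) {r : ℕ} (hr : 1 ≤ r)
    (hg : ContDiffOn ℝ r g (Set.Icc 0 1)) :
    ∃ K ≥ 0, ∀ (n m : ℕ) (k : ℤ), 0 < n → (N : ℝ) * 2 ^ m ≤ n →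
      (coeffMean g N n f m k - trueCoeff g (scaled N f m k)) ^ 2 ≤ K * (n : ℝ)⁻¹ := by
  obtain ⟨A, L, hA, hL, hgA, hgL⟩ := ContDiffOn.exists_bound_and_lipschitz hr hg
  refine ⟨(((C + B) * (N + 2) + 4 * B * S.card) * (L + A)) ^ 2, sq_nonneg _,
    fun n m k hn hmn => ?_⟩
  have h := hf.abs_coeffMean_sub_trueCoeff_le hN hg.continuousOn hA hL hgA hgL hn hmn k
  have h2 := pow_le_pow_left₀ (abs_nonneg _) h 2
  rwa [sq_abs, mul_pow, inv_pow, Real.sq_sqrt (Nat.cast_nonneg n)] at h2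

theorem one_le_natCast_mul_two_pow {N : ℕ} (hN : 0 < N) (m : ℕ) : (1 : ℝ) ≤ (N : ℝ) * 2 ^ m :=
  one_le_mul_of_one_le_of_one_le (by exact_mod_cast hN) (one_le_pow₀ (by norm_num))

section Upper

variable {Ω : Type*} [MeasurableSpace Ω] {P : Measure Ω} [IsProbabilityMeasure P]
  {N : ℕ} {φ ψ g : ℝ → ℝ} {ξ : ℕ → Ω → ℝ} {γ : ℕ → ℝ} {Cγ α : ℝ}

/-- About M coefficients, each with variance of order M⁻¹ (M/n)^α and squared bias O(1/n). The total
bias M/n is at most (M/n)^α because M ≤ n and α < 1. -/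
theorem exists_sum_coeffRisk_father_le {S : Finset ℝ} {C B : ℝ} (hφ : PiecewiseHolder N φ S C B)
    (hN : 0 < N) {r : ℕ} (hr : 1 ≤ r) (h0 : 0 < α) (h1 : α < 1) (hCγ : 0 < Cγ)
    (hξ : IsLongMemoryGaussian P ξ γ Cγ α) (hg : ContDiffOn ℝ r g (Set.Icc 0 1)) :
    ∃ C' ≥ 0, ∀ (n J q : ℕ) (δ : ℕ → ℝ≥0∞), 0 < n → (N : ℝ) * 2 ^ J ≤ n →
      ∑ k ∈ Finset.Icc (-(N : ℤ) + 1) ((N : ℤ) * 2 ^ J - 1),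
        coeffRisk P ξ g N φ ψ n J q δ (Sum.inl k) ≤
      ENNReal.ofReal (C' * ((N : ℝ) * 2 ^ J / n) ^ α) := by
  obtain ⟨V, hV, hvar⟩ := hφ.exists_coeffVariance_le hN h0 h1 hCγ hξ.decay
  obtain ⟨K, hK, hbias⟩ := hφ.exists_sq_coeffMean_sub_trueCoeff_le hN hr hg
  obtain ⟨c, hc, hmom⟩ := exists_lintegral_pow_le_of_gaussian 1
  refine ⟨8 * c * V + 8 * K, by positivity, fun n J q δ hn hJn => ?_⟩
  have hn0 : (0 : ℝ) < n := by exact_mod_cast hn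
  set M : ℝ := (N : ℝ) * 2 ^ J with hM
  have hM0 : 0 < M := by positivity
  have hle : ∀ k ∈ Finset.Icc (-(N : ℤ) + 1) ((N : ℤ) * 2 ^ J - 1),
      coeffRisk P ξ g N φ ψ n J q δ (Sum.inl k) ≤
        ENNReal.ofReal (4 * c * (V * (M⁻¹ * (M / n) ^ α)) + 4 * (K * (n : ℝ)⁻¹)) := by
    intro k hk
    have hX := aemeasurable_empiricalCoeff (g := g) (N := N) (n := n)
      (fun i => hξ.gaussian.aemeasurable i) φ J k
    obtain ⟨hv0, hlaw⟩ := hξ.map_empiricalCoeff hN n g φ J k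
    simp only [coeffRisk, estimatorCoeff, waveletSystem, if_pos hk]
    calc _ ≤ ∫⁻ ω, ENNReal.ofReal (2 * (trueCoeff g (scaled N φ J k) -
            empiricalCoeff N n (observation n g ξ ω) φ J k) ^ 2 + 0) ∂P :=
          lintegral_mono fun ω => ENNReal.ofReal_le_ofReal (by
            nlinarith [sq_nonneg (trueCoeff g (scaled N φ J k) -
              empiricalCoeff N n (observation n g ξ ω) φ J k)])
      _ ≤ _ := lintegral_sq_sub_le_of_gaussian hc hv0 hX (hmom hX hlaw hv0) _ le_rfl
      _ ≤ _ := by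
          refine ENNReal.ofReal_le_ofReal ?_
          rw [add_zero]
          gcongr
          · exact hvar n J k hn hJn
          · exact hbias n J k hn hJn
  have hMn : M / n ≤ (M / n) ^ α := by
    calc M / n = (M / n) ^ (1 : ℝ) := (Real.rpow_one _).symm
      _ ≤ _ := Real.rpow_le_rpow_of_exponent_ge (by positivity) ((div_le_one hn0).2 hJn) h1.le
  refine (Finset.sum_le_sum hle).trans ?_
  rw [Finset.sum_const, nsmul_eq_mul, ← ENNReal.ofReal_natCast,
    ← ENNReal.ofReal_mul (by positivity)]
  refine ENNReal.ofReal_le_ofReal ?_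
  calc _ ≤ 2 * M * (4 * c * (V * (M⁻¹ * (M / n) ^ α)) + 4 * (K * (n : ℝ)⁻¹)) := by
        gcongr
        exact card_interior_le hN
    _ = 8 * c * V * (M / n) ^ α + 8 * K * (M / n) := by field_simp; ring
    _ ≤ 8 * c * V * (M / n) ^ α + 8 * K * (M / n) ^ α := by gcongr
    _ = _ := by ring

/-- The smallness condition on C' forces the mean of each interior coefficient below τ/2, so its
risk is d² plus a false exceedance term with p extra moments; summed over O(M) positions with M ≤ n,
this gives the factor n. The terms n^(-α) + τ² come from the boundary positions. -/
theorem exists_sum_coeffRisk_mother_le {S : Finset ℝ} {C B : ℝ} (hψ : PiecewiseHolder N ψ S C B)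
    (hN : 0 < N) {r : ℕ} (hr : 1 ≤ r)
    (hmom : ∀ k < r, ∫ t in (0 : ℝ)..N, t ^ k * ψ t = 0)
    (h0 : 0 < α) (h1 : α < 1) (hCγ : 0 < Cγ) (hξ : IsLongMemoryGaussian P ξ γ Cγ α)
    (hg : ContDiffOn ℝ r g (Set.Icc 0 1)) (p : ℕ) :
    ∃ C' ≥ 0, ∀ (n J q j : ℕ) (δ : ℕ → ℝ≥0∞) (τ : ℝ), 0 < n → (N : ℝ) * 2 ^ (J + j) ≤ n → j ≤ q →
      0 < τ → δ j = ENNReal.ofReal τ →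
      C' * (((N : ℝ) * 2 ^ (J + j))⁻¹ * (((N : ℝ) * 2 ^ (J + j)) ^ (2 * r))⁻¹ + (n : ℝ) ^ (-α)) ≤
        τ ^ 2 →
      ∑ k ∈ Finset.Icc (-(N : ℤ) + 1) ((N : ℤ) * 2 ^ (J + j) - 1),
        coeffRisk P ξ g N φ ψ n J q δ (Sum.inr (j, k)) ≤
      ENNReal.ofReal (C' * ((((N : ℝ) * 2 ^ (J + j)) ^ (2 * r))⁻¹ +
        (n * ((τ ^ 2)⁻¹ ^ p * ((n : ℝ) ^ (-α)) ^ (p + 1)) + (n : ℝ) ^ (-α) + τ ^ 2))) := by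
  obtain ⟨V, hV, hvar⟩ := hψ.exists_coeffVariance_le hN h0 h1 hCγ hξ.decay
  obtain ⟨K, hK, hbias⟩ := hψ.exists_sq_coeffMean_sub_trueCoeff_le hN hr hg
  obtain ⟨cd, hcd, hcoef⟩ := hψ.exists_sq_trueCoeff_le hN hr hmom hg
  obtain ⟨c₁, hc₁, hmom₁⟩ := exists_lintegral_pow_le_of_gaussian 1
  obtain ⟨c₂, hc₂, hmom₂⟩ := exists_lintegral_pow_le_of_gaussian (p + 1)
  set C₁ := 2 * N * (4 * c₁ * V + 4 * K + 2) with hC₁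
  set C₂ := 2 * (8 * 4 ^ p * (c₂ * V ^ (p + 1))) with hC₂
  have hC₁0 : 0 ≤ C₁ := by positivity
  have hC₂0 : 0 ≤ C₂ := by positivity
  set C' := C₁ + C₂ + 8 * cd + 8 * K with hC'
  have hC'0 : 0 ≤ C' := by positivity
  refine ⟨C', hC'0, fun n J q j δ τ hn hmn hjq hτ hδ hsmall => ?_⟩
  have hn0 : (0 : ℝ) < n := by exact_mod_cast hn
  have hn1 : (1 : ℝ) ≤ n := by exact_mod_cast hn
  have hM1 := one_le_natCast_mul_two_pow hN (J + j)
  set M : ℝ := (N : ℝ) * 2 ^ (J + j) with hM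
  have hM0 : 0 < M := by positivity
  set w : ℝ := (n : ℝ) ^ (-α) with hw
  have hw0 : 0 < w := by positivity
  have hnw : (n : ℝ)⁻¹ ≤ w := by
    rw [← Real.rpow_neg_one]
    exact Real.rpow_le_rpow_of_exponent_le hn1 (by linarith)
  have hv : ∀ k : ℤ, coeffVariance γ N n ψ (J + j) k ≤ V * w := fun k =>
    (hvar n (J + j) k hn hmn).trans
      (mul_le_mul_of_nonneg_left (inv_mul_div_rpow_le hM1 hn0 h1) hV)
  have hb : ∀ k : ℤ, (coeffMean g N n ψ (J + j) k - trueCoeff g (scaled N ψ (J + j) k)) ^ 2 ≤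
      K * w := fun k => (hbias n (J + j) k hn hmn).trans (by gcongr)
  have hrisk : ∀ k ∈ Finset.Icc (-(N : ℤ) + 1) ((N : ℤ) * 2 ^ (J + j) - 1),
      coeffRisk P ξ g N φ ψ n J q δ (Sum.inr (j, k)) =
      ∫⁻ ω, ENNReal.ofReal ((trueCoeff g (scaled N ψ (J + j) k) -
        hardThreshold (ENNReal.ofReal τ)
          (empiricalCoeff N n (observation n g ξ ω) ψ (J + j) k)) ^ 2) ∂P := fun k hk => by
    simp only [coeffRisk, estimatorCoeff, waveletSystem, ← hδ,
      if_pos (And.intro (Finset.mem_range.2 (Nat.lt_succ_of_le hjq)) hk)]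
  rw [Finset.sum_congr rfl hrisk]
  set x := 8 * (4 / τ ^ 2) ^ p * (c₂ * (V * w) ^ (p + 1)) +
    2 * (cd * (M⁻¹ * (M ^ (2 * r))⁻¹)) with hx
  set y := 4 * c₁ * (V * w) + 4 * (K * w) + 2 * τ ^ 2 with hy
  refine (sum_le_interior_add_boundary hN _ (x := x) (y := y) (by positivity) (by positivity)
    (fun k hk0 hkN => ?_) (fun k => ?_)).trans (ENNReal.ofReal_le_ofReal ?_)
  · have hX := aemeasurable_empiricalCoeff (g := g) (N := N) (n := n)
      (fun i => hξ.gaussian.aemeasurable i) ψ (J + j) k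
    obtain ⟨hv0, hlaw⟩ := hξ.map_empiricalCoeff hN n g ψ (J + j) k
    have hd := hcoef (J + j) k hk0 hkN
    rw [← hM] at hd
    refine (lintegral_sq_sub_hardThreshold_le_of_small hc₂ hv0 hX (hmom₂ hX hlaw hv0) hτ ?_ _).trans
      (ENNReal.ofReal_le_ofReal ?_)
    · set μ := coeffMean g N n ψ (J + j) k
      set d := trueCoeff g (scaled N ψ (J + j) k)
      have hz : 0 ≤ M⁻¹ * (M ^ (2 * r))⁻¹ := by positivity
      have e1 : 8 * cd * (M⁻¹ * (M ^ (2 * r))⁻¹) + 8 * K * w ≤ τ ^ 2 := by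
        refine le_trans ?_ hsmall
        rw [mul_add]
        have e2 : 8 * cd ≤ C' := by rw [hC']; linarith
        have e3 : 8 * K ≤ C' := by rw [hC']; linarith
        gcongr
      have e4 : μ ^ 2 ≤ (τ / 2) ^ 2 := by
        have e5 : μ ^ 2 ≤ 2 * d ^ 2 + 2 * (μ - d) ^ 2 := by nlinarith [sq_nonneg (μ - 2 * d)]
        have e6 : (μ - d) ^ 2 ≤ K * w := hb k
        nlinarith
      exact abs_le_of_sq_le_sq e4 (by positivity)
    · rw [hx]
      gcongr
      exact hv k
  · have hX := aemeasurable_empiricalCoeff (g := g) (N := N) (n := n)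
      (fun i => hξ.gaussian.aemeasurable i) ψ (J + j) k
    obtain ⟨hv0, hlaw⟩ := hξ.map_empiricalCoeff hN n g ψ (J + j) k
    refine (lintegral_sq_sub_hardThreshold_le hc₁ hv0 hX (hmom₁ hX hlaw hv0) _).trans
      (ENNReal.ofReal_le_ofReal ?_)
    rw [hy]
    gcongr
    · exact hv k
    · exact hb k
  · have e1 : 2 * M * x = C₂ * (M * ((τ ^ 2)⁻¹ ^ p * w ^ (p + 1))) +
        4 * cd * (M ^ (2 * r))⁻¹ := by
      rw [hx, hC₂, div_eq_mul_inv, mul_pow, mul_pow]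
      field_simp
      ring
    have e2 : 2 * N * y ≤ C₁ * (w + τ ^ 2) := by
      rw [hy, hC₁, mul_assoc (2 * (N : ℝ))]
      refine mul_le_mul_of_nonneg_left ?_ (by positivity)
      have e3 : 0 ≤ (4 * c₁ * V + 4 * K) * τ ^ 2 + 2 * w := by positivity
      calc _ ≤ 4 * c₁ * (V * w) + 4 * (K * w) + 2 * τ ^ 2 +
            ((4 * c₁ * V + 4 * K) * τ ^ 2 + 2 * w) := le_add_of_nonneg_right e3
        _ = _ := by ring
    have hQ : 0 ≤ (τ ^ 2)⁻¹ ^ p * w ^ (p + 1) := by positivity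
    have hR : 0 ≤ (M ^ (2 * r))⁻¹ := by positivity
    calc 2 * M * x + 2 * N * y
        ≤ C₂ * (M * ((τ ^ 2)⁻¹ ^ p * w ^ (p + 1))) + 4 * cd * (M ^ (2 * r))⁻¹ +
          C₁ * (w + τ ^ 2) := by rw [e1]; exact add_le_add_right e2 _
      _ ≤ C' * (n * ((τ ^ 2)⁻¹ ^ p * w ^ (p + 1))) + C' * (M ^ (2 * r))⁻¹ +
          C' * (w + τ ^ 2) := by
          have e3 : C₂ ≤ C' := by rw [hC']; linarith
          have e4 : 4 * cd ≤ C' := by rw [hC']; linarith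
          have e5 : C₁ ≤ C' := by rw [hC']; linarith
          gcongr
      _ = _ := by ring

/-- Beyond level q the risk is the deterministic d². The interior sums to O(M^(-2r)); the O(1)
boundary positions contribute O(1/M), and this term dictates the size of q. -/
theorem exists_sum_coeffRisk_truncated_le {S : Finset ℝ} {C B : ℝ} (hψ : PiecewiseHolder N ψ S C B)
    (hN : 0 < N) {r : ℕ} (hr : 1 ≤ r)
    (hmom : ∀ k < r, ∫ t in (0 : ℝ)..N, t ^ k * ψ t = 0)
    (hg : ContDiffOn ℝ r g (Set.Icc 0 1)) :
    ∃ C' ≥ 0, ∀ (n J q j : ℕ) (δ : ℕ → ℝ≥0∞), q < j →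
      ∑ k ∈ Finset.Icc (-(N : ℤ) + 1) ((N : ℤ) * 2 ^ (J + j) - 1),
        coeffRisk P ξ g N φ ψ n J q δ (Sum.inr (j, k)) ≤
      ENNReal.ofReal (C' * ((((N : ℝ) * 2 ^ (J + j)) ^ (2 * r))⁻¹ +
        ((N : ℝ) * 2 ^ (J + j))⁻¹)) := by
  obtain ⟨A, L, hA, hL, hgA, hgL⟩ := ContDiffOn.exists_bound_and_lipschitz hr hg
  obtain ⟨cd, hcd, hcoef⟩ := hψ.exists_sq_trueCoeff_le hN hr hmom hg
  have hB := hψ.bound_nonneg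
  refine ⟨2 * cd + 2 * N * (A * B * N) ^ 2, by positivity, fun n J q j δ hqj => ?_⟩
  have hrisk : ∀ k, coeffRisk P ξ g N φ ψ n J q δ (Sum.inr (j, k)) =
      ENNReal.ofReal (trueCoeff g (scaled N ψ (J + j) k) ^ 2) := fun k => by
    have : ¬ (j ∈ Finset.range (q + 1) ∧
        k ∈ Finset.Icc (-(N : ℤ) + 1) ((N : ℤ) * 2 ^ (J + j) - 1)) := fun h => by
      have := Finset.mem_range.1 h.1
      omega
    simp only [coeffRisk, estimatorCoeff, waveletSystem, if_neg this, sub_zero, lintegral_const,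
      measure_univ, mul_one]
  simp only [hrisk]
  set M : ℝ := (N : ℝ) * 2 ^ (J + j) with hM
  have hM0 : 0 < M := by positivity
  refine (sum_le_interior_add_boundary hN _ (x := cd * (M⁻¹ * (M ^ (2 * r))⁻¹))
    (y := (A * B * N) ^ 2 * M⁻¹) (by positivity) (by positivity)
    (fun k hk0 hkN => ENNReal.ofReal_le_ofReal (hcoef (J + j) k hk0 hkN))
    (fun k => ENNReal.ofReal_le_ofReal ?_)).trans (ENNReal.ofReal_le_ofReal ?_)
  · have h2 := pow_le_pow_left₀ (abs_nonneg _) (hψ.abs_trueCoeff_le hN hA hgA (J + j) k) 2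
    rwa [sq_abs, mul_pow, inv_pow, Real.sq_sqrt hM0.le] at h2
  · have hR : 0 ≤ (M ^ (2 * r))⁻¹ := by positivity
    calc 2 * M * (cd * (M⁻¹ * (M ^ (2 * r))⁻¹)) + 2 * N * ((A * B * N) ^ 2 * M⁻¹)
        = 2 * cd * (M ^ (2 * r))⁻¹ + 2 * N * (A * B * N) ^ 2 * M⁻¹ := by field_simp
      _ ≤ _ := by
        have e1 : 0 ≤ 2 * cd * M⁻¹ := by positivity
        have e2 : 0 ≤ 2 * N * (A * B * N) ^ 2 * (M ^ (2 * r))⁻¹ := by positivity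
        linarith

end Upper

theorem eventually_const_mul_rpow_neg_le (K : ℝ) {a ε : ℝ} (ha : 0 < a) (hε : 0 < ε) :
    ∀ᶠ n : ℕ in atTop, K * (n : ℝ) ^ (-a) ≤ ε := by
  have := ((tendsto_rpow_neg_atTop ha).comp tendsto_natCast_atTop_atTop).const_mul K
  rw [mul_zero] at this
  exact this.eventually_le_const hε

theorem admissibleLevel_of_le_rpow {κ : ℝ} (hκ : κ < 1) {J : ℕ → ℕ}
    (hJ : ∀ n : ℕ, 0 < n → (2 : ℝ) ^ J n ≤ (n : ℝ) ^ κ) : AdmissibleLevel J := by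
  refine Asymptotics.IsLittleO.of_bound fun c hc => ?_
  filter_upwards [eventually_const_mul_rpow_neg_le 1 (by linarith : 0 < 1 - κ) hc,
    eventually_gt_atTop 0] with n hn hn0
  have hn0' : (0 : ℝ) < n := by exact_mod_cast hn0
  rw [Real.norm_of_nonneg (by positivity), Real.norm_of_nonneg (by positivity)]
  rw [one_mul, neg_sub, Real.rpow_sub hn0', Real.rpow_one, div_le_iff₀ hn0'] at hn
  exact (hJ n hn0).trans hn

/-- The number of levels is logarithmic in x, hence below any positive power of x. -/
theorem natCast_succ_le_of_two_pow_le {q : ℕ} {x β ε : ℝ} (hx : 1 ≤ x) (hβ : β ≤ 1) (hε : 0 < ε)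
    (hq : (2 : ℝ) ^ q ≤ x ^ β) : (q : ℝ) + 1 ≤ (2 / ε + 1) * x ^ ε := by
  have hx0 : 0 < x := by linarith
  have h1 := Real.log_le_log (by positivity) hq
  rw [Real.log_pow, Real.log_rpow hx0] at h1
  have h2 := Real.log_nonneg hx
  have h3 : Real.log x ≤ x ^ ε / ε := Real.log_le_rpow_div hx0.le hε
  have h4 : (1 : ℝ) ≤ x ^ ε := Real.one_le_rpow hx hε.le
  have h5 : (q : ℝ) * (1 / 2) ≤ q * Real.log 2 := by
    have := Real.log_two_gt_d9
    gcongr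
    linarith
  have h6 : β * Real.log x ≤ 1 * Real.log x := by gcongr
  calc (q : ℝ) + 1 ≤ 2 * (x ^ ε / ε) + x ^ ε := by linarith
    _ = _ := by ring

section Upper

variable {Ω : Type*} [MeasurableSpace Ω] {P : Measure Ω} [IsProbabilityMeasure P]
  {N : ℕ} {φ ψ g : ℝ → ℝ} {ξ : ℕ → Ω → ℝ} {γ : ℕ → ℝ} {Cγ α : ℝ}

theorem exists_eventually_MISE_le (hwav : IsWaveletPair N φ ψ) (hN : 0 < N)
    (hφ : WaveletRegular N φ) (hψ : WaveletRegular N ψ) {r : ℕ} (hr : 1 ≤ r)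
    (hmom : HasVanishingMoments N ψ r) (h0 : 0 < α) (h1 : α < 1) (hCγ : 0 < Cγ)
    (hξ : IsLongMemoryGaussian P ξ γ Cγ α) (hg : ContDiffOn ℝ r g (Set.Icc 0 1)) :
    ∃ C : ℝ, 0 < C ∧ ∃ (J q : ℕ → ℕ) (δ : ℕ → ℕ → ℝ≥0∞), AdmissibleLevel J ∧
      ∀ᶠ n : ℕ in atTop, MISE P ξ g N φ ψ n (J n) (q n) (δ n) ≤
        ENNReal.ofReal (C * (n : ℝ) ^ (-(2 * r * α / (2 * r + α)))) := by
  obtain ⟨_, _, _, hfφ⟩ := hφ.piecewiseHolder hwav.support_father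
  obtain ⟨_, _, _, hfψ⟩ := hψ.piecewiseHolder hwav.support_mother
  have hr1 : (1 : ℝ) ≤ r := by exact_mod_cast hr
  have hN1 : (1 : ℝ) ≤ N := by exact_mod_cast hN
  set κ := α / (2 * r + α) with hκ
  set β := 2 * r * α / (2 * r + α) with hβ
  have hden : 0 < 2 * (r : ℝ) + α := by linarith
  have hκ0 : 0 < κ := by positivity
  have hβ0 : 0 < β := by positivity
  have hκ1 : κ < 1 := by rw [hκ, div_lt_one hden]; linarith
  have hβα : β < α := by rw [hβ, div_lt_iff₀ hden]; nlinarith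
  have hκβ : κ + β < 1 := by
    rw [hκ, hβ, ← add_div, div_lt_one hden]
    nlinarith
  -- Since M^(-1-2r) is of order at most n^(-κ-β), this inequality places d² for interior
  -- coefficients below a multiple of the noise level n^(-α).
  have hκβα : α ≤ κ + β := by
    rw [hκ, hβ, ← add_div, le_div_iff₀ hden]
    nlinarith
  have hβκ : κ * (2 * r) = β := by rw [hκ, hβ]; ring
  have hκα : (κ - 1) * α = -β := by rw [hκ, hβ]; field_simp; ring
  -- The squared threshold n^(-β') must exceed the noise n^(-α) by a power of n and stay below the
  -- target n^(-β) by another power. The number p of moments is such that p (α - β') ≥ 1, which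
  -- compensates the factor n from the number of positions.
  obtain ⟨β', hβ'1, hβ'2⟩ := exists_between hβα
  obtain ⟨p, hp⟩ := exists_nat_ge (1 / (α - β'))
  rw [div_le_iff₀ (by linarith)] at hp
  obtain ⟨C₁, hC₁, key₁⟩ := exists_sum_coeffRisk_father_le hfφ hN hr h0 h1 hCγ hξ hg
  obtain ⟨C₂, hC₂, key₂⟩ := exists_sum_coeffRisk_mother_le hfψ hN hr hmom.1 h0 h1 hCγ hξ hg p
  obtain ⟨C₃, hC₃, key₃⟩ := exists_sum_coeffRisk_truncated_le (P := P) (ξ := ξ) (φ := φ)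
    hfψ hN hr hmom.1 hg
  have hlevel : ∀ {η : ℝ}, 0 ≤ η → ∃ m : ℕ → ℕ, ∀ n : ℕ, 0 < n →
      (2 : ℝ) ^ m n ≤ (n : ℝ) ^ η ∧ (n : ℝ) ^ η / 2 ≤ 2 ^ m n := fun hη => by
    choose m hm using fun (n : ℕ) (hn : 0 < n) => exists_dyadic_level hη hn
    exact ⟨fun n => if hn : 0 < n then m n hn else 0, fun n hn => by simpa [hn] using hm n hn⟩
  obtain ⟨J, hJ⟩ := hlevel hκ0.le
  -- The omitted boundary coefficients cost at most a multiple of 2^(-q), so 2^q of order n^β is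
  -- enough. All kept levels still satisfy M ≤ n for large n because κ + β < 1.
  obtain ⟨q, hq⟩ := hlevel hβ0.le
  set ε := β' - β with hε
  have hε0 : 0 < ε := by linarith
  refine ⟨C₁ * N ^ α + 2 * ((C₂ + C₃) * 4 ^ r) + (2 / ε + 1) * (3 * C₂) + C₃ * 2 + 1,
    by positivity, J, q, fun n _ => ENNReal.ofReal (√((n : ℝ) ^ (-β'))),
    admissibleLevel_of_le_rpow hκ1 fun n hn => (hJ n hn).1, ?_⟩
  -- The second condition says M ≤ n at all levels up to q; the third is the smallness condition on
  -- the threshold.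
  filter_upwards [eventually_gt_atTop 0,
    eventually_const_mul_rpow_neg_le N (by linarith : 0 < 1 - (κ + β)) one_pos,
    eventually_const_mul_rpow_neg_le (C₂ * (2 * 4 ^ r + 1)) (by linarith : 0 < α - β') one_pos]
    with n hn hn2 hn3
  have hn0 : (0 : ℝ) < n := by exact_mod_cast hn
  have hn1 : (1 : ℝ) ≤ n := by exact_mod_cast hn
  obtain ⟨hJ1, hJ2⟩ := hJ n hn
  obtain ⟨hq1, hq2⟩ := hq n hn
  have hMn : ∀ j ≤ q n, (N : ℝ) * 2 ^ (J n + j) ≤ n := fun j hj => by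
    rw [neg_sub, Real.rpow_sub hn0, Real.rpow_one, ← mul_div_assoc, div_le_one hn0,
      Real.rpow_add hn0] at hn2
    refine le_trans ?_ hn2
    rw [pow_add]
    have : (2 : ℝ) ^ j ≤ 2 ^ q n := pow_le_pow_right₀ (by norm_num) hj
    gcongr
    exact this.trans hq1
  have hM1 : ∀ j, (2 : ℝ) ^ (J n + j) ≤ (N : ℝ) * 2 ^ (J n + j) := fun j =>
    le_mul_of_one_le_left (by positivity) hN1
  have hinv : ∀ j, ((N : ℝ) * 2 ^ (J n + j))⁻¹ ≤ 2 * (n : ℝ) ^ (-κ) * (1 / 2) ^ j := fun j => by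
    calc ((N : ℝ) * 2 ^ (J n + j))⁻¹ ≤ ((n : ℝ) ^ κ / 2 * 2 ^ j)⁻¹ := by
          refine inv_anti₀ (by positivity) ((le_trans ?_ (hM1 j)))
          rw [pow_add]
          gcongr
      _ = _ := by rw [Real.rpow_neg hn0.le, one_div, inv_pow]; field_simp
  have hinv' : ∀ j, ((N : ℝ) * 2 ^ (J n + j))⁻¹ ≤ (1 / 2) ^ j := fun j => by
    rw [one_div, inv_pow]
    refine inv_anti₀ (by positivity) (le_trans ?_ (hM1 j))
    exact pow_le_pow_right₀ (by norm_num) (by omega)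
  have hhalf : ∀ j : ℕ, ((1 : ℝ) / 2) ^ j ≤ 1 := fun j => pow_le_one₀ (by norm_num) (by norm_num)
  have hinvr : ∀ j, (((N : ℝ) * 2 ^ (J n + j)) ^ (2 * r))⁻¹ ≤
      4 ^ r * (n : ℝ) ^ (-β) * (1 / 2) ^ j := fun j => by
    calc (((N : ℝ) * 2 ^ (J n + j)) ^ (2 * r))⁻¹ = (((N : ℝ) * 2 ^ (J n + j))⁻¹) ^ (2 * r) :=
          (inv_pow _ _).symm
      _ ≤ (2 * (n : ℝ) ^ (-κ) * (1 / 2) ^ j) ^ (2 * r) := by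
          gcongr
          exact hinv j
      _ = 4 ^ r * (n : ℝ) ^ (-β) * ((1 / 2) ^ j) ^ (2 * r) := by
          rw [mul_pow, mul_pow, pow_mul 2 2 r, ← Real.rpow_natCast ((n : ℝ) ^ (-κ)),
            ← Real.rpow_mul hn0.le]
          norm_num
          rw [hβκ]
      _ ≤ 4 ^ r * (n : ℝ) ^ (-β) * (1 / 2) ^ j := by
          gcongr
          exact pow_le_of_le_one (by positivity) (hhalf j) (by omega)
  have hτ0 : (0 : ℝ) ≤ (n : ℝ) ^ (-β') := by positivity
  have hτ : √((n : ℝ) ^ (-β')) ^ 2 = (n : ℝ) ^ (-β') := Real.sq_sqrt hτ0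
  have hαβ' : (n : ℝ) ^ (-α) = (n : ℝ) ^ (-(α - β')) * (n : ℝ) ^ (-β') := by
    rw [← Real.rpow_add hn0]
    congr 1
    ring
  have hlow : ∀ j ≤ q n, ∑ k ∈ Finset.Icc (-(N : ℤ) + 1) ((N : ℤ) * 2 ^ (J n + j) - 1),
      coeffRisk P ξ g N φ ψ n (J n) (q n) (fun _ => ENNReal.ofReal (√((n : ℝ) ^ (-β'))))
        (Sum.inr (j, k)) ≤
      ENNReal.ofReal ((C₂ + C₃) * (4 ^ r * (n : ℝ) ^ (-β)) * (1 / 2) ^ j +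
        3 * C₂ * (n : ℝ) ^ (-β')) := fun j hj => by
    refine (key₂ n (J n) (q n) j _ (√((n : ℝ) ^ (-β'))) hn (hMn j hj) hj (by positivity) rfl
      ?_).trans (ENNReal.ofReal_le_ofReal ?_)
    · rw [hτ]
      have e1 : ((N : ℝ) * 2 ^ (J n + j))⁻¹ * (((N : ℝ) * 2 ^ (J n + j)) ^ (2 * r))⁻¹ ≤
          2 * 4 ^ r * (n : ℝ) ^ (-α) := by
        calc _ ≤ (2 * (n : ℝ) ^ (-κ) * (1 / 2) ^ j) * (4 ^ r * (n : ℝ) ^ (-β) * (1 / 2) ^ j) := by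
              gcongr
              · exact hinv j
              · exact hinvr j
          _ ≤ (2 * (n : ℝ) ^ (-κ) * 1) * (4 ^ r * (n : ℝ) ^ (-β) * 1) := by
              gcongr <;> exact hhalf j
          _ = 2 * 4 ^ r * (n : ℝ) ^ (-(κ + β)) := by
              rw [neg_add, Real.rpow_add hn0]
              ring
          _ ≤ _ := by
              gcongr
      calc _ ≤ C₂ * (2 * 4 ^ r * (n : ℝ) ^ (-α) + (n : ℝ) ^ (-α)) := by gcongr
        _ = C₂ * (2 * 4 ^ r + 1) * (n : ℝ) ^ (-(α - β')) * (n : ℝ) ^ (-β') := by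
            rw [hαβ']
            ring
        _ ≤ 1 * (n : ℝ) ^ (-β') := by gcongr
        _ = _ := one_mul _
    · rw [hτ]
      have e1 : (n : ℝ) * (((n : ℝ) ^ (-β'))⁻¹ ^ p * ((n : ℝ) ^ (-α)) ^ (p + 1)) ≤
          (n : ℝ) ^ (-β') := by
        rw [← Real.rpow_neg hn0.le, neg_neg, ← Real.rpow_natCast, ← Real.rpow_natCast,
          ← Real.rpow_mul hn0.le, ← Real.rpow_mul hn0.le, ← Real.rpow_add hn0]
        nth_rewrite 1 [← Real.rpow_one (n : ℝ)]
        rw [← Real.rpow_add hn0]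
        refine Real.rpow_le_rpow_of_exponent_le hn1 ?_
        push_cast
        nlinarith
      have e2 : (n : ℝ) ^ (-α) ≤ (n : ℝ) ^ (-β') :=
        Real.rpow_le_rpow_of_exponent_le hn1 (by linarith)
      have e3 : 0 ≤ C₃ * (4 ^ r * (n : ℝ) ^ (-β) * (1 / 2) ^ j) := by positivity
      calc _ ≤ C₂ * (4 ^ r * (n : ℝ) ^ (-β) * (1 / 2) ^ j +
            ((n : ℝ) ^ (-β') + (n : ℝ) ^ (-β') + (n : ℝ) ^ (-β'))) := by
            gcongr
            exact hinvr j
        _ ≤ _ := by linarith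
  have hhigh : ∀ j, q n < j → ∑ k ∈ Finset.Icc (-(N : ℤ) + 1) ((N : ℤ) * 2 ^ (J n + j) - 1),
      coeffRisk P ξ g N φ ψ n (J n) (q n) (fun _ => ENNReal.ofReal (√((n : ℝ) ^ (-β'))))
        (Sum.inr (j, k)) ≤
      ENNReal.ofReal ((C₂ + C₃) * (4 ^ r * (n : ℝ) ^ (-β)) * (1 / 2) ^ j + C₃ * (1 / 2) ^ j) :=
    fun j hj => by
    refine (key₃ n (J n) (q n) j _ hj).trans (ENNReal.ofReal_le_ofReal ?_)
    have e3 : 0 ≤ C₂ * (4 ^ r * (n : ℝ) ^ (-β) * (1 / 2) ^ j) := by positivity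
    calc _ ≤ C₃ * (4 ^ r * (n : ℝ) ^ (-β) * (1 / 2) ^ j + (1 / 2) ^ j) := by
          gcongr
          · exact hinvr j
          · exact hinv' j
      _ ≤ _ := by linarith
  have hfather := key₁ n (J n) (q n) (fun _ => ENNReal.ofReal (√((n : ℝ) ^ (-β')))) hn
    (by simpa using hMn 0 (Nat.zero_le _))
  refine (MISE_le_sum_add_tsum hwav hN hφ hψ (fun i => hξ.gaussian.aemeasurable i)
    hg.continuousOn).trans ((add_le_add hfather (tsum_ofReal_level_le (by positivity)
      (by positivity) hC₃ hlow hhigh)).trans ?_)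
  rw [← ENNReal.ofReal_add (by positivity) (by positivity)]
  refine ENNReal.ofReal_le_ofReal ?_
  have f1 : ((N : ℝ) * 2 ^ J n / n) ^ α ≤ N ^ α * (n : ℝ) ^ (-β) := by
    calc ((N : ℝ) * 2 ^ J n / n) ^ α ≤ (N * (n : ℝ) ^ (κ - 1)) ^ α := by
          refine Real.rpow_le_rpow (by positivity) ?_ h0.le
          rw [Real.rpow_sub hn0, Real.rpow_one, ← mul_div_assoc]
          gcongr
      _ = _ := by rw [Real.mul_rpow (by positivity) (by positivity), ← Real.rpow_mul hn0.le, hκα]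
  have f2 : ((q n : ℝ) + 1) * (3 * C₂ * (n : ℝ) ^ (-β')) ≤
      (2 / ε + 1) * (3 * C₂) * (n : ℝ) ^ (-β) := by
    calc _ ≤ (2 / ε + 1) * (n : ℝ) ^ ε * (3 * C₂ * (n : ℝ) ^ (-β')) := by
          gcongr
          exact natCast_succ_le_of_two_pow_le hn1 (by linarith) hε0 hq1
      _ = (2 / ε + 1) * (3 * C₂) * ((n : ℝ) ^ ε * (n : ℝ) ^ (-β')) := by ring
      _ = _ := by
          rw [← Real.rpow_add hn0, hε]
          congr 2
          ring
  have f3 : ((1 : ℝ) / 2) ^ q n ≤ 2 * (n : ℝ) ^ (-β) := by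
    rw [one_div, inv_pow, Real.rpow_neg hn0.le]
    calc ((2 : ℝ) ^ q n)⁻¹ ≤ ((n : ℝ) ^ β / 2)⁻¹ := inv_anti₀ (by positivity) hq2
      _ = _ := by field_simp
  have f4 : 0 ≤ (n : ℝ) ^ (-β) := by positivity
  calc _ ≤ C₁ * (N ^ α * (n : ℝ) ^ (-β)) + (2 * ((C₂ + C₃) * (4 ^ r * (n : ℝ) ^ (-β))) +
        (2 / ε + 1) * (3 * C₂) * (n : ℝ) ^ (-β) + C₃ * (2 * (n : ℝ) ^ (-β))) := by gcongr
    _ = (C₁ * N ^ α + 2 * ((C₂ + C₃) * 4 ^ r) + (2 / ε + 1) * (3 * C₂) + C₃ * 2) *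
        (n : ℝ) ^ (-β) := by ring
    _ ≤ _ := mul_le_mul_of_nonneg_right (le_add_of_nonneg_right zero_le_one) f4

theorem IsWaveletPair.pos (hwav : IsWaveletPair N φ ψ) : 0 < N := by
  refine Nat.pos_of_ne_zero fun hN => ?_
  have := hwav.integral_father
  simp [hN] at this

end Upper

end LongMemoryWavelet

theorem theorem1 {Ω : Type*} [MeasurableSpace Ω] (P : Measure Ω) [IsProbabilityMeasure P]
    (N : ℕ) (φ ψ : ℝ → ℝ) (hwav : LongMemoryWavelet.IsWaveletPair N φ ψ)
    (hφ : LongMemoryWavelet.WaveletRegular N φ) (hψ : LongMemoryWavelet.WaveletRegular N ψ)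
    (r : ℕ) (hr : 1 ≤ r) (hmom : LongMemoryWavelet.HasVanishingMoments N ψ r)
    (α Cγ : ℝ) (hα₀ : 0 < α) (hα₁ : α < 1) (hCγ : 0 < Cγ)
    (ξ : ℕ → Ω → ℝ) (γ : ℕ → ℝ) (hξ : LongMemoryWavelet.IsLongMemoryGaussian P ξ γ Cγ α)
    (g : ℝ → ℝ) (hg : ContDiffOn ℝ r g (Set.Icc 0 1))
    (hsupp : 0 < volume {t ∈ Set.Icc (0 : ℝ) 1 | iteratedDerivWithin r g (Set.Icc 0 1) t ≠ 0}) :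
    ∃ c C : ℝ, 0 < c ∧ 0 < C ∧
      (∃ (J q : ℕ → ℕ) (δ : ℕ → ℕ → ℝ≥0∞), LongMemoryWavelet.AdmissibleLevel J ∧
        ∀ᶠ n : ℕ in atTop, LongMemoryWavelet.MISE P ξ g N φ ψ n (J n) (q n) (δ n) ≤
          ENNReal.ofReal (C * (n : ℝ) ^ (-(2 * r * α / (2 * r + α))))) ∧
      (∀ J : ℕ → ℕ, LongMemoryWavelet.AdmissibleLevel J →
        ∀ᶠ n : ℕ in atTop, ∀ (q : ℕ) (δ : ℕ → ℝ≥0∞),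
          ENNReal.ofReal (c * (n : ℝ) ^ (-(2 * r * α / (2 * r + α)))) ≤
            LongMemoryWavelet.MISE P ξ g N φ ψ n (J n) q δ) := by

  have hN := hwav.pos
  obtain ⟨c, hc, hlower⟩ := LongMemoryWavelet.exists_eventually_le_MISE hwav hN hφ hψ hr hmom
    hα₀ hα₁ hCγ hξ hg hsupp
  obtain ⟨C, hC, hupper⟩ := LongMemoryWavelet.exists_eventually_MISE_le hwav hN hφ hψ hr hmom
    hα₀ hα₁ hCγ hξ hg
  exact ⟨c, C, hc, hC, hupper, hlower⟩
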